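/- \textbf{Setting.} Let $d\ge 1$, let $A^*\in\mathbb{R}^{d\times d}$ with $\|A^*\|<1$ (operator norm), and let $\mu$ be a probability law on $\mathbb{R}^d$ with mean zero and full-rank covariance $\Sigma$ such that for $\eta\sim\mu$ and every $x\in\mathbb{R}^d$ the variable $\langle x,\eta\rangle$ is sub-Gaussian with variance proxy $C_\mu\langle x,\Sigma x\rangle$. Let $\pi$ be the stationary distribution of the chain $X\mapsto A^*X+\eta$ and $G=\mathbb{E}_{X\sim\pi}XX^\top$. Let $X_0\sim\pi$ be independent of the i.i.d. noise $\eta_0,\dots,\eta_{T-1}\sim\mu$, and let $X_{\tau+1}=A^*X_\tau+\eta_\tau$ for $0\le\tau<T$. Write $\sigma_{\max},\sigma_{\min}$ for the extreme singular values, $\kappa(G)=\sigma_{\max}(G)/\sigma_{\min}(G)$, and $\lambda_{\min}(G)$ for the smallest eigenvalue. \textbf{Algorithm (SGD-RER).} Given a buffer size $B\ge 1$, a gap $u\ge 0$, a step size $\gamma$, a bound $R$ and a deterministic $A_0$, put $S=B+u$ and $A^0_0=A_0$. For $t=1,2,\dots$ with $tS\le T$ and $0\le i<B$ put $$A^{t-1}_{i+1}=A^{t-1}_i-2\gamma\bigl(A^{t-1}_iX_{(t-1)S+S-1-i}-X_{(t-1)S+S-i}\bigr)X_{(t-1)S+S-1-i}^\top,\qquad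 A^t_0=A^{t-1}_B .$$ For $a<t$ the output after $t$ buffers is $\hat A_{a,t}=\frac1{t-a}\sum_{\tau=a+1}^tA^{\tau-1}_B$, except that $\hat A_{a,t}=0$ if $\|X_\tau\|^2>R$ for some $\tau<tS$. \textbf{Theorem.} For all $C_\mu,\alpha_0>0$ there are constants $c,K,C,c_0,c_1>0$ depending only on $C_\mu,\alpha_0$; for every $M\ge 0$ there is $c_4>0$ depending only on these and $M$; and for all $C_\gamma,c_R>0$ there are $c_2,c_3>0$ depending only on the preceding quantities, such that the following holds in the setting above whenever $\|A_0\|\le M$. Let $\alpha\ge\alpha_0$ with $c_R\ge K\alpha$, and choose $$R=c_R\,\mathrm{tr}(G)\log T,\qquad \gamma=\min\Bigl(\frac{C_\gamma}{B\lambda_{\min}(G)},\frac1{8BR}\Bigr).$$ Let $a<t$ with $t(B+u)\le T$, $T^{\alpha/2}>c\,d\,\kappa(G)$ and $a>c_0(d+\alpha\log T)$. Then with probability at least $1-C/T^\alpha$, $$\|\hat A_{a,t}-A^*\|\le c_1\sqrt{\frac{(d+\alpha\log T)\,\sigma_{\max}(\Sigma)}{(t-a)B\lambda_{\min}(G)}}+\beta_b\|A_0-A^*\|+c_4\frac{T^2}{B^2}\|(A^*)^u\|,$$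 where $$\beta_b=c_3\,\frac{d\,\kappa(G)\log T}{t-a}\,\exp\Bigl(-c_2\frac{a}{d\,\kappa(G)\log T}\Bigr).$$ -/

import Mathlib

open MeasureTheory ProbabilityTheory
open scoped RealInnerProductSpace

namespace SGDRER

/-- Euclidean `ℝ^d`.  Real `d × d` matrices are identified with the linear operators on it, so that
`‖·‖` on them is the operator norm. -/
abbrev E (d : ℕ) : Type := EuclideanSpace ℝ (Fin d)

/-- Real `d × d` matrices, as linear operators on Euclidean space. -/
abbrev Mat (d : ℕ) : Type := E d →L[ℝ] E d

/-- The matrix `x yᵀ`. -/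
noncomputable def outer {d : ℕ} (x y : E d) : Mat d := InnerProductSpace.rankOne ℝ x y

/-- The second moment matrix `𝔼 [Z Zᵀ]` for `Z ∼ ν`, which is the covariance matrix when `ν` has
mean zero. -/
noncomputable def covMat {d : ℕ} (ν : Measure (E d)) : Mat d := covarianceOperator ν

/-- The trace of a matrix. -/
noncomputable def tr {d : ℕ} (M : Mat d) : ℝ := LinearMap.trace ℝ (E d) (M : E d →ₗ[ℝ] E d)

/-- The largest singular value. -/
noncomputable def sigmaMax {d : ℕ} (M : Mat d) : ℝ :=
  LinearMap.singularValues (M : E d →ₗ[ℝ] E d) 0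

/-- The smallest singular value (the `d`-th one; Mathlib numbers them from `0`). -/
noncomputable def sigmaMin {d : ℕ} (M : Mat d) : ℝ :=
  LinearMap.singularValues (M : E d →ₗ[ℝ] E d) (d - 1)

/-- The condition number. -/
noncomputable def kappa {d : ℕ} (M : Mat d) : ℝ := sigmaMax M / sigmaMin M

/-- The smallest eigenvalue of a symmetric matrix. -/
noncomputable def lambdaMin {d : ℕ} (M : Mat d) : ℝ :=
  sInf {c : ℝ | Module.End.HasEigenvalue (M : E d →ₗ[ℝ] E d) c}

/-- The noise law: mean zero, full rank covariance `Σ`, and `⟨x, η⟩` is sub-Gaussian with variance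
proxy `Cμ ⟨x, Σ x⟩` for every `x`. -/
structure IsSubGaussianNoise {d : ℕ} (Cμ : ℝ) (μ : Measure (E d)) : Prop where
  isProbabilityMeasure : IsProbabilityMeasure μ
  mean_zero : ∫ z, z ∂μ = 0
  full_rank : LinearMap.range (covMat μ : E d →ₗ[ℝ] E d) = ⊤
  subGaussian : ∀ x : E d,
    HasSubgaussianMGF (fun z : E d => ⟪x, z⟫) (Cμ * ⟪x, covMat μ x⟫).toNNReal μ

/-- `π` is a stationary distribution of the chain `X ↦ A X + η`, `η ∼ μ` independent of `X`. -/
structure IsStationaryLaw {d : ℕ} (A : Mat d) (μ π : Measure (E d)) : Prop where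
  isProbabilityMeasure : IsProbabilityMeasure π
  invariant : (π.prod μ).map (fun p : E d × E d => A p.1 + p.2) = π

/-- `X 0, …, X T` is a sample of the `VAR(A, μ)` model with i.i.d. noise `η 0, …, η (T - 1)` of law
`μ`, started from an `X 0` that is independent of the noise and has law `π`. -/
structure IsVAR {d : ℕ} {Ω : Type*} [MeasurableSpace Ω] (A : Mat d) (μ π : Measure (E d)) (T : ℕ)
    (P : Measure Ω) (X η : ℕ → Ω → E d) : Prop where
  measurable_init : Measurable (X 0)
  init_law : P.map (X 0) = π
  measurable_noise : ∀ τ < T, Measurable (η τ)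
  noise_law : ∀ τ < T, P.map (η τ) = μ
  noise_indep : iIndepFun (fun τ : Fin T => η τ) P
  init_indep : IndepFun (X 0) (fun ω => fun τ : Fin T => η τ ω) P
  recursion : ∀ τ < T, ∀ ω, X (τ + 1) ω = A (X τ ω) + η τ ω

/-- One gradient step `A ↦ A - 2 γ (A x - y) xᵀ` for the transition `(x, y)`. -/
noncomputable def sgdStep {d : ℕ} (γ : ℝ) (A : Mat d) (x y : E d) : Mat d :=
  A - (2 * γ) • outer (A x - y) x

/-- The iterate after `i` steps inside buffer `s`, started from `A`.  The buffer holds the samples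
`X (s S), …, X (s S + S - 1)`, `S = B + u`, and its transitions are processed in reverse order. -/
noncomputable def bufferIterate {d : ℕ} (γ : ℝ) (B u : ℕ) (X : ℕ → E d) (s : ℕ) (A : Mat d) :
    ℕ → Mat d
  | 0 => A
  | i + 1 => sgdStep γ (bufferIterate γ B u X s A i)
      (X (s * (B + u) + (B + u - 1 - i))) (X (s * (B + u) + (B + u - i)))

/-- The iterate after the first `t` buffers have been processed, `B` steps in each. -/
noncomputable def rerIterate {d : ℕ} (γ : ℝ) (B u : ℕ) (A₀ : Mat d) (X : ℕ → E d) : ℕ → Mat d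
  | 0 => A₀
  | t + 1 => bufferIterate γ B u X t (rerIterate γ B u A₀ X t) B

open scoped Classical in
/-- The output of SGD with reverse experience replay after the first `t` buffers: the average of the
end-of-buffer iterates number `a + 1, …, t`, or the zero matrix if the algorithm has stopped because
some sample in one of these buffers has squared norm larger than `R`. -/
noncomputable def sgdRER {d : ℕ} (γ R : ℝ) (B u a t : ℕ) (A₀ : Mat d) (X : ℕ → E d) : Mat d :=
  if ∃ τ < t * (B + u), R < ‖X τ‖ ^ 2 then 0
  else ((t : ℝ) - a)⁻¹ • ∑ s ∈ Finset.Ioc a t, rerIterate γ B u A₀ X s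

/-- The bias factor `β_b`. -/
noncomputable def biasFactor (c₂ c₃ : ℝ) (d a t T : ℕ) (κ : ℝ) : ℝ :=
  c₃ * (d * κ * Real.log T / ((t : ℝ) - a)) * Real.exp (-(c₂ * (a / (d * κ * Real.log T))))

end SGDRER

namespace SGDRER

/-! The error of the iterate obeys an affine recursion `D (s + 1) = D s * H s + V s` over buffers.
Because transitions are replayed backwards, `H s` is the product of the factors `1 - 2γ x xᵀ` with
the earliest sample rightmost, and in `V s` each noise vector `η k` is multiplied only by samples up
to its own time, of which it is independent. The noise therefore keeps its martingale structure in
spite of the dependence of the data.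

One identity controls everything: a step at `x` lowers `‖w‖²` by at least `2γ⟪x, w⟫²`. This energy
loss pays for the sub-Gaussian variance of the noise, so `exp (l⟪v, V w⟫ - l²γσ(‖w‖² - ‖H w‖²))` has
mean at most one (`IsChain.lintegral_exp_noiseSum_le_one`). It also gives contraction: in a moment
of order `2r` with `r` of order `1/(γBλ_min)`, every buffer shrinks a fixed vector by a constant
factor (`IsChain.lintegral_norm_contraction_rpow_le`), by first and second moment bounds for the
empirical quadratic form.

Buffers become independent once each is restarted from a fresh stationary state with the same noise.
After the gap the two paths differ by at most `2√R ‖A^u‖`, and the algorithm is stable under such a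
change; this produces the last term of the bound. Truncation of samples at `‖x‖² ≤ R` makes the
deterministic estimates hold surely, and the sub-Gaussian tail of the stationary law makes it
inactive with high probability.

The sum of the last iterates is unrolled from the end (`sum_Ioc_eq_tailWeight`): the noise `V` of a
buffer meets a weight built from later buffers only, so the exponential bounds multiply along a
backward filtration. The total energy telescopes and is at most `2mq` for `m` averaged iterates and
weights of norm at most `q` (`sum_energy_tailWeight_le`). A net argument shows that products of at
least `c₀(d + α log T)` contractions decay geometrically, whence `q` is of order `1/(γBλ_min)` and
the step size cancels from the fluctuation term. The weight on the initial error is the bias term.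
-/

/-! ### Algebra of rank-one matrices -/

theorem outer_apply {d : ℕ} (x y w : E d) : outer x y w = ⟪y, w⟫ • x := rfl

theorem norm_outer {d : ℕ} (x y : E d) : ‖outer x y‖ = ‖x‖ * ‖y‖ :=
  InnerProductSpace.norm_rankOne x y

theorem mul_outer {d : ℕ} (A : Mat d) (x y : E d) : A * outer x y = outer (A x) y := by
  ext1 w
  simp [outer_apply]

theorem mul_smul_mat {d : ℕ} (A B : Mat d) (c : ℝ) : A * c • B = c • (A * B) := by
  ext1 w
  simp

theorem smul_mul_mat {d : ℕ} (A B : Mat d) (c : ℝ) : c • A * B = c • (A * B) := by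
  ext1 w
  simp

theorem outer_add_left {d : ℕ} (x y z : E d) : outer (x + y) z = outer x z + outer y z := by
  ext1 w
  simp [outer_apply]

theorem outer_sub_left {d : ℕ} (x y z : E d) : outer (x - y) z = outer x z - outer y z := by
  ext1 w
  simp [outer_apply, smul_sub]

theorem outer_sub_right {d : ℕ} (x y z : E d) : outer x (y - z) = outer x y - outer x z := by
  ext1 w
  simp [outer_apply, inner_sub_left, sub_smul]

/-! ### Energy and noise within one buffer -/

/-- The matrix `1 - 2 γ x xᵀ` that multiplies the error in a gradient step at `x`. -/
noncomputable def stepFactor {d : ℕ} (γ : ℝ) (x : E d) : Mat d := 1 - (2 * γ) • outer x x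

/-- The product of the step factors of the samples `x 0, …, x (n - 1)`, later samples on the left. -/
noncomputable def contraction {d : ℕ} (γ : ℝ) (x : ℕ → E d) : ℕ → Mat d
  | 0 => 1
  | k + 1 => stepFactor γ (x k) * contraction γ x k

/-- The noise accumulated by the samples `x 0, …, x (n - 1)` with noise `z 0, …, z (n - 1)`. -/
noncomputable def noiseSum {d : ℕ} (γ : ℝ) (x z : ℕ → E d) : ℕ → Mat d
  | 0 => 0
  | k + 1 => noiseSum γ x z k + (2 * γ) • (outer (z k) (x k) * contraction γ x k)

theorem stepFactor_apply {d : ℕ} (γ : ℝ) (x w : E d) :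
    stepFactor γ x w = w - (2 * γ * ⟪x, w⟫) • x := by
  simp [stepFactor, outer_apply, smul_smul]

theorem norm_sq_stepFactor_apply {d : ℕ} (γ : ℝ) (x w : E d) :
    ‖stepFactor γ x w‖ ^ 2 = ‖w‖ ^ 2 - 4 * γ * (1 - γ * ‖x‖ ^ 2) * ⟪x, w⟫ ^ 2 := by
  rw [stepFactor_apply, norm_sub_sq_real, inner_smul_right, norm_smul, real_inner_comm, mul_pow,
    Real.norm_eq_abs, sq_abs]
  ring

theorem norm_sq_stepFactor_apply_le {d : ℕ} {γ : ℝ} (hγ : 0 ≤ γ) {x : E d}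
    (hx : γ * ‖x‖ ^ 2 ≤ 1 / 2) (w : E d) :
    ‖stepFactor γ x w‖ ^ 2 ≤ ‖w‖ ^ 2 - 2 * γ * ⟪x, w⟫ ^ 2 := by
  rw [norm_sq_stepFactor_apply]
  have : 0 ≤ γ * ⟪x, w⟫ ^ 2 * (1 / 2 - γ * ‖x‖ ^ 2) :=
    mul_nonneg (by positivity) (by linarith)
  nlinarith

theorem norm_stepFactor_le {d : ℕ} {γ : ℝ} (hγ : 0 ≤ γ) {x : E d} (hx : γ * ‖x‖ ^ 2 ≤ 1 / 2) :
    ‖stepFactor γ x‖ ≤ 1 := by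
  refine ContinuousLinearMap.opNorm_le_bound _ zero_le_one fun w => ?_
  rw [one_mul]
  refine le_of_sq_le_sq ((norm_sq_stepFactor_apply_le hγ hx w).trans ?_) (norm_nonneg _)
  have : 0 ≤ 2 * γ * ⟪x, w⟫ ^ 2 := by positivity
  linarith

theorem contraction_succ_apply {d : ℕ} (γ : ℝ) (x : ℕ → E d) (k : ℕ) (w : E d) :
    contraction γ x (k + 1) w = stepFactor γ (x k) (contraction γ x k w) := rfl

/-- Telescoped energy loss. The left side is, up to scale, the conditional variance of the noise
accumulated along the same trajectory. -/
theorem sum_sq_le_norm_sq_sub_contraction {d : ℕ} {γ : ℝ} (hγ : 0 ≤ γ) {x : ℕ → E d}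
    (hx : ∀ k, γ * ‖x k‖ ^ 2 ≤ 1 / 2) (n : ℕ) (w : E d) :
    2 * γ * ∑ k ∈ Finset.range n, ⟪x k, contraction γ x k w⟫ ^ 2 ≤
      ‖w‖ ^ 2 - ‖contraction γ x n w‖ ^ 2 := by
  induction n with
  | zero => simp [contraction]
  | succ n ih =>
    have := norm_sq_stepFactor_apply_le hγ (hx n) (contraction γ x n w)
    rw [Finset.sum_range_succ, contraction_succ_apply]
    linarith

theorem norm_contraction_apply_le {d : ℕ} {γ : ℝ} (hγ : 0 ≤ γ) {x : ℕ → E d}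
    (hx : ∀ k, γ * ‖x k‖ ^ 2 ≤ 1 / 2) (n : ℕ) (w : E d) : ‖contraction γ x n w‖ ≤ ‖w‖ := by
  have h := sum_sq_le_norm_sq_sub_contraction hγ hx n w
  have : 0 ≤ 2 * γ * ∑ k ∈ Finset.range n, ⟪x k, contraction γ x k w⟫ ^ 2 := by positivity
  exact le_of_sq_le_sq (by linarith) (norm_nonneg _)

theorem contraction_apply_eq_sub_sum {d : ℕ} (γ : ℝ) (x : ℕ → E d) (n : ℕ) (w : E d) :
    contraction γ x n w =
      w - ∑ j ∈ Finset.range n, (2 * γ * ⟪x j, contraction γ x j w⟫) • x j := by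
  induction n with
  | zero => simp [contraction]
  | succ n ih =>
    rw [contraction_succ_apply, stepFactor_apply, Finset.sum_range_succ, ← sub_sub, ← ih]

/-- Since `8BγR ≤ 1`, the trajectory of `w` moves little within a buffer. The moving vector can thus
be replaced by `w` itself, leaving a quadratic form of the samples whose moments are accessible. -/
theorem sum_inner_sq_le_two_mul {d : ℕ} {γ R : ℝ} {B : ℕ} (hγ : 0 ≤ γ) (hR : 0 ≤ R)
    (hγR : 8 * B * (γ * R) ≤ 1) {x : ℕ → E d} (hx : ∀ k, ‖x k‖ ^ 2 ≤ R) (w : E d) :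
    ∑ k ∈ Finset.range B, ⟪x k, w⟫ ^ 2 ≤
      2 * ∑ k ∈ Finset.range B, ⟪x k, contraction γ x k w⟫ ^ 2 := by
  set b : ℕ → ℝ := fun k => ⟪x k, contraction γ x k w⟫ with hb
  set s : ℝ := ∑ j ∈ Finset.range B, |b j| with hs
  have hs0 : 0 ≤ s := by positivity
  -- Young's inequality `(b + e)² ≤ (5/4) b² + 5 e²`. After summation the error costs `20 (BγR)² ≤
  -- 5/16`, so the total factor is `25/16 ≤ 2`.
  have key : ∀ k ∈ Finset.range B, ⟪x k, w⟫ ^ 2 ≤ 5 / 4 * b k ^ 2 + 5 * (2 * (γ * R) * s) ^ 2 := by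
    intro k hk
    have h1 : ⟪x k, w⟫ = b k + ∑ j ∈ Finset.range k, 2 * γ * b j * ⟪x k, x j⟫ := by
      have := contraction_apply_eq_sub_sum γ x k w
      simp only [hb]
      conv_rhs => rw [this]
      simp only [inner_sub_right, inner_sum, inner_smul_right]
      ring
    have h2 : |∑ j ∈ Finset.range k, 2 * γ * b j * ⟪x k, x j⟫| ≤ 2 * (γ * R) * s := by
      rw [hs, Finset.mul_sum]
      refine (Finset.abs_sum_le_sum_abs _ _).trans ((Finset.sum_le_sum fun j _ => ?_).trans
        (Finset.sum_le_sum_of_subset_of_nonneg (Finset.range_mono (Finset.mem_range.1 hk).le)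
          fun _ _ _ => by positivity))
      have h3 : |⟪x k, x j⟫| ≤ R := by
        refine (abs_real_inner_le_norm _ _).trans ?_
        nlinarith [hx k, hx j, sq_nonneg (‖x k‖ - ‖x j‖)]
      rw [abs_mul, abs_mul, abs_of_nonneg (by positivity : 0 ≤ 2 * γ)]
      calc 2 * γ * |b j| * |⟪x k, x j⟫| ≤ 2 * γ * |b j| * R := by gcongr
        _ = 2 * (γ * R) * |b j| := by ring
    rw [h1]
    have h4 : (∑ j ∈ Finset.range k, 2 * γ * b j * ⟪x k, x j⟫) ^ 2 ≤ (2 * (γ * R) * s) ^ 2 := by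
      rw [← sq_abs]
      gcongr
    nlinarith [sq_nonneg (b k - 4 * ∑ j ∈ Finset.range k, 2 * γ * b j * ⟪x k, x j⟫)]
  have hcs : s ^ 2 ≤ B * ∑ k ∈ Finset.range B, b k ^ 2 := by
    have := sq_sum_le_card_mul_sum_sq (s := Finset.range B) (f := fun j => |b j|)
    simpa using this
  refine (Finset.sum_le_sum key).trans ?_
  rw [Finset.sum_add_distrib, ← Finset.mul_sum, Finset.sum_const, Finset.card_range, nsmul_eq_mul]
  set Q := ∑ k ∈ Finset.range B, b k ^ 2
  have hQ : 0 ≤ Q := by positivity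
  have hB : (0 : ℝ) ≤ B := by positivity
  have hg : 0 ≤ γ * R := by positivity
  have h5 : (B : ℝ) * (γ * R) ^ 2 * s ^ 2 ≤ (B * (γ * R)) ^ 2 * Q := by
    calc (B : ℝ) * (γ * R) ^ 2 * s ^ 2 ≤ B * (γ * R) ^ 2 * (B * Q) := by gcongr
      _ = _ := by ring
  have h6 : (B * (γ * R)) ^ 2 ≤ (1 / 8) ^ 2 := by
    gcongr
    linarith
  nlinarith

theorem norm_sq_contraction_apply_le {d : ℕ} {γ R : ℝ} {B : ℕ} (hB : 1 ≤ B) (hγ : 0 ≤ γ)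
    (hR : 0 ≤ R) (hγR : 8 * B * (γ * R) ≤ 1) {x : ℕ → E d} (hx : ∀ k, ‖x k‖ ^ 2 ≤ R) (w : E d) :
    ‖contraction γ x B w‖ ^ 2 ≤ ‖w‖ ^ 2 - γ * ∑ k ∈ Finset.range B, ⟪x k, w⟫ ^ 2 := by
  have hx' : ∀ k, γ * ‖x k‖ ^ 2 ≤ 1 / 2 := fun k => by
    have h1 : γ * ‖x k‖ ^ 2 ≤ γ * R := mul_le_mul_of_nonneg_left (hx k) hγ
    have h2 : (1 : ℝ) ≤ B := by exact_mod_cast hB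
    have h3 : 0 ≤ γ * R := by positivity
    nlinarith
  have h1 := sum_sq_le_norm_sq_sub_contraction hγ hx' B w
  have h2 := mul_le_mul_of_nonneg_left (sum_inner_sq_le_two_mul hγ hR hγR hx w) hγ
  linarith

theorem inner_noiseSum_apply {d : ℕ} (γ : ℝ) (x z : ℕ → E d) (n : ℕ) (v w : E d) :
    ⟪v, noiseSum γ x z n w⟫ =
      ∑ k ∈ Finset.range n, 2 * γ * ⟪v, z k⟫ * ⟪x k, contraction γ x k w⟫ := by
  induction n with
  | zero => simp [noiseSum]
  | succ n ih =>
    rw [Finset.sum_range_succ, ← ih]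
    simp [noiseSum, inner_add_right, inner_smul_right, outer_apply]
    ring

theorem sgdStep_eq {d : ℕ} (γ : ℝ) (A : Mat d) (x y : E d) :
    sgdStep γ A x y = A * stepFactor γ x + (2 * γ) • outer y x := by
  rw [sgdStep, stepFactor, outer_sub_left, mul_sub, mul_one, mul_smul_mat, mul_outer, smul_sub]
  abel

/-- An invariant of the reversed pass: after `i` steps the factors and noise of the first `B - i`
samples are still to come, and applying them always gives the same matrix. At `i = B` it is the
affine recursion of the error over the buffer. -/
theorem bufferIterate_sub_mul_contraction {d : ℕ} (γ : ℝ) (B u : ℕ) (X : ℕ → E d) (s : ℕ)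
    (A Astar : Mat d) (x z : ℕ → E d) (hx : ∀ k < B, x k = X (s * (B + u) + (u + k)))
    (hz : ∀ k < B, X (s * (B + u) + (u + k + 1)) = Astar (x k) + z k) (i : ℕ) (hi : i ≤ B) :
    (bufferIterate γ B u X s A i - Astar) * contraction γ x (B - i) + noiseSum γ x z (B - i) =
      (A - Astar) * contraction γ x B + noiseSum γ x z B := by
  induction i with
  | zero => simp [bufferIterate]
  | succ i ih =>
    rw [← ih (by omega)]
    obtain ⟨k, hk⟩ : ∃ k, B - i = k + 1 := ⟨B - i - 1, by omega⟩
    have e1 : B - (i + 1) = k := by omega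
    have e2 : B + u - 1 - i = u + k := by omega
    have e3 : B + u - i = u + k + 1 := by omega
    rw [e1, hk, bufferIterate, e2, e3, hz k (by omega), ← hx k (by omega), sgdStep_eq,
      outer_add_left, contraction, noiseSum]
    have : stepFactor γ (x k) = 1 - (2 * γ) • outer (x k) (x k) := rfl
    have h2 : Astar * stepFactor γ (x k) = Astar - (2 * γ) • outer (Astar (x k)) (x k) := by
      rw [this, mul_sub, mul_one, mul_smul_mat, mul_outer]
    rw [← mul_assoc, sub_mul _ Astar (stepFactor γ (x k)), h2, smul_add]
    simp only [add_mul, sub_mul, smul_mul_mat]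
    abel

/-! ### Stability of the algorithm under perturbation of the path -/

theorem norm_sgdStep_le {d : ℕ} {γ R : ℝ} (hγ : 0 ≤ γ) (hγR : γ * R ≤ 1 / 2) (A : Mat d)
    {x y : E d} (hx : ‖x‖ ^ 2 ≤ R) (hy : ‖y‖ ^ 2 ≤ R) :
    ‖sgdStep γ A x y‖ ≤ ‖A‖ + 2 * (γ * R) := by
  rw [sgdStep_eq]
  refine (norm_add_le _ _).trans (add_le_add ?_ ?_)
  · refine (norm_mul_le _ _).trans (mul_le_of_le_one_right (norm_nonneg _)
      (norm_stepFactor_le hγ ?_))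
    exact (mul_le_mul_of_nonneg_left hx hγ).trans hγR
  · rw [norm_smul, norm_outer, Real.norm_of_nonneg (by positivity), mul_assoc]
    have : ‖y‖ * ‖x‖ ≤ R := by nlinarith [sq_nonneg (‖x‖ - ‖y‖)]
    have := mul_le_mul_of_nonneg_left this hγ
    linarith

theorem norm_outer_sub_outer_le {d : ℕ} {r δ : ℝ} {x y x' y' : E d} (hy : ‖y‖ ≤ r)
    (hx' : ‖x'‖ ≤ r) (hxx : ‖x - x'‖ ≤ δ) (hyy : ‖y - y'‖ ≤ δ) :
    ‖outer x y - outer x' y'‖ ≤ 2 * r * δ := by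
  have hδ : 0 ≤ δ := (norm_nonneg _).trans hxx
  have hr : 0 ≤ r := (norm_nonneg _).trans hy
  have : outer x y - outer x' y' = outer (x - x') y + outer x' (y - y') := by
    rw [outer_sub_left, outer_sub_right]
    abel
  rw [this]
  refine (norm_add_le _ _).trans ?_
  rw [norm_outer, norm_outer]
  have h1 := mul_le_mul hxx hy (norm_nonneg _) hδ
  have h2 := mul_le_mul hx' hyy (norm_nonneg _) hr
  linarith

theorem norm_sgdStep_sub_sgdStep_le {d : ℕ} {γ r δ : ℝ} (hγ : 0 ≤ γ) (hγr : γ * r ^ 2 ≤ 1 / 2)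
    (A A' : Mat d) {x y x' y' : E d} (hx : ‖x‖ ≤ r) (hx' : ‖x'‖ ≤ r) (hy' : ‖y'‖ ≤ r)
    (hxx : ‖x - x'‖ ≤ δ) (hyy : ‖y - y'‖ ≤ δ) :
    ‖sgdStep γ A x y - sgdStep γ A' x' y'‖ ≤ ‖A - A'‖ + (‖A'‖ + 1) * (2 * γ * (2 * r * δ)) := by
  have e : sgdStep γ A x y - sgdStep γ A' x' y' = (A - A') * stepFactor γ x
      + (-((2 * γ) • (A' * (outer x x - outer x' x'))) + (2 * γ) • (outer y x - outer y' x')) := by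
    rw [sgdStep_eq, sgdStep_eq, stepFactor, stepFactor]
    simp only [mul_sub, sub_mul, mul_one, smul_sub, mul_smul_mat]
    abel
  rw [e]
  refine (norm_add_le _ _).trans (add_le_add ?_ ((norm_add_le _ _).trans ?_))
  · refine (norm_mul_le _ _).trans (mul_le_of_le_one_right (norm_nonneg _)
      (norm_stepFactor_le hγ (le_trans ?_ hγr)))
    gcongr
  · rw [norm_neg, norm_smul, norm_smul, Real.norm_of_nonneg (by positivity)]
    have h1 := norm_outer_sub_outer_le hx hx' hxx hxx
    have h2 := norm_outer_sub_outer_le hx hy' hyy hxx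
    have h3 : ‖A' * (outer x x - outer x' x')‖ ≤ ‖A'‖ * (2 * r * δ) :=
      (norm_mul_le _ _).trans (mul_le_mul_of_nonneg_left h1 (norm_nonneg _))
    calc _ ≤ 2 * γ * (‖A'‖ * (2 * r * δ)) + 2 * γ * (2 * r * δ) := by gcongr
      _ = _ := by ring

/-- The buffer iterates when every buffer `s` is run on its own path `Y s`. -/
noncomputable def splitIterate {d : ℕ} (γ : ℝ) (B u : ℕ) (A₀ : Mat d) (Y : ℕ → ℕ → E d) : ℕ → Mat d
  | 0 => A₀
  | t + 1 => bufferIterate γ B u (Y t) 0 (splitIterate γ B u A₀ Y t) B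

theorem norm_bufferIterate_le {d : ℕ} {γ R : ℝ} {B u : ℕ} (hγ : 0 ≤ γ) (hR : 0 ≤ R)
    (hγR : 8 * B * (γ * R) ≤ 1) (X : ℕ → E d) (s : ℕ) (A : Mat d)
    (hX : ∀ k ≤ B, ‖X (s * (B + u) + (u + k))‖ ^ 2 ≤ R) (i : ℕ) (hi : i ≤ B) :
    ‖bufferIterate γ B u X s A i‖ ≤ ‖A‖ + i * (2 * (γ * R)) := by
  induction i with
  | zero => simp [bufferIterate]
  | succ i ih =>
    have e2 : B + u - 1 - i = u + (B - (i + 1)) := by omega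
    have e3 : B + u - i = u + (B - i) := by omega
    have hB : (1 : ℝ) ≤ B := by exact_mod_cast (show 1 ≤ B by omega)
    have h0 : 0 ≤ γ * R := by positivity
    rw [bufferIterate, e2, e3]
    refine (norm_sgdStep_le hγ (by nlinarith) _ (hX _ (by omega)) (hX _ (by omega))).trans ?_
    have := ih (by omega)
    push_cast
    linarith

theorem norm_bufferIterate_sub_le {d : ℕ} {γ r δ b : ℝ} {B u : ℕ} (hγ : 0 ≤ γ)
    (hγR : 8 * B * (γ * r ^ 2) ≤ 1) (X Y : ℕ → E d) (s : ℕ) (A A' : Mat d)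
    (hX : ∀ k ≤ B, ‖X (s * (B + u) + (u + k))‖ ≤ r) (hY : ∀ k ≤ B, ‖Y (u + k)‖ ≤ r)
    (hXY : ∀ k ≤ B, ‖X (s * (B + u) + (u + k)) - Y (u + k)‖ ≤ δ)
    (hb : ‖A'‖ + 1 / 4 ≤ b) (i : ℕ) (hi : i ≤ B) :
    ‖bufferIterate γ B u X s A i - bufferIterate γ B u Y 0 A' i‖ ≤
      ‖A - A'‖ + i * ((b + 1) * (2 * γ * (2 * r * δ))) := by
  induction i with
  | zero => simp [bufferIterate]
  | succ i ih =>
    have e2 : B + u - 1 - i = u + (B - (i + 1)) := by omega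
    have e3 : B + u - i = u + (B - i) := by omega
    have hB : (1 : ℝ) ≤ B := by exact_mod_cast (show 1 ≤ B by omega)
    have hr : 0 ≤ r := (norm_nonneg _).trans (hX 0 (by omega))
    have hδ : 0 ≤ δ := (norm_nonneg _).trans (hXY 0 (by omega))
    have h0 : 0 ≤ γ * r ^ 2 := by positivity
    rw [bufferIterate, bufferIterate, e2, e3, zero_mul, zero_add, zero_add]
    refine (norm_sgdStep_sub_sgdStep_le hγ (by nlinarith) _ _ (hX _ (by omega)) (hY _ (by omega))
      (hY _ (by omega)) (hXY _ (by omega)) (hXY _ (by omega))).trans ?_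
    have h1 := ih (by omega)
    have h2 : ‖bufferIterate γ B u Y 0 A' i‖ ≤ b := by
      refine (norm_bufferIterate_le (R := r ^ 2) hγ (by positivity) hγR Y 0 A' (fun k hk => ?_) i
        (by omega)).trans (le_trans ?_ hb)
      · rw [zero_mul, zero_add]
        exact pow_le_pow_left₀ (norm_nonneg _) (hY k hk) 2
      · have : (i : ℝ) ≤ B := by exact_mod_cast (show i ≤ B by omega)
        nlinarith
    have h3 : (‖bufferIterate γ B u Y 0 A' i‖ + 1) * (2 * γ * (2 * r * δ)) ≤
        (b + 1) * (2 * γ * (2 * r * δ)) := by gcongr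
    push_cast
    linarith

/-- Each of the `B` steps adds at most `2γr²` to the norm, hence a buffer adds at most `1/4`. -/
theorem norm_splitIterate_le {d : ℕ} {γ r : ℝ} {B u N : ℕ} (hγ : 0 ≤ γ)
    (hγR : 8 * B * (γ * r ^ 2) ≤ 1) (A₀ : Mat d) (Y : ℕ → ℕ → E d)
    (hY : ∀ s < N, ∀ k ≤ B, ‖Y s (u + k)‖ ≤ r) (t : ℕ) (ht : t ≤ N) :
    ‖splitIterate γ B u A₀ Y t‖ ≤ ‖A₀‖ + t / 4 := by
  induction t with
  | zero => simp [splitIterate]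
  | succ t ih =>
    rw [splitIterate]
    refine (norm_bufferIterate_le (R := r ^ 2) hγ (by positivity) hγR (Y t) 0 _ (fun k hk => ?_) B
      le_rfl).trans ?_
    · rw [zero_mul, zero_add]
      exact pow_le_pow_left₀ (norm_nonneg _) (hY t (by omega) k hk) 2
    · have := ih (by omega)
      push_cast
      linarith

/-- Step factors do not expand, so differences only add up. A step whose data move by `2rh` moves
the result by `O(γ r² h)` times the current norm, and `8Bγr² ≤ 1` absorbs the `B` steps of a buffer.
-/
theorem norm_rerIterate_sub_splitIterate_le {d : ℕ} {γ r h : ℝ} {B u N : ℕ} (hγ : 0 ≤ γ)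
    (hγR : 8 * B * (γ * r ^ 2) ≤ 1) (A₀ : Mat d) (X : ℕ → E d) (Y : ℕ → ℕ → E d)
    (hX : ∀ s < N, ∀ k ≤ B, ‖X (s * (B + u) + (u + k))‖ ≤ r)
    (hY : ∀ s < N, ∀ k ≤ B, ‖Y s (u + k)‖ ≤ r) (hh : 0 ≤ h)
    (hXY : ∀ s < N, ∀ k ≤ B, ‖X (s * (B + u) + (u + k)) - Y s (u + k)‖ ≤ 2 * r * h)
    (t : ℕ) (ht : t ≤ N) :
    ‖rerIterate γ B u A₀ X t - splitIterate γ B u A₀ Y t‖ ≤ t * ((‖A₀‖ + N / 4 + 1) * h) := by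
  induction t with
  | zero => simp [splitIterate, rerIterate]
  | succ t ih =>
    rw [splitIterate, rerIterate]
    have hb : ‖splitIterate γ B u A₀ Y t‖ + 1 / 4 ≤ ‖A₀‖ + N / 4 := by
      have h1 := norm_splitIterate_le hγ hγR A₀ Y hY t (by omega)
      have : (t : ℝ) + 1 ≤ N := by exact_mod_cast ht
      linarith
    refine (norm_bufferIterate_sub_le hγ hγR X (Y t) t _ _ (hX t (by omega)) (hY t (by omega))
      (hXY t (by omega)) hb B le_rfl).trans ?_
    have h2 : (B : ℝ) * ((‖A₀‖ + N / 4 + 1) * (2 * γ * (2 * r * (2 * r * h)))) ≤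
        (‖A₀‖ + N / 4 + 1) * h := by
      calc (B : ℝ) * ((‖A₀‖ + N / 4 + 1) * (2 * γ * (2 * r * (2 * r * h))))
          = (8 * B * (γ * r ^ 2)) * ((‖A₀‖ + N / 4 + 1) * h) := by ring
        _ ≤ 1 * ((‖A₀‖ + N / 4 + 1) * h) := by gcongr
        _ = _ := one_mul _
    have := ih (by omega)
    push_cast
    linarith

/-! ### Weights of the tail average -/

/-- The matrix weights with which the `k`-th buffer from the end contributes to the sum of the last
`m` iterates, when `h k` is the contraction in the `k`-th buffer from the end. -/
noncomputable def tailWeight {d : ℕ} (m : ℕ) (h : ℕ → Mat d) : ℕ → Mat d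
  | 0 => 1
  | k + 1 => (if k + 1 < m then 1 else 0) + h k * tailWeight m h k

/-- The product `h (j + n - 1) ⋯ h j`. -/
noncomputable def backProd {d : ℕ} (h : ℕ → Mat d) (j : ℕ) : ℕ → Mat d
  | 0 => 1
  | n + 1 => h (j + n) * backProd h j n

/-- Unrolling from the last iterate backwards: the noise of buffer `N - 1 - k` is multiplied by a
weight that involves only later buffers. This is what makes the sum a martingale in reversed time.
-/
theorem sum_Ioc_eq_tailWeight {d : ℕ} {a N : ℕ} (haN : a < N) (D H V : ℕ → Mat d)
    (hD : ∀ s < N, D (s + 1) = D s * H s + V s) :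
    ∑ s ∈ Finset.Ioc a N, D s =
      D 0 * tailWeight (N - a) (fun k => H (N - 1 - k)) N +
        ∑ k ∈ Finset.range N, V (N - 1 - k) * tailWeight (N - a) (fun k => H (N - 1 - k)) k := by
  set U := tailWeight (N - a) (fun k => H (N - 1 - k)) with hU
  -- Partial unrolling: iterates strictly before `N - k` are untouched, and all later ones have been
  -- expressed through `D (N - k)` and noise.
  have key : ∀ k ≤ N, ∑ s ∈ Finset.Ioc a N, D s = ∑ s ∈ Finset.Ioo a (N - k), D s +
      D (N - k) * U k + ∑ j ∈ Finset.range k, V (N - 1 - j) * U j := by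
    intro k
    induction k with
    | zero =>
      intro _
      rw [← Finset.Ioo_insert_right haN, Finset.sum_insert (by simp)]
      simp [hU, tailWeight, add_comm]
    | succ k ih =>
      intro hk
      obtain ⟨p, hp⟩ : ∃ p, N - k = p + 1 := ⟨N - k - 1, by omega⟩
      have e1 : N - (k + 1) = p := by omega
      have e2 : N - 1 - k = p := by omega
      rw [ih (by omega), Finset.sum_range_succ, hp, e1, e2, hD p (by omega)]
      have e3 : U (k + 1) = (if k + 1 < N - a then 1 else 0) + H p * U k := by
        rw [hU, tailWeight, e2]
      rw [e3]
      have e4 : Finset.Ioo a (p + 1) = Finset.Ioc a p := by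
        ext
        simp only [Finset.mem_Ioo, Finset.mem_Ioc]
        omega
      rw [e4]
      by_cases hap : a < p
      · rw [if_pos (by omega), ← Finset.Ioo_insert_right hap, Finset.sum_insert (by simp)]
        simp only [add_mul, mul_add, mul_one, mul_assoc]
        abel
      · rw [if_neg (by omega), Finset.Ioc_eq_empty (by omega), Finset.Ioo_eq_empty (by omega)]
        simp only [add_mul, Finset.sum_empty, zero_add, mul_assoc]
        abel
  have := key N le_rfl
  simpa using this

/-- The sum telescopes except where the recursion adds the identity. There `h k` applied to the
current vector is the next vector minus `y`, and expanding the square costs at most `2q`; this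
happens at most `m - 1` times, and the initial energy is at most `1`. -/
theorem sum_energy_tailWeight_le {d : ℕ} {m n : ℕ} {h : ℕ → Mat d} {q : ℝ} {y : E d}
    (hm : 1 ≤ m) (hq : 1 ≤ q) (hy : ‖y‖ ≤ 1) (hU : ∀ k ≤ n, ‖tailWeight m h k‖ ≤ q) :
    ∑ k ∈ Finset.range n, (‖tailWeight m h k y‖ ^ 2 - ‖h k (tailWeight m h k y)‖ ^ 2) ≤
      2 * m * q := by
  have key : ∀ j ≤ n, ∑ k ∈ Finset.range j,
      (‖tailWeight m h k y‖ ^ 2 - ‖h k (tailWeight m h k y)‖ ^ 2) + ‖tailWeight m h j y‖ ^ 2 ≤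
        1 + 2 * q * (min j (m - 1) : ℕ) := by
    intro j
    induction j with
    | zero =>
      intro _
      simp only [tailWeight, Finset.range_zero, Finset.sum_empty]
      simp only [one_apply_eq_self]
      simp
      nlinarith [norm_nonneg y]
    | succ j ih =>
      intro hj
      have h1 := ih (by omega)
      rw [Finset.sum_range_succ]
      have hle : ‖tailWeight m h (j + 1) y‖ ≤ q :=
        (ContinuousLinearMap.le_opNorm _ _).trans
          ((mul_le_of_le_one_right (norm_nonneg _) hy).trans (hU _ hj))
      by_cases hjm : j + 1 < m
      · have e : h j (tailWeight m h j y) = tailWeight m h (j + 1) y - y := by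
          simp [tailWeight, hjm]
        have e2 : (min (j + 1) (m - 1) : ℕ) = (min j (m - 1) : ℕ) + 1 := by omega
        rw [e, norm_sub_sq_real, e2]
        have h3 : ⟪tailWeight m h (j + 1) y, y⟫ ≤ q :=
          (real_inner_le_norm _ _).trans ((mul_le_of_le_one_right (norm_nonneg _) hy).trans hle)
        push_cast at h1 ⊢
        nlinarith [sq_nonneg ‖y‖]
      · have e : h j (tailWeight m h j y) = tailWeight m h (j + 1) y := by
          simp [tailWeight, hjm]
        have e2 : ((min j (m - 1) : ℕ) : ℝ) ≤ (min (j + 1) (m - 1) : ℕ) := by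
          exact_mod_cast (by omega)
        rw [e]
        nlinarith
  have h1 := key n le_rfl
  have h2 : ((min n (m - 1) : ℕ) : ℝ) ≤ m - 1 := by
    have : (min n (m - 1) : ℕ) + 1 ≤ m := by omega
    have : ((min n (m - 1) : ℕ) : ℝ) + 1 ≤ m := by exact_mod_cast this
    linarith
  have h3 := sq_nonneg ‖tailWeight m h n y‖
  nlinarith

theorem tailWeight_eq_sum_backProd {d : ℕ} {m : ℕ} (hm : 1 ≤ m) (h : ℕ → Mat d) (k : ℕ) :
    tailWeight m h k = ∑ j ∈ Finset.range (k + 1), if j < m then backProd h j (k - j) else 0 := by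
  induction k with
  | zero => rw [zero_add, Finset.sum_range_one, if_pos (by omega), tailWeight, backProd]
  | succ k ih =>
    rw [Finset.sum_range_succ, tailWeight, ih, Finset.mul_sum, add_comm]
    congr 1
    · refine Finset.sum_congr rfl fun j hj => ?_
      have hj' : j ≤ k := by simpa [Nat.lt_succ_iff] using hj
      rw [Nat.sub_add_comm hj', backProd, Nat.add_sub_cancel' hj']
      split_ifs <;> simp
    · simp [backProd]

theorem norm_backProd_le_one {d : ℕ} {h : ℕ → Mat d} (hh : ∀ k, ‖h k‖ ≤ 1) (j n : ℕ) :
    ‖backProd h j n‖ ≤ 1 := by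
  induction n with
  | zero => exact ContinuousLinearMap.norm_id_le
  | succ n ih =>
    exact (norm_mul_le _ _).trans (mul_le_one₀ (hh _) (norm_nonneg _) ih)

theorem sum_range_pow_le {ρ : ℝ} (h0 : 0 ≤ ρ) (h1 : ρ < 1) (n : ℕ) :
    ∑ j ∈ Finset.range n, ρ ^ j ≤ 1 / (1 - ρ) := by
  rw [one_div, ← tsum_geometric_of_lt_one h0 h1]
  exact (summable_geometric_of_lt_one h0 h1).sum_le_tsum _ fun _ _ => by positivity

/-- A weight is a sum of products of consecutive contractions, one of each length. Fewer than `n₀ +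
1` have length below `n₀` and norm at most one; the others form a geometric series. -/
theorem norm_tailWeight_le {d : ℕ} {m N : ℕ} {h : ℕ → Mat d} {ρ n₀ : ℝ} (hm : 1 ≤ m)
    (hn₀ : 0 ≤ n₀) (h0 : 0 ≤ ρ) (h1 : ρ < 1) (hh : ∀ k, ‖h k‖ ≤ 1)
    (hback : ∀ j n, j + n ≤ N → n₀ ≤ n → ‖backProd h j n‖ ≤ 2 * ρ ^ n) (k : ℕ) (hk : k ≤ N) :
    ‖tailWeight m h k‖ ≤ (n₀ + 1) + 2 / (1 - ρ) := by
  have h2 : ‖tailWeight m h k‖ ≤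
      ∑ j ∈ Finset.range (k + 1), ((if ((k - j : ℕ) : ℝ) < n₀ then 1 else 0) + 2 * ρ ^ (k - j)) := by
    rw [tailWeight_eq_sum_backProd hm]
    refine (norm_sum_le _ _).trans (Finset.sum_le_sum fun j hj => ?_)
    have hj' : j ≤ k := by simpa [Nat.lt_succ_iff] using hj
    have hp : 0 ≤ 2 * ρ ^ (k - j) := by positivity
    by_cases hjm : j < m
    · rw [if_pos hjm]
      by_cases hkj : ((k - j : ℕ) : ℝ) < n₀
      · rw [if_pos hkj]
        linarith [norm_backProd_le_one hh j (k - j)]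
      · rw [if_neg hkj, zero_add]
        exact hback j (k - j) (by omega) (not_lt.1 hkj)
    · rw [if_neg hjm, norm_zero]
      split_ifs <;> linarith
  refine h2.trans ?_
  rw [Finset.sum_add_distrib]
  refine add_le_add ?_ ?_
  · have := Finset.sum_range_reflect (fun i : ℕ => if (i : ℝ) < n₀ then (1 : ℝ) else 0) (k + 1)
    simp only [Nat.add_sub_cancel] at this
    rw [this, Finset.sum_boole]
    have hsub : (Finset.range (k + 1)).filter (fun i : ℕ => (i : ℝ) < n₀) ⊆
        Finset.range ⌈n₀⌉₊ := by
      intro i hi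
      rw [Finset.mem_filter] at hi
      exact Finset.mem_range.2 (Nat.lt_ceil.2 hi.2)
    have h3 : (((Finset.range (k + 1)).filter (fun i : ℕ => (i : ℝ) < n₀)).card : ℝ) ≤ ⌈n₀⌉₊ := by
      exact_mod_cast (Finset.card_le_card hsub).trans (Finset.card_range _).le
    exact h3.trans (Nat.ceil_lt_add_one hn₀).le
  · have := Finset.sum_range_reflect (fun i : ℕ => 2 * ρ ^ i) (k + 1)
    simp only [Nat.add_sub_cancel] at this
    rw [this, ← Finset.mul_sum]
    have := sum_range_pow_le h0 h1 (k + 1)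
    calc 2 * ∑ i ∈ Finset.range (k + 1), ρ ^ i ≤ 2 * (1 / (1 - ρ)) := by gcongr
      _ = _ := by ring

/-- Every product that reaches the initial error passes through the `a` discarded buffers, which
yields the common factor `ρ ^ a`. -/
theorem norm_tailWeight_last_le {d : ℕ} {a N : ℕ} {h : ℕ → Mat d} {ρ n₀ : ℝ} (haN : a < N)
    (ha : n₀ ≤ a) (h0 : 0 ≤ ρ) (h1 : ρ < 1)
    (hback : ∀ j n, j + n ≤ N → n₀ ≤ n → ‖backProd h j n‖ ≤ 2 * ρ ^ n) :
    ‖tailWeight (N - a) h N‖ ≤ 2 * ρ ^ a / (1 - ρ) := by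
  have h2 : ‖tailWeight (N - a) h N‖ ≤
      ∑ j ∈ Finset.range (N + 1), 2 * ρ ^ a * ρ ^ (N - a - 1 - j) * (if j < N - a then 1 else 0) := by
    rw [tailWeight_eq_sum_backProd (by omega)]
    refine (norm_sum_le _ _).trans (Finset.sum_le_sum fun j hj => ?_)
    by_cases hjm : j < N - a
    · rw [if_pos hjm, if_pos hjm, mul_one]
      refine (hback j (N - j) (by omega) (ha.trans (by exact_mod_cast (by omega)))).trans ?_
      -- One power of `ρ` is given away, so that the exponent `N - a - 1 - j` is the reflection of a
      -- range.
      rw [mul_assoc, ← pow_add]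
      exact mul_le_mul_of_nonneg_left (pow_le_pow_of_le_one h0 h1.le (by omega)) zero_le_two
    · rw [if_neg hjm, if_neg hjm, norm_zero, mul_zero]
  refine h2.trans ?_
  have e : ∑ j ∈ Finset.range (N + 1),
      2 * ρ ^ a * ρ ^ (N - a - 1 - j) * (if j < N - a then (1 : ℝ) else 0) =
      ∑ j ∈ Finset.range (N - a), 2 * ρ ^ a * ρ ^ (N - a - 1 - j) := by
    simp only [mul_ite, mul_one, mul_zero]
    rw [← Finset.sum_filter]
    congr 1
    ext j
    simp
    omega
  rw [e, Finset.sum_range_reflect (fun i => 2 * ρ ^ a * ρ ^ i) (N - a), ← Finset.mul_sum]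
  have := sum_range_pow_le h0 h1 (N - a)
  calc 2 * ρ ^ a * ∑ i ∈ Finset.range (N - a), ρ ^ i ≤ 2 * ρ ^ a * (1 / (1 - ρ)) := by gcongr
    _ = _ := by ring

/-! ### Nets of the unit ball -/

/-- A `1/2`-separated set of maximal cardinality is a net. Doubled, it is `1`-separated in the ball
of radius `2`, where the packing bound from Besicovitch's covering theory is `5 ^ d`. -/
theorem exists_half_net (d : ℕ) : ∃ s : Finset (E d), s.card ≤ 5 ^ d ∧ (∀ y ∈ s, ‖y‖ ≤ 1) ∧
    ∀ x : E d, ‖x‖ ≤ 1 → ∃ y ∈ s, ‖x - y‖ ≤ 1 / 2 := by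
  classical
  have hcard : ∀ s : Finset (E d), (∀ y ∈ s, ‖y‖ ≤ 1) →
      (∀ x ∈ s, ∀ y ∈ s, x ≠ y → 1 / 2 ≤ ‖x - y‖) → s.card ≤ 5 ^ d := by
    intro s h1 h2
    have h := Besicovitch.card_le_of_separated (s.image fun x => (2 : ℝ) • x) ?_ ?_
    · rwa [Finset.card_image_of_injective _ (smul_right_injective _ two_ne_zero),
        finrank_euclideanSpace_fin] at h
    · intro c hc
      obtain ⟨x, hx, rfl⟩ := Finset.mem_image.1 hc
      rw [norm_smul]
      norm_num
      exact h1 x hx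
    · intro c hc c' hc' hne
      obtain ⟨x, hx, rfl⟩ := Finset.mem_image.1 hc
      obtain ⟨y, hy, rfl⟩ := Finset.mem_image.1 hc'
      rw [← smul_sub, norm_smul]
      have := h2 x hx y hy fun h => hne (by rw [h])
      norm_num
      linarith
  let p : ℕ → Prop := fun n => ∃ s : Finset (E d), s.card = n ∧ (∀ y ∈ s, ‖y‖ ≤ 1) ∧
    ∀ x ∈ s, ∀ y ∈ s, x ≠ y → 1 / 2 ≤ ‖x - y‖
  have hp0 : p 0 := ⟨∅, by simp⟩
  have hmax := Nat.findGreatest_spec (P := p) (Nat.zero_le (5 ^ d)) hp0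
  obtain ⟨s, hs, h1, h2⟩ := hmax
  refine ⟨s, hcard s h1 h2, h1, fun x hx => ?_⟩
  by_contra! hcon
  have hxs : x ∉ s := fun hxs => by
    have := hcon x hxs
    norm_num at this
  have h1' : ∀ y ∈ insert x s, ‖y‖ ≤ 1 := by
    intro y hy
    rcases Finset.mem_insert.1 hy with rfl | hy
    exacts [hx, h1 y hy]
  have h2' : ∀ z ∈ insert x s, ∀ y ∈ insert x s, z ≠ y → 1 / 2 ≤ ‖z - y‖ := by
    intro z hz y hy hne
    rcases Finset.mem_insert.1 hz with hz' | hz' <;> rcases Finset.mem_insert.1 hy with hy' | hy'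
    · exact absurd (hz'.trans hy'.symm) hne
    · rw [hz']
      exact (hcon y hy').le
    · rw [norm_sub_rev, hy']
      exact (hcon z hz').le
    · exact h2 z hz' y hy' hne
  have hle := Nat.le_findGreatest (P := p) (hcard _ h1' h2') ⟨_, rfl, h1', h2'⟩
  rw [Finset.card_insert_of_notMem hxs, hs] at hle
  omega

theorem opNorm_le_two_mul_of_net {d : ℕ} {s : Finset (E d)}
    (hs : ∀ x : E d, ‖x‖ ≤ 1 → ∃ y ∈ s, ‖x - y‖ ≤ 1 / 2) {M : Mat d} {b : ℝ} (hb : 0 ≤ b)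
    (h : ∀ y ∈ s, ‖M y‖ ≤ b) : ‖M‖ ≤ 2 * b := by
  have h1 : ‖M‖ ≤ b + ‖M‖ * (1 / 2) := by
    refine ContinuousLinearMap.opNorm_le_of_unit_norm (by positivity) fun x hx => ?_
    obtain ⟨y, hy, hxy⟩ := hs x hx.le
    have e : M x = M y + M (x - y) := by simp
    rw [e]
    exact (norm_add_le _ _).trans (add_le_add (h y hy)
      ((M.le_opNorm _).trans (mul_le_mul_of_nonneg_left hxy (norm_nonneg _))))
  linarith

theorem norm_le_two_mul_of_net {d : ℕ} {s : Finset (E d)}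
    (hs : ∀ x : E d, ‖x‖ ≤ 1 → ∃ y ∈ s, ‖x - y‖ ≤ 1 / 2) {v : E d} {b : ℝ} (hb : 0 ≤ b)
    (h : ∀ y ∈ s, ⟪y, v⟫ ≤ b) : ‖v‖ ≤ 2 * b := by
  by_cases hv : v = 0
  · simp [hv, hb]
  have hv' : 0 < ‖v‖ := norm_pos_iff.2 hv
  have h1 : ‖(‖v‖⁻¹ : ℝ) • v‖ ≤ 1 := by
    rw [norm_smul, norm_inv, norm_norm, inv_mul_cancel₀ hv'.ne']
  obtain ⟨y, hy, hxy⟩ := hs _ h1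
  have h2 : ⟪(‖v‖⁻¹ : ℝ) • v, v⟫ = ‖v‖ := by
    rw [real_inner_smul_left, real_inner_self_eq_norm_sq]
    field_simp
  have h3 : ⟪(‖v‖⁻¹ : ℝ) • v - y, v⟫ ≤ 1 / 2 * ‖v‖ :=
    (real_inner_le_norm _ _).trans (mul_le_mul_of_nonneg_right hxy hv'.le)
  rw [inner_sub_left, h2] at h3
  linarith [h y hy]

/-! ### Eigenvalues, singular values and trace -/

theorem inner_apply_eq_sum_eigenvalues {d : ℕ} {T : E d →ₗ[ℝ] E d} (hT : T.IsSymmetric) (x : E d) :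
    ⟪x, T x⟫ = ∑ i, hT.eigenvalues finrank_euclideanSpace_fin i *
      ⟪hT.eigenvectorBasis finrank_euclideanSpace_fin i, x⟫ ^ 2 := by
  rw [← OrthonormalBasis.sum_inner_mul_inner (hT.eigenvectorBasis finrank_euclideanSpace_fin) x]
  refine Finset.sum_congr rfl fun i _ => ?_
  have h : ⟪hT.eigenvectorBasis finrank_euclideanSpace_fin i, T x⟫ =
      hT.eigenvalues finrank_euclideanSpace_fin i *
        ⟪hT.eigenvectorBasis finrank_euclideanSpace_fin i, x⟫ := by
    rw [← hT, hT.apply_eigenvectorBasis]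
    exact real_inner_smul_left _ _ _
  rw [h, real_inner_comm]
  ring

theorem sum_inner_eigenvectorBasis_sq {d : ℕ} {T : E d →ₗ[ℝ] E d} (hT : T.IsSymmetric) (x : E d) :
    ∑ i, ⟪hT.eigenvectorBasis finrank_euclideanSpace_fin i, x⟫ ^ 2 = ‖x‖ ^ 2 := by
  rw [← OrthonormalBasis.sum_sq_norm_inner_right
    (hT.eigenvectorBasis finrank_euclideanSpace_fin) x]
  simp

theorem finite_eigenvalues {d : ℕ} (M : Mat d) :
    {c : ℝ | Module.End.HasEigenvalue (M : E d →ₗ[ℝ] E d) c}.Finite :=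
  Module.End.finite_hasEigenvalue _

theorem hasEigenvalue_lambdaMin {d : ℕ} (hd : 1 ≤ d) {M : Mat d}
    (hM : (M : E d →ₗ[ℝ] E d).IsSymmetric) :
    Module.End.HasEigenvalue (M : E d →ₗ[ℝ] E d) (lambdaMin M) :=
  Set.Nonempty.csInf_mem
    ⟨_, hM.hasEigenvalue_eigenvalues finrank_euclideanSpace_fin ⟨0, hd⟩⟩ (finite_eigenvalues M)

theorem lambdaMin_mul_norm_sq_le {d : ℕ} {M : Mat d} (hM : (M : E d →ₗ[ℝ] E d).IsSymmetric)
    (x : E d) : lambdaMin M * ‖x‖ ^ 2 ≤ ⟪x, M x⟫ := by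
  have h := inner_apply_eq_sum_eigenvalues hM x
  rw [ContinuousLinearMap.coe_coe] at h
  rw [h, ← sum_inner_eigenvectorBasis_sq hM x, Finset.mul_sum]
  refine Finset.sum_le_sum fun i _ => mul_le_mul_of_nonneg_right ?_ (sq_nonneg _)
  exact csInf_le (finite_eigenvalues M).bddBelow
    (hM.hasEigenvalue_eigenvalues finrank_euclideanSpace_fin i)

theorem lambdaMin_pos {d : ℕ} (hd : 1 ≤ d) {M : Mat d} (hM : (M : E d →ₗ[ℝ] E d).IsSymmetric)
    (hpos : ∀ x : E d, x ≠ 0 → 0 < ⟪x, M x⟫) : 0 < lambdaMin M := by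
  obtain ⟨v, hv⟩ := (hasEigenvalue_lambdaMin hd hM).exists_hasEigenvector
  have h1 := hpos v hv.2
  have h2 : M v = lambdaMin M • v := hv.apply_eq_smul
  rw [h2, real_inner_smul_right] at h1
  exact pos_of_mul_pos_left h1 real_inner_self_nonneg

theorem norm_apply_le_singularValues_zero {d : ℕ} (hd : 1 ≤ d) (T : E d →ₗ[ℝ] E d) (x : E d) :
    ‖T x‖ ≤ T.singularValues 0 * ‖x‖ := by
  have hS := T.isSymmetric_adjoint_comp_self
  have h1 : ‖T x‖ ^ 2 = ⟪x, (T.adjoint ∘ₗ T) x⟫ := by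
    rw [LinearMap.comp_apply, LinearMap.adjoint_inner_right, real_inner_self_eq_norm_sq]
  refine le_of_sq_le_sq ?_ (mul_nonneg (T.singularValues_nonneg _) (norm_nonneg _))
  rw [h1, inner_apply_eq_sum_eigenvalues hS, mul_pow, ← sum_inner_eigenvectorBasis_sq hS x,
    Finset.mul_sum, T.sq_singularValues_of_lt finrank_euclideanSpace_fin hd]
  refine Finset.sum_le_sum fun i _ => mul_le_mul_of_nonneg_right ?_ (sq_nonneg _)
  exact hS.eigenvalues_antitone finrank_euclideanSpace_fin (Fin.le_def.2 (Nat.zero_le _))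

theorem singularValues_last_mul_norm_le {d : ℕ} (hd : 1 ≤ d) (T : E d →ₗ[ℝ] E d) (x : E d) :
    T.singularValues (d - 1) * ‖x‖ ≤ ‖T x‖ := by
  have hS := T.isSymmetric_adjoint_comp_self
  have h1 : ‖T x‖ ^ 2 = ⟪x, (T.adjoint ∘ₗ T) x⟫ := by
    rw [LinearMap.comp_apply, LinearMap.adjoint_inner_right, real_inner_self_eq_norm_sq]
  refine le_of_sq_le_sq ?_ (norm_nonneg _)
  rw [h1, inner_apply_eq_sum_eigenvalues hS, mul_pow, ← sum_inner_eigenvectorBasis_sq hS x,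
    Finset.mul_sum, T.sq_singularValues_of_lt finrank_euclideanSpace_fin (Nat.sub_lt hd one_pos)]
  refine Finset.sum_le_sum fun i _ => mul_le_mul_of_nonneg_right ?_ (sq_nonneg _)
  exact hS.eigenvalues_antitone finrank_euclideanSpace_fin
    (Fin.le_def.2 (Nat.le_sub_one_of_lt i.2))

theorem norm_apply_le_sigmaMax {d : ℕ} (hd : 1 ≤ d) (M : Mat d) (x : E d) :
    ‖M x‖ ≤ sigmaMax M * ‖x‖ :=
  norm_apply_le_singularValues_zero hd (M : E d →ₗ[ℝ] E d) x

theorem inner_apply_le_sigmaMax {d : ℕ} (hd : 1 ≤ d) (M : Mat d) (x : E d) :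
    ⟪x, M x⟫ ≤ sigmaMax M * ‖x‖ ^ 2 := by
  refine (real_inner_le_norm _ _).trans ?_
  have := mul_le_mul_of_nonneg_left (norm_apply_le_sigmaMax hd M x) (norm_nonneg x)
  linarith

theorem sigmaMin_mul_norm_le {d : ℕ} (hd : 1 ≤ d) (M : Mat d) (x : E d) :
    sigmaMin M * ‖x‖ ≤ ‖M x‖ :=
  singularValues_last_mul_norm_le hd (M : E d →ₗ[ℝ] E d) x

theorem sigmaMin_le_lambdaMin {d : ℕ} (hd : 1 ≤ d) {M : Mat d}
    (hM : (M : E d →ₗ[ℝ] E d).IsSymmetric) (h0 : 0 ≤ lambdaMin M) :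
    sigmaMin M ≤ lambdaMin M := by
  obtain ⟨v, hv⟩ := (hasEigenvalue_lambdaMin hd hM).exists_hasEigenvector
  have h2 : M v = lambdaMin M • v := hv.apply_eq_smul
  have h1 := sigmaMin_mul_norm_le hd M v
  rw [h2, norm_smul, Real.norm_of_nonneg h0] at h1
  exact le_of_mul_le_mul_right h1 (norm_pos_iff.2 hv.2)

theorem sigmaMin_pos {d : ℕ} (hd : 1 ≤ d) {M : Mat d}
    (hpos : ∀ x : E d, x ≠ 0 → 0 < ⟪x, M x⟫) : 0 < sigmaMin M := by
  refine (LinearMap.injective_iff_forall_lt_finrank_singularValues_pos _).1 ?_ _ ?_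
  · refine (injective_iff_map_eq_zero _).2 fun x hx => ?_
    by_contra hne
    have := hpos x hne
    rw [ContinuousLinearMap.coe_coe] at hx
    simp [hx] at this
  · rw [finrank_euclideanSpace_fin]
    exact Nat.sub_lt hd one_pos

theorem tr_eq_sum {d : ℕ} (M : Mat d) :
    tr M = ∑ i, ⟪EuclideanSpace.basisFun (Fin d) ℝ i, M (EuclideanSpace.basisFun (Fin d) ℝ i)⟫ :=
  LinearMap.trace_eq_sum_inner _ _

theorem tr_le_mul_sigmaMax {d : ℕ} (hd : 1 ≤ d) (M : Mat d) : tr M ≤ d * sigmaMax M := by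
  rw [tr_eq_sum]
  refine (Finset.sum_le_sum fun i _ => inner_apply_le_sigmaMax hd M _).trans ?_
  simp

theorem mul_lambdaMin_le_tr {d : ℕ} {M : Mat d} (hM : (M : E d →ₗ[ℝ] E d).IsSymmetric) :
    d * lambdaMin M ≤ tr M := by
  rw [tr_eq_sum]
  refine le_trans ?_ (Finset.sum_le_sum fun i _ => lambdaMin_mul_norm_sq_le hM _)
  simp

/-! ### Sub-Gaussianity and moments of the stationary law -/

section StationaryLaw

variable {d : ℕ} {Cμ : ℝ} {A : Mat d} {μ π : Measure (E d)}

theorem isSymmetric_covMat (ν : Measure (E d)) : (covMat ν : E d →ₗ[ℝ] E d).IsSymmetric :=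
  isPositive_covarianceOperator.1

theorem inner_covMat_nonneg (ν : Measure (E d)) (x : E d) : 0 ≤ ⟪x, covMat ν x⟫ := by
  have := (isPositive_covarianceOperator (μ := ν)).2 x
  rw [real_inner_comm]
  exact this

theorem memLp_id_of_hasSubgaussianMGF {ν : Measure (E d)}
    (h : ∀ x : E d, ∃ c, HasSubgaussianMGF (fun z : E d => ⟪x, z⟫) c ν) : MemLp id 2 ν := by
  refine MemLp.of_eval_piLp fun i => ?_
  obtain ⟨c, hc⟩ := h (EuclideanSpace.basisFun (Fin d) ℝ i)
  have := hc.memLp 2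
  simpa [EuclideanSpace.inner_single_left] using this

theorem IsSubGaussianNoise.memLp (hμ : IsSubGaussianNoise Cμ μ) : MemLp id 2 μ :=
  memLp_id_of_hasSubgaussianMGF fun x => ⟨_, hμ.subGaussian x⟩

theorem inner_covMat_eq_integral {ν : Measure (E d)} (hν : MemLp id 2 ν) (x y : E d) :
    ⟪covMat ν x, y⟫ = ∫ z, ⟪x, z⟫ * ⟪y, z⟫ ∂ν :=
  covarianceOperator_inner hν x y

theorem inner_covMat_self_eq_integral {ν : Measure (E d)} (hν : MemLp id 2 ν) (x : E d) :
    ⟪x, covMat ν x⟫ = ∫ z, ⟪x, z⟫ ^ 2 ∂ν := by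
  rw [real_inner_comm, inner_covMat_eq_integral hν]
  simp [sq]

theorem integrable_inner_sq {ν : Measure (E d)} (hν : MemLp id 2 ν) (x : E d) :
    Integrable (fun z => ⟪x, z⟫ ^ 2) ν := by
  have : MemLp (fun z => ⟪x, z⟫) 2 ν := hν.const_inner x
  exact this.integrable_sq

/-- If the form vanished at `x`, then `⟪x, z⟫ = 0` almost surely, so `x` would be orthogonal to the
range of the covariance, which is everything. -/
theorem IsSubGaussianNoise.inner_covMat_pos (hμ : IsSubGaussianNoise Cμ μ) {x : E d} (hx : x ≠ 0) :
    0 < ⟪x, covMat μ x⟫ := by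
  refine (inner_covMat_nonneg μ x).lt_of_ne fun h => hx ?_
  rw [inner_covMat_self_eq_integral hμ.memLp, eq_comm,
    integral_eq_zero_iff_of_nonneg (fun _ => sq_nonneg _) (integrable_inner_sq hμ.memLp x)] at h
  have hy : x ∈ LinearMap.range (covMat μ : E d →ₗ[ℝ] E d) := by simp [hμ.full_rank]
  obtain ⟨y, hy⟩ := hy
  rw [ContinuousLinearMap.coe_coe] at hy
  have h2 : ⟪covMat μ y, x⟫ = 0 := by
    rw [inner_covMat_eq_integral hμ.memLp]
    refine integral_eq_zero_of_ae ?_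
    filter_upwards [h] with z hz
    have : ⟪x, z⟫ = 0 := by simpa using hz
    simp [this]
  rwa [hy, inner_self_eq_zero] at h2

theorem IsSubGaussianNoise.lintegral_exp_inner_le (hC : 0 < Cμ) (hμ : IsSubGaussianNoise Cμ μ)
    (x : E d) :
    ∫⁻ z, ENNReal.ofReal (Real.exp ⟪x, z⟫) ∂μ ≤
      ENNReal.ofReal (Real.exp (Cμ / 2 * ⟪x, covMat μ x⟫)) := by
  have h := hμ.subGaussian x
  have h1 := h.integrable_exp_mul 1
  have h2 := h.mgf_le 1
  have h0 := mul_nonneg hC.le (inner_covMat_nonneg μ x)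
  simp only [mgf, one_mul, one_pow, mul_one, Real.coe_toNNReal _ h0] at h1 h2
  rw [← ofReal_integral_eq_lintegral_ofReal h1 (ae_of_all _ fun _ => (Real.exp_pos _).le)]
  refine ENNReal.ofReal_le_ofReal (h2.trans_eq ?_)
  congr 1
  ring

theorem IsStationaryLaw.lintegral_eq (hμ : IsSubGaussianNoise Cμ μ) (hπ : IsStationaryLaw A μ π)
    {f : E d → ENNReal} (hf : Measurable f) :
    ∫⁻ z, f z ∂π = ∫⁻ z, ∫⁻ w, f (A z + w) ∂μ ∂π := by
  have := hμ.isProbabilityMeasure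
  have := hπ.isProbabilityMeasure
  conv_lhs => rw [← hπ.invariant]
  rw [lintegral_map hf (by fun_prop), lintegral_prod _ (by fun_prop)]

/-- Using invariance `n` times peels off `n` independent noises, each contributing its moment
generating function. The cap `L` keeps the integrals finite, as exponential moments of `π` are not
yet known. -/
theorem IsStationaryLaw.lintegral_min_exp_le (hC : 0 < Cμ) (hμ : IsSubGaussianNoise Cμ μ)
    (hπ : IsStationaryLaw A μ π) (L : ENNReal) (x : E d) (n : ℕ) :
    ∫⁻ z, min (ENNReal.ofReal (Real.exp ⟪x, z⟫)) L ∂π ≤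
      ∫⁻ z, min (ENNReal.ofReal (Real.exp (∑ k ∈ Finset.range n,
        Cμ / 2 * ⟪(A.adjoint ^ k) x, covMat μ ((A.adjoint ^ k) x)⟫ + ⟪(A.adjoint ^ n) x, z⟫))) L ∂π := by
  have := hμ.isProbabilityMeasure
  induction n with
  | zero => simp
  | succ n ih =>
    refine ih.trans ?_
    set y := (A.adjoint ^ n) x with hy
    have hy' : (A.adjoint ^ (n + 1)) x = A.adjoint y := by rw [pow_succ']; rfl
    set c := ∑ k ∈ Finset.range n,
        Cμ / 2 * ⟪(A.adjoint ^ k) x, covMat μ ((A.adjoint ^ k) x)⟫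
    rw [hπ.lintegral_eq hμ (by fun_prop)]
    refine lintegral_mono fun z => ?_
    refine le_min ?_ ((lintegral_mono fun w => min_le_right _ _).trans (by simp))
    refine (lintegral_mono fun w => min_le_left _ _).trans ?_
    have e : ∀ w, ENNReal.ofReal (Real.exp (c + ⟪y, A z + w⟫)) =
        ENNReal.ofReal (Real.exp (c + ⟪A.adjoint y, z⟫)) * ENNReal.ofReal (Real.exp ⟪y, w⟫) := by
      intro w
      rw [← ENNReal.ofReal_mul (Real.exp_pos _).le, ← Real.exp_add, inner_add_right,
        ContinuousLinearMap.adjoint_inner_left, add_assoc]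
    rw [lintegral_congr e, lintegral_const_mul _ (by fun_prop)]
    refine (mul_le_mul_right (hμ.lintegral_exp_inner_le hC y) _).trans_eq ?_
    rw [← ENNReal.ofReal_mul (Real.exp_pos _).le, ← Real.exp_add, Finset.sum_range_succ, hy']
    congr 2
    ring

theorem norm_adjoint_pow_apply_le (A : Mat d) (x : E d) (n : ℕ) :
    ‖(A.adjoint ^ n) x‖ ≤ ‖A‖ ^ n * ‖x‖ := by
  induction n with
  | zero => simp
  | succ n ih =>
    have : (A.adjoint ^ (n + 1)) x = A.adjoint ((A.adjoint ^ n) x) := by rw [pow_succ']; rfl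
    rw [this]
    refine (ContinuousLinearMap.le_opNorm _ _).trans ?_
    rw [LinearIsometryEquiv.norm_map, pow_succ']
    calc _ ≤ ‖A‖ * (‖A‖ ^ n * ‖x‖) := by gcongr
      _ = _ := by ring

/-- As `n → ∞` the remaining term vanishes because `‖A‖ < 1`, by dominated convergence under the
cap. The cap is then removed by monotone convergence. -/
theorem IsStationaryLaw.lintegral_exp_inner_le (hC : 0 < Cμ) (hA : ‖A‖ < 1)
    (hμ : IsSubGaussianNoise Cμ μ) (hπ : IsStationaryLaw A μ π) {x : E d} {Q : ℝ}
    (hQ : ∀ n, ∑ k ∈ Finset.range n,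
        Cμ / 2 * ⟪(A.adjoint ^ k) x, covMat μ ((A.adjoint ^ k) x)⟫ ≤ Q) :
    ∫⁻ z, ENNReal.ofReal (Real.exp ⟪x, z⟫) ∂π ≤ ENNReal.ofReal (Real.exp Q) := by
  have := hπ.isProbabilityMeasure
  have h1 : ∀ L : ℕ, ∫⁻ z, min (ENNReal.ofReal (Real.exp ⟪x, z⟫)) L ∂π ≤
      ENNReal.ofReal (Real.exp Q) := by
    intro L
    have hlim : Filter.Tendsto (fun n => ∫⁻ z, min (ENNReal.ofReal (Real.exp
        (Q + ⟪(A.adjoint ^ n) x, z⟫))) (L : ENNReal) ∂π) Filter.atTop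
        (nhds (∫⁻ _, min (ENNReal.ofReal (Real.exp (Q + 0))) (L : ENNReal) ∂π)) := by
      refine tendsto_lintegral_of_dominated_convergence (fun _ => (L : ENNReal))
        (fun n => by fun_prop) (fun n => ae_of_all _ fun z => min_le_right _ _) (by simp)
        (ae_of_all _ fun z => ?_)
      refine Filter.Tendsto.min (ENNReal.tendsto_ofReal ((Real.continuous_exp.tendsto _).comp
        (Filter.Tendsto.const_add _ ?_))) tendsto_const_nhds
      refine squeeze_zero_norm (a := fun n => ‖A‖ ^ n * (‖x‖ * ‖z‖)) (fun n => ?_) ?_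
      · refine (norm_inner_le_norm _ _).trans ?_
        rw [← mul_assoc]
        exact mul_le_mul_of_nonneg_right (norm_adjoint_pow_apply_le A x n) (norm_nonneg _)
      · rw [← zero_mul (‖x‖ * ‖z‖)]
        exact (tendsto_pow_atTop_nhds_zero_of_lt_one (norm_nonneg A) hA).mul_const _
    have h2 := ge_of_tendsto' hlim fun n => (hπ.lintegral_min_exp_le hC hμ (L : ENNReal) x n).trans
      (lintegral_mono fun z => min_le_min_right _ (ENNReal.ofReal_le_ofReal
        (Real.exp_le_exp.2 (add_le_add_left (hQ n) _))))
    refine h2.trans ((lintegral_mono fun z => min_le_left _ _).trans (by simp))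
  have h2 : ∀ z : E d, ENNReal.ofReal (Real.exp ⟪x, z⟫) =
      ⨆ L : ℕ, min (ENNReal.ofReal (Real.exp ⟪x, z⟫)) (L : ENNReal) := by
    intro z
    refine le_antisymm ?_ (iSup_le fun L => min_le_left _ _)
    obtain ⟨L, hL⟩ := ENNReal.exists_nat_gt (ENNReal.ofReal_ne_top (r := Real.exp ⟪x, z⟫))
    exact le_iSup_of_le L (le_min le_rfl hL.le)
  rw [lintegral_congr h2]
  refine (lintegral_iSup
    (f := fun (L : ℕ) (z : E d) => min (ENNReal.ofReal (Real.exp ⟪x, z⟫)) (L : ENNReal))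
    (fun L => by fun_prop) (fun L L' h z => min_le_min_left _ ?_)).trans_le (iSup_le h1)
  exact_mod_cast h

theorem IsStationaryLaw.hasSubgaussianMGF_of_sum_le (hC : 0 < Cμ) (hA : ‖A‖ < 1)
    (hμ : IsSubGaussianNoise Cμ μ) (hπ : IsStationaryLaw A μ π) {x : E d} {Q : ℝ}
    (hQ : ∀ n, ∑ k ∈ Finset.range n,
        ⟪(A.adjoint ^ k) x, covMat μ ((A.adjoint ^ k) x)⟫ ≤ Q) :
    HasSubgaussianMGF (fun z : E d => ⟪x, z⟫) (Cμ * Q).toNNReal π := by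
  have hQ0 : 0 ≤ Q := by simpa using hQ 0
  have key : ∀ t : ℝ, ∫⁻ z, ENNReal.ofReal (Real.exp (t * ⟪x, z⟫)) ∂π ≤
      ENNReal.ofReal (Real.exp (Cμ * Q * t ^ 2 / 2)) := by
    intro t
    have := hπ.lintegral_exp_inner_le hC hA hμ (x := t • x) (Q := Cμ * Q * t ^ 2 / 2) ?_
    · simpa [real_inner_smul_left] using this
    · intro n
      have h := mul_le_mul_of_nonneg_left (hQ n) (by positivity : 0 ≤ Cμ * t ^ 2 / 2)
      rw [Finset.mul_sum] at h
      refine le_trans (le_of_eq (Finset.sum_congr rfl fun k _ => ?_)) (h.trans_eq (by ring))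
      simp only [map_smul, real_inner_smul_left, real_inner_smul_right]
      ring
  have hint : ∀ t : ℝ, Integrable (fun z : E d => Real.exp (t * ⟪x, z⟫)) π := fun t => by
    refine ⟨by fun_prop, ?_⟩
    rw [hasFiniteIntegral_iff_ofReal (ae_of_all _ fun _ => (Real.exp_pos _).le)]
    exact (key t).trans_lt ENNReal.ofReal_lt_top
  refine ⟨hint, fun t => ?_⟩
  rw [Real.coe_toNNReal _ (by positivity), mgf]
  rw [← ENNReal.ofReal_le_ofReal_iff (Real.exp_pos _).le, ofReal_integral_eq_lintegral_ofReal
    (hint t) (ae_of_all _ fun _ => (Real.exp_pos _).le)]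
  exact key t

/-- A crude geometric proxy suffices for square integrability, without which `covMat π` cannot be
used as a second moment. The sharp proxy comes afterwards. -/
theorem IsStationaryLaw.memLp (hC : 0 < Cμ) (hA : ‖A‖ < 1)
    (hμ : IsSubGaussianNoise Cμ μ) (hπ : IsStationaryLaw A μ π) : MemLp id 2 π := by
  refine memLp_id_of_hasSubgaussianMGF fun x => ⟨_, hπ.hasSubgaussianMGF_of_sum_le hC hA hμ
    (Q := ‖covMat μ‖ * ‖x‖ ^ 2 * (1 / (1 - ‖A‖))) fun n => ?_⟩
  refine le_trans (Finset.sum_le_sum fun k _ => ?_) ((Finset.mul_sum _ _ _).symm.trans_le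
    (mul_le_mul_of_nonneg_left (sum_range_pow_le (norm_nonneg A) hA n) (by positivity)))
  have h1 := norm_adjoint_pow_apply_le A x k
  have h2 : ‖(A.adjoint ^ k) x‖ ^ 2 ≤ ‖A‖ ^ k * ‖x‖ ^ 2 := by
    calc ‖(A.adjoint ^ k) x‖ ^ 2 ≤ (‖A‖ ^ k * ‖x‖) ^ 2 := by gcongr
      _ = ‖A‖ ^ k * (‖A‖ ^ k * ‖x‖ ^ 2) := by ring
      _ ≤ ‖A‖ ^ k * (1 * ‖x‖ ^ 2) := by
        gcongr
        exact pow_le_one₀ (norm_nonneg _) hA.le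
      _ = _ := by ring
  refine (real_inner_le_norm _ _).trans ?_
  calc _ ≤ ‖(A.adjoint ^ k) x‖ * (‖covMat μ‖ * ‖(A.adjoint ^ k) x‖) := by
        gcongr
        exact ContinuousLinearMap.le_opNorm _ _
    _ = ‖covMat μ‖ * ‖(A.adjoint ^ k) x‖ ^ 2 := by ring
    _ ≤ ‖covMat μ‖ * (‖A‖ ^ k * ‖x‖ ^ 2) := by gcongr
    _ = _ := by ring

/-- The Lyapunov equation `G = A G Aᵀ + Σ`; the cross term vanishes because the noise is centred and
independent of the state. -/
theorem IsStationaryLaw.inner_covMat_eq (hC : 0 < Cμ) (hA : ‖A‖ < 1)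
    (hμ : IsSubGaussianNoise Cμ μ) (hπ : IsStationaryLaw A μ π) (x : E d) :
    ⟪x, covMat π x⟫ = ⟪A.adjoint x, covMat π (A.adjoint x)⟫ + ⟪x, covMat μ x⟫ := by
  have := hμ.isProbabilityMeasure
  have := hπ.isProbabilityMeasure
  have hL := hπ.memLp hC hA hμ
  rw [inner_covMat_self_eq_integral hL, inner_covMat_self_eq_integral hL,
    inner_covMat_self_eq_integral hμ.memLp]
  conv_lhs => rw [← hπ.invariant]
  rw [integral_map (by fun_prop) (by fun_prop)]
  have e : ∀ p : E d × E d, ⟪x, A p.1 + p.2⟫ ^ 2 =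
      ⟪A.adjoint x, p.1⟫ ^ 2 + 2 * (⟪A.adjoint x, p.1⟫ * ⟪x, p.2⟫) + ⟪x, p.2⟫ ^ 2 := by
    intro p
    rw [inner_add_right, ContinuousLinearMap.adjoint_inner_left]
    ring
  simp_rw [e]
  have i1 : Integrable (fun p : E d × E d => ⟪A.adjoint x, p.1⟫ ^ 2) (π.prod μ) :=
    (integrable_inner_sq hL _).comp_fst μ
  have i3 : Integrable (fun p : E d × E d => ⟪x, p.2⟫ ^ 2) (π.prod μ) :=
    (integrable_inner_sq hμ.memLp _).comp_snd π
  have j1 : Integrable (fun z : E d => ⟪A.adjoint x, z⟫) π :=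
    (hL.const_inner (A.adjoint x)).integrable (by simp)
  have j2 : Integrable (fun z : E d => ⟪x, z⟫) μ :=
    (hμ.memLp.const_inner x).integrable (by simp)
  have i2 : Integrable (fun p : E d × E d => ⟪A.adjoint x, p.1⟫ * ⟪x, p.2⟫) (π.prod μ) :=
    j1.mul_prod j2
  have hz : ∫ z, ⟪x, z⟫ ∂μ = 0 := by
    have := integral_inner (𝕜 := ℝ) (E := E d) (f := fun z => z)
      (hμ.memLp.integrable (by simp)) x
    rw [this, hμ.mean_zero, inner_zero_right]
  refine (integral_add (i1.add (i2.const_mul 2)) i3).trans ?_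
  refine (congrArg (· + _) (integral_add i1 (i2.const_mul 2))).trans ?_
  beta_reduce
  rw [integral_const_mul, integral_prod_mul (fun z => ⟪A.adjoint x, z⟫) (fun w => ⟪x, w⟫), hz,
    integral_fun_fst (fun z => ⟪A.adjoint x, z⟫ ^ 2), integral_fun_snd (fun z => ⟪x, z⟫ ^ 2)]
  simp

/-- The Lyapunov equation telescopes the partial sums of noise variances below `⟪x, G x⟫`. The proxy
thus carries no factor `1/(1 - ‖A‖)`. -/
theorem IsStationaryLaw.hasSubgaussianMGF (hC : 0 < Cμ) (hA : ‖A‖ < 1)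
    (hμ : IsSubGaussianNoise Cμ μ) (hπ : IsStationaryLaw A μ π) (x : E d) :
    HasSubgaussianMGF (fun z : E d => ⟪x, z⟫) (Cμ * ⟪x, covMat π x⟫).toNNReal π := by
  refine hπ.hasSubgaussianMGF_of_sum_le hC hA hμ fun n => ?_
  have : ∑ k ∈ Finset.range n, ⟪(A.adjoint ^ k) x, covMat μ ((A.adjoint ^ k) x)⟫ =
      ⟪x, covMat π x⟫ - ⟪(A.adjoint ^ n) x, covMat π ((A.adjoint ^ n) x)⟫ := by
    induction n with
    | zero => simp
    | succ n ih =>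
      have h := hπ.inner_covMat_eq hC hA hμ ((A.adjoint ^ n) x)
      have e : (A.adjoint ^ (n + 1)) x = A.adjoint ((A.adjoint ^ n) x) := by rw [pow_succ']; rfl
      rw [Finset.sum_range_succ, ih, e]
      linarith
  rw [this]
  linarith [inner_covMat_nonneg π ((A.adjoint ^ n) x)]

theorem IsStationaryLaw.inner_covMat_pos (hC : 0 < Cμ) (hA : ‖A‖ < 1)
    (hμ : IsSubGaussianNoise Cμ μ) (hπ : IsStationaryLaw A μ π) {x : E d} (hx : x ≠ 0) :
    0 < ⟪x, covMat π x⟫ := by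
  rw [hπ.inner_covMat_eq hC hA hμ]
  linarith [inner_covMat_nonneg π (A.adjoint x), hμ.inner_covMat_pos hx]

theorem pow_four_le_exp_add_exp (y : ℝ) : y ^ 4 ≤ 24 * (Real.exp y + Real.exp (-y)) := by
  have h := Real.pow_div_factorial_le_exp |y| (abs_nonneg y) 4
  have e : |y| ^ 4 = y ^ 4 := by
    rw [show |y| ^ 4 = (|y| ^ 2) ^ 2 by ring, sq_abs]; ring
  rw [e] at h
  norm_num [Nat.factorial] at h
  have h2 : Real.exp |y| ≤ Real.exp y + Real.exp (-y) := by
    rcases abs_cases y with ⟨h, _⟩ | ⟨h, _⟩ <;> rw [h] <;>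
      linarith [Real.exp_pos y, Real.exp_pos (-y)]
  linarith

theorem IsStationaryLaw.integral_inner_pow_four_le (hC : 0 < Cμ) (hA : ‖A‖ < 1)
    (hμ : IsSubGaussianNoise Cμ μ) (hπ : IsStationaryLaw A μ π) (x : E d) :
    Integrable (fun z => ⟪x, z⟫ ^ 4) π ∧
    ∫ z, ⟪x, z⟫ ^ 4 ∂π ≤ 48 * Real.exp (Cμ / 2) * ⟪x, covMat π x⟫ ^ 2 := by
  have hint : ∀ x : E d, Integrable (fun z => ⟪x, z⟫ ^ 4) π := fun x => by
    have := ((hπ.hasSubgaussianMGF hC hA hμ x).memLp 4).integrable_norm_pow (by norm_num)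
    refine this.congr (ae_of_all _ fun z => ?_)
    simp only [Real.norm_eq_abs]
    rw [show |⟪x, z⟫| ^ 4 = (|⟪x, z⟫| ^ 2) ^ 2 by ring, sq_abs]; ring
  refine ⟨hint x, ?_⟩
  by_cases hx : x = 0
  · simp [hx]
  set g := ⟪x, covMat π x⟫ with hg
  have hg0 : 0 < g := hπ.inner_covMat_pos hC hA hμ hx
  -- Normalises `⟪x, z⟫` to unit variance, so that both exponential moments are bounded by `exp (Cμ
  -- / 2)`.
  set s : ℝ := (√g)⁻¹ with hs
  have hs2 : s ^ 2 * g = 1 := by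
    rw [hs, inv_pow, Real.sq_sqrt hg0.le, inv_mul_cancel₀ hg0.ne']
  have hS := hπ.hasSubgaussianMGF hC hA hμ x
  have hpos : 0 ≤ Cμ * g := by positivity
  have h1 : mgf (fun z => ⟪x, z⟫) π s ≤ Real.exp (Cμ / 2) := by
    refine (hS.mgf_le s).trans_eq ?_
    rw [Real.coe_toNNReal _ hpos]
    congr 1
    linear_combination Cμ / 2 * hs2
  have h2 : mgf (fun z => ⟪x, z⟫) π (-s) ≤ Real.exp (Cμ / 2) := by
    refine (hS.mgf_le (-s)).trans_eq ?_
    rw [Real.coe_toNNReal _ hpos]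
    congr 1
    linear_combination Cμ / 2 * hs2
  have h3 : ∫ z, s ^ 4 * ⟪x, z⟫ ^ 4 ∂π ≤
      ∫ z, 24 * (Real.exp (s * ⟪x, z⟫) + Real.exp (-s * ⟪x, z⟫)) ∂π := by
    refine integral_mono ((hint x).const_mul _)
      (((hS.integrable_exp_mul s).add (hS.integrable_exp_mul (-s))).const_mul 24) fun z => ?_
    have := pow_four_le_exp_add_exp (s * ⟪x, z⟫)
    simp only
    rw [neg_mul, ← mul_pow]
    exact this
  rw [integral_const_mul, integral_const_mul,
    integral_add (hS.integrable_exp_mul s) (hS.integrable_exp_mul (-s))] at h3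
  simp only [mgf] at h1 h2
  have h4 : s ^ 4 * g ^ 2 = 1 := by
    linear_combination (s ^ 2 * g + 1) * hs2
  have h5 : s ^ 4 * ∫ z, ⟪x, z⟫ ^ 4 ∂π ≤ 48 * Real.exp (Cμ / 2) := by linarith
  calc ∫ z, ⟪x, z⟫ ^ 4 ∂π = (s ^ 4 * ∫ z, ⟪x, z⟫ ^ 4 ∂π) * g ^ 2 := by
        linear_combination (-∫ z, ⟪x, z⟫ ^ 4 ∂π) * h4
    _ ≤ _ := by gcongr

/-- If every squared coordinate is at most `ρ` times its variance, then `‖z‖² ≤ ρ tr G`. A union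
bound over `2d` one-sided tails gives the rest. -/
theorem IsStationaryLaw.measure_norm_sq_gt_le (hC : 0 < Cμ) (hA : ‖A‖ < 1)
    (hμ : IsSubGaussianNoise Cμ μ) (hπ : IsStationaryLaw A μ π) {ρ : ℝ} (hρ : 0 ≤ ρ) :
    π.real {z | ρ * tr (covMat π) < ‖z‖ ^ 2} ≤ 2 * d * Real.exp (-(ρ / (2 * Cμ))) := by
  have := hπ.isProbabilityMeasure
  set e := EuclideanSpace.basisFun (Fin d) ℝ with he
  set g : Fin d → ℝ := fun i => ⟪e i, covMat π (e i)⟫ with hg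
  have hg0 : ∀ i, 0 < g i := fun i => hπ.inner_covMat_pos hC hA hμ (e.orthonormal.ne_zero i)
  have hsub : {z : E d | ρ * tr (covMat π) < ‖z‖ ^ 2} ⊆
      ⋃ i ∈ (Finset.univ : Finset (Fin d)),
        ({z : E d | √(ρ * g i) ≤ ⟪e i, z⟫} ∪ {z | √(ρ * g i) ≤ ⟪-e i, z⟫}) := by
    intro z hz
    by_contra hcon
    simp only [Set.mem_iUnion, not_exists, Finset.mem_univ, Set.mem_union,
      Set.mem_ofPred_eq, not_or, not_le, forall_true_left] at hcon
    rw [Set.mem_ofPred_eq, tr_eq_sum, ← OrthonormalBasis.sum_sq_norm_inner_right e z,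
      Finset.mul_sum] at hz
    refine absurd hz (not_lt.2 (Finset.sum_le_sum fun i _ => ?_))
    obtain ⟨h1, h2⟩ := hcon i
    rw [inner_neg_left] at h2
    have h3 : |⟪e i, z⟫| ≤ √(ρ * g i) := abs_le.2 ⟨by linarith, h1.le⟩
    rw [Real.norm_eq_abs]
    refine (pow_le_pow_left₀ (abs_nonneg _) h3 2).trans_eq ?_
    rw [Real.sq_sqrt (mul_nonneg hρ (hg0 i).le)]
  have hone : ∀ x : E d, x ≠ 0 → π.real {z | √(ρ * ⟪x, covMat π x⟫) ≤ ⟪x, z⟫} ≤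
      Real.exp (-(ρ / (2 * Cμ))) := by
    intro x hx
    have hx0 := hπ.inner_covMat_pos hC hA hμ hx
    refine ((hπ.hasSubgaussianMGF hC hA hμ x).measure_ge_le (Real.sqrt_nonneg _)).trans_eq ?_
    rw [Real.sq_sqrt (by positivity), Real.coe_toNNReal _ (by positivity)]
    congr 1
    field_simp
  refine (measureReal_mono hsub (measure_ne_top _ _)).trans
    ((measureReal_biUnion_finset_le _ _).trans ?_)
  refine (Finset.sum_le_sum fun i _ => (measureReal_union_le _ _).trans (add_le_add
    (hone (e i) (e.orthonormal.ne_zero i)) ?_)).trans_eq (b := ∑ i : Fin d,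
      (Real.exp (-(ρ / (2 * Cμ))) + Real.exp (-(ρ / (2 * Cμ))))) ?_
  · have := hone (-e i) (neg_ne_zero.2 (e.orthonormal.ne_zero i))
    simpa [hg] using this
  · simp
    ring

end StationaryLaw

/-! ### Measurability -/

theorem continuous_outer {d : ℕ} : Continuous fun p : E d × E d => outer p.1 p.2 :=
  ((InnerProductSpace.rankOne (𝕜 := ℝ) (E := E d) (F := E d)).continuous.comp
    continuous_fst).clm_apply continuous_snd

theorem measurable_stepFactor {d : ℕ} (γ : ℝ) : Measurable (stepFactor γ : E d → Mat d) := by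
  refine Continuous.measurable ?_
  exact continuous_const.sub
    ((continuous_outer.comp (continuous_id.prodMk continuous_id)).const_smul (2 * γ))

section Measurability

variable {d : ℕ} {Ω : Type*} [MeasurableSpace Ω]

theorem measurable_mul_mat {f g : Ω → Mat d} (hf : Measurable f) (hg : Measurable g) :
    Measurable fun ω => f ω * g ω :=
  (continuous_mul (M := Mat d)).measurable.comp (hf.prodMk hg)

theorem measurable_mat_apply {f : Ω → Mat d} {g : Ω → E d} (hf : Measurable f)
    (hg : Measurable g) : Measurable fun ω => f ω (g ω) :=
  (continuous_fst.clm_apply continuous_snd : Continuous fun p : Mat d × E d => p.1 p.2).measurable.comp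
    (hf.prodMk hg)

theorem measurable_contraction (γ : ℝ) {x : Ω → ℕ → E d} {n : ℕ}
    (hx : ∀ k < n, Measurable fun ω => x ω k) : Measurable fun ω => contraction γ (x ω) n := by
  induction n with
  | zero => exact measurable_const
  | succ n ih =>
    exact measurable_mul_mat ((measurable_stepFactor γ).comp (hx n (by omega)))
      (ih fun k hk => hx k (by omega))

theorem measurable_noiseSum (γ : ℝ) {x z : Ω → ℕ → E d} {n : ℕ}
    (hx : ∀ k < n, Measurable fun ω => x ω k) (hz : ∀ k < n, Measurable fun ω => z ω k) :
    Measurable fun ω => noiseSum γ (x ω) (z ω) n := by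
  induction n with
  | zero => exact measurable_const
  | succ n ih =>
    refine (ih (fun k hk => hx k (by omega)) fun k hk => hz k (by omega)).add
      ((measurable_mul_mat (continuous_outer.measurable.comp
        ((hz n (by omega)).prodMk (hx n (by omega))))
        (measurable_contraction γ fun k hk => hx k (by omega))).const_smul (2 * γ))

theorem measurable_inner_sub_energy {M N : Ω → Mat d} (hM : Measurable M) (hN : Measurable N)
    (l c : ℝ) (v w : E d) :
    Measurable fun ω => l * ⟪v, M ω w⟫ - c * (‖w‖ ^ 2 - ‖N ω w‖ ^ 2) := by
  have h1 := measurable_mat_apply hM (measurable_const (a := w))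
  have h2 := measurable_mat_apply hN (measurable_const (a := w))
  fun_prop

theorem measurable_mul_inner_apply {x : Ω → E d} {M : Ω → Mat d} (hx : Measurable x)
    (hM : Measurable M) (c : ℝ) (w : E d) : Measurable fun ω => c * ⟪x ω, M ω w⟫ := by
  have h2 := measurable_mat_apply hM (measurable_const (a := w))
  fun_prop

end Measurability

/-! ### Truncation, and integration with independent variables frozen -/

/-- The vector `x` if `‖x‖² ≤ R`, and zero otherwise. -/
noncomputable def trunc {d : ℕ} (R : ℝ) (x : E d) : E d := if ‖x‖ ^ 2 ≤ R then x else 0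

theorem measurable_trunc {d : ℕ} (R : ℝ) : Measurable (trunc R : E d → E d) :=
  Measurable.ite (measurableSet_le (by fun_prop) measurable_const) measurable_id measurable_const

theorem norm_sq_trunc_le {d : ℕ} {R : ℝ} (hR : 0 ≤ R) (x : E d) : ‖trunc R x‖ ^ 2 ≤ R := by
  unfold trunc
  split_ifs with h
  · exact h
  · simpa using hR

theorem trunc_of_le {d : ℕ} {R : ℝ} {x : E d} (h : ‖x‖ ^ 2 ≤ R) : trunc R x = x := if_pos h

theorem inner_trunc_sq_le {d : ℕ} (R : ℝ) (x w : E d) : ⟪trunc R x, w⟫ ^ 2 ≤ ⟪x, w⟫ ^ 2 := by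
  unfold trunc
  split_ifs
  · rfl
  · simpa using sq_nonneg _

theorem lintegral_comp_of_indep {Ω β δ : Type*} {m mΩ : MeasurableSpace Ω} [MeasurableSpace β]
    [MeasurableSpace δ] {P : Measure Ω} [IsProbabilityMeasure P] (hm : m ≤ mΩ) {Y : Ω → β}
    {ξ : Ω → δ} (hY : Measurable[m] Y) (hξ : Measurable ξ)
    (h : Indep m (MeasurableSpace.comap ξ inferInstance) P) {F : β → δ → ENNReal}
    (hF : Measurable (Function.uncurry F)) :
    ∫⁻ ω, F (Y ω) (ξ ω) ∂P = ∫⁻ ω, ∫⁻ z, F (Y ω) z ∂(P.map ξ) ∂P := by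
  have hY' : Measurable Y := hY.mono hm le_rfl
  have hind : IndepFun Y ξ P := indep_of_indep_of_le_left h hY.comap_le
  have := hind.map_prod_eq_prod_map_map hY'.aemeasurable hξ.aemeasurable
  have h1 : ∫⁻ ω, F (Y ω) (ξ ω) ∂P =
      ∫⁻ p, Function.uncurry F p ∂(P.map fun ω => (Y ω, ξ ω)) := by
    rw [lintegral_map hF (hY'.prodMk hξ)]
    rfl
  have := Measure.isProbabilityMeasure_map (μ := P) hξ.aemeasurable
  rw [h1, hind.map_prod_eq_prod_map_map hY'.aemeasurable hξ.aemeasurable,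
    lintegral_prod _ hF.aemeasurable, lintegral_map hF.lintegral_prod_right' hY']
  rfl

theorem lintegral_lintegral_comp_of_indep {Ω β δ : Type*} {m mΩ : MeasurableSpace Ω}
    [MeasurableSpace β] [MeasurableSpace δ] {P : Measure Ω} [IsProbabilityMeasure P] (hm : m ≤ mΩ)
    {Y : Ω → β} {ξ : Ω → δ} (hY : Measurable[m] Y) (hξ : Measurable ξ)
    (h : Indep m (MeasurableSpace.comap ξ inferInstance) P) {F : β → δ → ENNReal}
    (hF : Measurable (Function.uncurry F)) :
    ∫⁻ ω, F (Y ω) (ξ ω) ∂P = ∫⁻ ω, ∫⁻ ω', F (Y ω) (ξ ω') ∂P ∂P := by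
  rw [lintegral_comp_of_indep hm hY hξ h hF]
  exact lintegral_congr fun ω => lintegral_map (hF.comp measurable_prodMk_left) hξ

/-! ### Exponential and contraction bounds for one buffer -/

/-- A chain `X (k + 1) = A X k + η k` of length `S` that starts from the law `π` and is adapted to
the filtration `ℱ`, where the noise `η k` has law `μ` and is independent of `ℱ k`. -/
structure IsChain {d : ℕ} {Ω : Type*} [mΩ : MeasurableSpace Ω] (A : Mat d) (μ π : Measure (E d))
    (S : ℕ) (P : Measure Ω) (ℱ : ℕ → MeasurableSpace Ω) (X η : ℕ → Ω → E d) : Prop where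
  le : ∀ k, ℱ k ≤ mΩ
  mono : Monotone ℱ
  measurable_init : Measurable[ℱ 0] (X 0)
  init_law : P.map (X 0) = π
  measurable_noise : ∀ k < S, Measurable[ℱ (k + 1)] (η k)
  noise_law : ∀ k < S, P.map (η k) = μ
  indep : ∀ k < S, Indep (ℱ k) (MeasurableSpace.comap (η k) inferInstance) P
  recursion : ∀ k < S, ∀ ω, X (k + 1) ω = A (X k ω) + η k ω

section Chain

variable {d : ℕ} {Cμ : ℝ} {A : Mat d} {μ π : Measure (E d)} {Ω : Type*} [mΩ : MeasurableSpace Ω]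
  {P : Measure Ω} {S : ℕ} {ℱ : ℕ → MeasurableSpace Ω}
  {X η : ℕ → Ω → E d}

theorem IsChain.measurable_state (h : IsChain A μ π S P ℱ X η) {k : ℕ} (hk : k ≤ S) :
    Measurable[ℱ k] (X k) := by
  induction k with
  | zero => exact h.measurable_init
  | succ k ih =>
    have e : X (k + 1) = fun ω => A (X k ω) + η k ω := funext (h.recursion k (by omega))
    rw [e]
    have h1 : Measurable[ℱ (k + 1)] (X k) := (ih (by omega)).mono (h.mono (Nat.le_succ k)) le_rfl
    have h2 : Measurable fun p : E d × E d => A p.1 + p.2 := by fun_prop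
    exact h2.comp (h1.prodMk (h.measurable_noise k (by omega)))

theorem IsChain.law_state [IsProbabilityMeasure P] (hπ : IsStationaryLaw A μ π)
    (h : IsChain A μ π S P ℱ X η) {k : ℕ}
    (hk : k ≤ S) : P.map (X k) = π := by
  induction k with
  | zero => exact h.init_law
  | succ k ih =>
    have hX : Measurable (X k) := (h.measurable_state (by omega)).mono (h.le _) le_rfl
    have hη : Measurable (η k) := (h.measurable_noise k (by omega)).mono (h.le _) le_rfl
    have hind : IndepFun (X k) (η k) P :=
      indep_of_indep_of_le_left (h.indep k (by omega)) (h.measurable_state (by omega)).comap_le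
    have e : X (k + 1) = (fun p : E d × E d => A p.1 + p.2) ∘ fun ω => (X k ω, η k ω) :=
      funext (h.recursion k (by omega))
    rw [e, ← Measure.map_map (by fun_prop) (hX.prodMk hη),
      hind.map_prod_eq_prod_map_map hX.aemeasurable hη.aemeasurable, ih (by omega),
      h.noise_law k (by omega), hπ.invariant]

/-- An exponential supermartingale whose compensator is the energy lost by `w`. Measuring the
variance by energy is what later allows it to be telescoped over buffers. -/
theorem IsChain.lintegral_exp_noiseSum_le_one [IsProbabilityMeasure P] (hC : 0 < Cμ)
    (hμ : IsSubGaussianNoise Cμ μ)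
    (h : IsChain A μ π S P ℱ X η) {γ R : ℝ} (hγ : 0 ≤ γ) (hR : 0 ≤ R) (hγR : γ * R ≤ 1 / 2)
    {u : ℕ} (l : ℝ) (v w : E d) (n : ℕ) (hn : u + n ≤ S) :
    ∫⁻ ω, ENNReal.ofReal (Real.exp
      (l * ⟪v, noiseSum γ (fun k => trunc R (X (u + k) ω)) (fun k => η (u + k) ω) n w⟫ -
        l ^ 2 * γ * (Cμ * ⟪v, covMat μ v⟫) *
          (‖w‖ ^ 2 - ‖contraction γ (fun k => trunc R (X (u + k) ω)) n w‖ ^ 2))) ∂P ≤ 1 := by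
  induction n with
  | zero => simp [noiseSum, contraction]
  | succ n ih =>
    set x : Ω → ℕ → E d := fun ω k => trunc R (X (u + k) ω) with hx
    set z : Ω → ℕ → E d := fun ω k => η (u + k) ω with hz
    set σ := Cμ * ⟪v, covMat μ v⟫ with hσ
    have hσ0 : 0 ≤ σ := mul_nonneg hC.le (inner_covMat_nonneg μ v)
    have hxm : ∀ k ≤ n, Measurable[ℱ (u + n)] fun ω => x ω k := fun k hk =>
      (measurable_trunc R).comp ((h.measurable_state (by omega)).mono (h.mono (by omega)) le_rfl)
    have hzm : ∀ k < n, Measurable[ℱ (u + n)] fun ω => z ω k := fun k hk =>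
      (h.measurable_noise (u + k) (by omega)).mono (h.mono (by omega)) le_rfl
    have hcm : Measurable[ℱ (u + n)] fun ω => contraction γ (x ω) n :=
      @measurable_contraction d Ω (ℱ (u + n)) γ x n fun k hk => hxm k hk.le
    have hcm1 : Measurable[ℱ (u + n)] fun ω => contraction γ (x ω) (n + 1) :=
      @measurable_contraction d Ω (ℱ (u + n)) γ x (n + 1) fun k hk => hxm k (by omega)
    have hnm : Measurable[ℱ (u + n)] fun ω => noiseSum γ (x ω) (z ω) n :=
      @measurable_noiseSum d Ω (ℱ (u + n)) γ x z n (fun k hk => hxm k hk.le) hzm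
    -- The energy after `n + 1` steps belongs to the known part: it involves samples up to time `u +
    -- n` only, and these precede the noise `η (u + n)`.
    set G : Ω → ℝ := fun ω => l * ⟪v, noiseSum γ (x ω) (z ω) n w⟫ -
      l ^ 2 * γ * σ * (‖w‖ ^ 2 - ‖contraction γ (x ω) (n + 1) w‖ ^ 2) with hG
    set b : Ω → ℝ := fun ω => 2 * γ * l * ⟪x ω n, contraction γ (x ω) n w⟫ with hb
    have hGm : Measurable[ℱ (u + n)] G :=
      @measurable_inner_sub_energy d Ω (ℱ (u + n)) _ _ hnm hcm1 l (l ^ 2 * γ * σ) v w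
    have hbm : Measurable[ℱ (u + n)] b :=
      @measurable_mul_inner_apply d Ω (ℱ (u + n)) _ _ (hxm n le_rfl) hcm (2 * γ * l) w
    have hηm : Measurable (η (u + n)) :=
      (h.measurable_noise (u + n) (by omega)).mono (h.le _) le_rfl
    have e1 : ∀ ω, l * ⟪v, noiseSum γ (x ω) (z ω) (n + 1) w⟫ -
        l ^ 2 * γ * σ * (‖w‖ ^ 2 - ‖contraction γ (x ω) (n + 1) w‖ ^ 2) =
        G ω + b ω * ⟪v, η (u + n) ω⟫ := by
      intro ω
      have e0 : ⟪v, noiseSum γ (x ω) (z ω) (n + 1) w⟫ = ⟪v, noiseSum γ (x ω) (z ω) n w⟫ +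
          2 * γ * ⟪v, η (u + n) ω⟫ * ⟪x ω n, contraction γ (x ω) n w⟫ := by
        rw [inner_noiseSum_apply, Finset.sum_range_succ, ← inner_noiseSum_apply]
      rw [e0]
      simp only [hG, hb]
      ring
    refine (lintegral_congr fun ω =>
      congrArg (fun t => ENNReal.ofReal (Real.exp t)) (e1 ω)).trans_le ?_
    have key := lintegral_comp_of_indep (P := P) (h.le (u + n)) (hGm.prodMk hbm) hηm
      (h.indep (u + n) (by omega))
      (F := fun p y => ENNReal.ofReal (Real.exp (p.1 + p.2 * ⟪v, y⟫))) (by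
        unfold Function.uncurry
        fun_prop)
    refine key.trans_le ?_
    rw [h.noise_law _ (by omega)]
    refine (lintegral_mono fun ω => ?_).trans (ih (by omega))
    have e2 : ∀ y, ENNReal.ofReal (Real.exp (G ω + b ω * ⟪v, y⟫)) =
        ENNReal.ofReal (Real.exp (G ω)) * ENNReal.ofReal (Real.exp ⟪b ω • v, y⟫) := fun y => by
      rw [← ENNReal.ofReal_mul (Real.exp_pos _).le, ← Real.exp_add, real_inner_smul_left]
    refine (lintegral_congr e2).trans_le ?_
    rw [lintegral_const_mul _ (by fun_prop)]
    refine (mul_le_mul_right (hμ.lintegral_exp_inner_le hC (b ω • v)) _).trans ?_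
    rw [← ENNReal.ofReal_mul (Real.exp_pos _).le, ← Real.exp_add]
    refine ENNReal.ofReal_le_ofReal (Real.exp_le_exp.2 ?_)
    have h5 : γ * ‖x ω n‖ ^ 2 ≤ 1 / 2 :=
      (mul_le_mul_of_nonneg_left (norm_sq_trunc_le hR _) hγ).trans hγR
    have h6 := norm_sq_stepFactor_apply_le hγ h5 (contraction γ (x ω) n w)
    rw [← contraction_succ_apply] at h6
    have h7 := mul_le_mul_of_nonneg_left h6 (by positivity : 0 ≤ l ^ 2 * γ * σ)
    -- The new noise costs `2γ²l²σ⟪x, ·⟫²`, which is `l²γσ` times the guaranteed energy loss `2γ⟪x,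
    -- ·⟫²` of the step.
    have h8 : Cμ / 2 * ⟪b ω • v, covMat μ (b ω • v)⟫ = σ / 2 * b ω ^ 2 := by
      rw [map_smul, real_inner_smul_left, real_inner_smul_right, hσ]
      ring
    rw [h8]
    simp only [hG, hb]
    linarith

/-- The constant in the fourth moment bound for the stationary law. -/
noncomputable def momentConst (Cμ : ℝ) : ℝ := 48 * Real.exp (Cμ / 2)

theorem one_le_momentConst {Cμ : ℝ} (hC : 0 < Cμ) : 1 ≤ momentConst Cμ := by
  have := Real.one_le_exp (by positivity : 0 ≤ Cμ / 2)
  unfold momentConst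
  linarith

theorem exp_neg_le_quadratic {y : ℝ} (hy : 0 ≤ y) : Real.exp (-y) ≤ 1 - y + y ^ 2 / 2 := by
  have h := Real.quadratic_le_exp_of_nonneg hy
  rw [Real.exp_neg, inv_le_iff_one_le_mul₀ (Real.exp_pos y)]
  have h0 : 0 ≤ 1 - y + y ^ 2 / 2 := by nlinarith [sq_nonneg (1 - y)]
  nlinarith [mul_le_mul_of_nonneg_left h h0, sq_nonneg (y ^ 2)]

/-- The truncated part of the second moment is small by the fourth moment bound and the small
probability of truncation. -/
theorem IsStationaryLaw.half_le_integral_inner_trunc_sq (hC : 0 < Cμ) (hA : ‖A‖ < 1)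
    (hμ : IsSubGaussianNoise Cμ μ) (hπ : IsStationaryLaw A μ π) {R : ℝ}
    (hp : π.real {z | R < ‖z‖ ^ 2} ≤ 1 / (4 * momentConst Cμ)) {w : E d} (hw : w ≠ 0) :
    ⟪w, covMat π w⟫ / 2 ≤ ∫ z, ⟪trunc R z, w⟫ ^ 2 ∂π := by
  have := hπ.isProbabilityMeasure
  have hK := one_le_momentConst hC
  set K := momentConst Cμ with hKd
  set g := ⟪w, covMat π w⟫ with hg
  have hg0 : 0 < g := hπ.inner_covMat_pos hC hA hμ hw
  obtain ⟨i4, h4⟩ := hπ.integral_inner_pow_four_le hC hA hμ w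
  have hL := hπ.memLp hC hA hμ
  have i2 := integrable_inner_sq hL w
  have hs : MeasurableSet {z : E d | R < ‖z‖ ^ 2} := measurableSet_lt measurable_const (by fun_prop)
  have i1 : Integrable ({z : E d | R < ‖z‖ ^ 2}.indicator fun _ => (1 : ℝ)) π :=
    (integrable_const 1).indicator hs
  have it : Integrable (fun z => ⟪trunc R z, w⟫ ^ 2) π := by
    refine i2.mono' (((measurable_trunc R).inner measurable_const).pow_const 2).aestronglyMeasurable
      (ae_of_all _ fun z => ?_)
    rw [Real.norm_of_nonneg (sq_nonneg _), real_inner_comm z w]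
    exact inner_trunc_sq_le R z w
  -- Pointwise `y² ≤ y⁴/(4Kg) + Kg` on the truncated event; each of the two terms then has integral
  -- at most `g/4`.
  have hpt : ∀ z : E d, ⟪w, z⟫ ^ 2 - (1 / (4 * K * g) * ⟪w, z⟫ ^ 4 +
      K * g * ({z : E d | R < ‖z‖ ^ 2}.indicator (fun _ => (1 : ℝ)) z)) ≤ ⟪trunc R z, w⟫ ^ 2 := by
    intro z
    have hpos : 0 ≤ 1 / (4 * K * g) * ⟪w, z⟫ ^ 4 := by positivity
    by_cases hz : R < ‖z‖ ^ 2
    · rw [Set.indicator_of_mem (by exact hz), trunc, if_neg (not_le.2 hz)]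
      have : 1 / (4 * K * g) * ⟪w, z⟫ ^ 4 + K * g * 1 - ⟪w, z⟫ ^ 2 =
          1 / (4 * K * g) * (⟪w, z⟫ ^ 2 - 2 * K * g) ^ 2 := by
        field_simp
        ring
      have h0 : 0 ≤ 1 / (4 * K * g) * (⟪w, z⟫ ^ 2 - 2 * K * g) ^ 2 := by positivity
      simp only [inner_zero_left]
      linarith
    · rw [Set.indicator_of_notMem (by exact hz), trunc, if_pos (not_lt.1 hz), real_inner_comm w z]
      linarith
  have hint := integral_mono (i2.sub ((i4.const_mul (1 / (4 * K * g))).add (i1.const_mul (K * g))))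
    it hpt
  refine le_trans ?_ hint
  have e : ∫ z, (⟪w, z⟫ ^ 2 - (1 / (4 * K * g) * ⟪w, z⟫ ^ 4 +
      K * g * ({z : E d | R < ‖z‖ ^ 2}.indicator (fun _ => (1 : ℝ)) z))) ∂π =
      g - (1 / (4 * K * g) * ∫ z, ⟪w, z⟫ ^ 4 ∂π + K * g * π.real {z | R < ‖z‖ ^ 2}) := by
    refine (integral_sub i2 ((i4.const_mul (1 / (4 * K * g))).add (i1.const_mul (K * g)))).trans ?_
    refine (congrArg (_ - ·) (integral_add (i4.const_mul (1 / (4 * K * g)))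
      (i1.const_mul (K * g)))).trans ?_
    beta_reduce
    rw [integral_const_mul, integral_const_mul, integral_indicator_const _ hs, smul_eq_mul, mul_one,
      ← inner_covMat_self_eq_integral hL]
  refine le_trans ?_ e.ge
  have h5 : 1 / (4 * K * g) * ∫ z, ⟪w, z⟫ ^ 4 ∂π ≤ g / 4 := by
    calc 1 / (4 * K * g) * ∫ z, ⟪w, z⟫ ^ 4 ∂π ≤ 1 / (4 * K * g) * (K * g ^ 2) := by
          gcongr
          exact h4
      _ = g / 4 := by field_simp
  have h6 : K * g * π.real {z | R < ‖z‖ ^ 2} ≤ g / 4 := by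
    calc K * g * π.real {z | R < ‖z‖ ^ 2} ≤ K * g * (1 / (4 * K)) := by gcongr
      _ = g / 4 := by field_simp
  linarith

/-- The buffer multiplies `‖w‖²` by at most `exp (-γY/‖w‖²)`, with `Y` the empirical quadratic form.
A power `r` of order `1/(γBλ_min)` brings the exponent to order one, where bounds on the first two
moments of `Y` give a constant gain. -/
theorem IsChain.lintegral_norm_contraction_rpow_le [IsProbabilityMeasure P] (hC : 0 < Cμ)
    (hA : ‖A‖ < 1)
    (hμ : IsSubGaussianNoise Cμ μ) (hπ : IsStationaryLaw A μ π)
    (h : IsChain A μ π S P ℱ X η) {γ R r : ℝ} {B u : ℕ} (hB : 1 ≤ B) (hBu : u + B ≤ S)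
    (hγ : 0 < γ) (hR : 0 ≤ R) (hγR : 8 * B * (γ * R) ≤ 1)
    (hp : π.real {z | R < ‖z‖ ^ 2} ≤ 1 / (4 * momentConst Cμ)) (hr : 0 < r)
    (hrγ : 1 / (2 * momentConst Cμ) ≤ r * (γ * B * lambdaMin (covMat π))) (w : E d) :
    ∫⁻ ω, ENNReal.ofReal
      (‖contraction γ (fun k => trunc R (X (u + k) ω)) B w‖ ^ (2 * r)) ∂P ≤
      ENNReal.ofReal (Real.exp (-(1 / (8 * momentConst Cμ)))) * ENNReal.ofReal (‖w‖ ^ (2 * r)) := by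
  by_cases hw : w = 0
  · simp [hw, Real.zero_rpow (by positivity : 2 * r ≠ 0)]
  have hw' : 0 < ‖w‖ := norm_pos_iff.2 hw
  have hK := one_le_momentConst hC
  set K := momentConst Cμ with hKd
  set g := ⟪w, covMat π w⟫ with hg
  have hg0 : 0 < g := hπ.inner_covMat_pos hC hA hμ hw
  have hlam := lambdaMin_mul_norm_sq_le (isSymmetric_covMat π) w
  have hB' : (1 : ℝ) ≤ B := by exact_mod_cast hB
  set x : Ω → ℕ → E d := fun ω k => trunc R (X (u + k) ω) with hx
  have hXm : ∀ k ∈ Finset.range B, Measurable (X (u + k)) := fun k hk =>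
    (h.measurable_state (by have := Finset.mem_range.1 hk; omega)).mono (h.le _) le_rfl
  have hXlaw : ∀ k ∈ Finset.range B, P.map (X (u + k)) = π := fun k hk =>
    h.law_state hπ (by have := Finset.mem_range.1 hk; omega)
  set Y : Ω → ℝ := fun ω => ∑ k ∈ Finset.range B, ⟪x ω k, w⟫ ^ 2 with hY
  have hY0 : ∀ ω, 0 ≤ Y ω := fun ω => by positivity
  have hYm : Measurable Y := Finset.measurable_fun_sum _ fun k hk =>
    (((measurable_trunc R).comp (hXm k hk)).inner measurable_const).pow_const 2
  obtain ⟨i4, h4⟩ := hπ.integral_inner_pow_four_le hC hA hμ w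
  have hm4 : AEStronglyMeasurable (fun z : E d => ⟪w, z⟫ ^ 4) π := by fun_prop
  have i4' : ∀ k ∈ Finset.range B, Integrable (fun ω => ⟪w, X (u + k) ω⟫ ^ 4) P := fun k hk => by
    rw [← hXlaw k hk] at i4 hm4
    exact (integrable_map_measure hm4 (hXm k hk).aemeasurable).1 i4
  have h4' : ∀ k ∈ Finset.range B, ∫ ω, ⟪w, X (u + k) ω⟫ ^ 4 ∂P ≤ K * g ^ 2 := fun k hk => by
    rw [← hXlaw k hk] at hm4
    rw [← integral_map (hXm k hk).aemeasurable hm4, hXlaw k hk]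
    exact h4
  -- Cauchy–Schwarz reduces the second moment of `Y` to marginal fourth moments, so no mixing within
  -- the buffer is needed.
  have hY2 : ∀ ω, Y ω ^ 2 ≤ B * ∑ k ∈ Finset.range B, ⟪w, X (u + k) ω⟫ ^ 4 := by
    intro ω
    have h1 : Y ω ≤ ∑ k ∈ Finset.range B, ⟪w, X (u + k) ω⟫ ^ 2 :=
      Finset.sum_le_sum fun k _ => by
        rw [real_inner_comm _ w]
        exact inner_trunc_sq_le R _ w
    have h2 := sq_sum_le_card_mul_sum_sq (s := Finset.range B)
      (f := fun k => ⟪w, X (u + k) ω⟫ ^ 2)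
    rw [Finset.card_range] at h2
    refine (pow_le_pow_left₀ (hY0 ω) h1 2).trans (h2.trans_eq ?_)
    simp only [← pow_mul]
  have iY2 : Integrable (fun ω => Y ω ^ 2) P :=
    ((integrable_finsetSum _ i4').const_mul (B : ℝ)).mono' (hYm.pow_const 2).aestronglyMeasurable
      (ae_of_all _ fun ω => by
        rw [Real.norm_of_nonneg (sq_nonneg _)]
        exact hY2 ω)
  have hEY2 : ∫ ω, Y ω ^ 2 ∂P ≤ B ^ 2 * (K * g ^ 2) := by
    refine (integral_mono iY2 ((integrable_finsetSum _ i4').const_mul (B : ℝ)) hY2).trans ?_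
    rw [integral_const_mul, integral_finsetSum _ i4', sq, mul_assoc]
    refine mul_le_mul_of_nonneg_left ((Finset.sum_le_sum h4').trans_eq ?_) (by positivity)
    simp
  have hLY : MemLp Y 2 P := (memLp_two_iff_integrable_sq hYm.aestronglyMeasurable).2 iY2
  have iY : Integrable Y P := hLY.integrable (by simp)
  have hmt : AEStronglyMeasurable (fun z : E d => ⟪trunc R z, w⟫ ^ 2) π :=
    (((measurable_trunc R).inner measurable_const).pow_const 2).aestronglyMeasurable
  have hEk : ∀ k ∈ Finset.range B, g / 2 ≤ ∫ ω, ⟪x ω k, w⟫ ^ 2 ∂P := fun k hk => by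
    have h1 := hπ.half_le_integral_inner_trunc_sq hC hA hμ hp hw
    rw [← hXlaw k hk] at hmt
    rwa [← hXlaw k hk, integral_map (hXm k hk).aemeasurable hmt, hXlaw k hk] at h1
  have ik : ∀ k ∈ Finset.range B, Integrable (fun ω => ⟪x ω k, w⟫ ^ 2) P := fun k hk => by
    refine iY.mono' (((((measurable_trunc R).comp (hXm k hk)).inner
      measurable_const).pow_const 2).aestronglyMeasurable) (ae_of_all _ fun ω => ?_)
    rw [Real.norm_of_nonneg (sq_nonneg _)]
    exact Finset.single_le_sum (f := fun k => ⟪x ω k, w⟫ ^ 2) (fun _ _ => sq_nonneg _) hk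
  have hEY : B * (g / 2) ≤ ∫ ω, Y ω ∂P := by
    rw [hY, integral_finsetSum _ ik]
    refine le_trans ?_ (Finset.sum_le_sum hEk)
    simp
  -- The minimiser of `-sBg/2 + s²B²Kg²/2`, whose minimum is `-1/(8K)`.
  set s : ℝ := 1 / (2 * K) / (B * g) with hs
  have hs0 : 0 ≤ s := by positivity
  have hexp : ∫ ω, Real.exp (-(s * Y ω)) ∂P ≤ Real.exp (-(1 / (8 * K))) := by
    have iq : Integrable (fun ω => 1 - s * Y ω + (s * Y ω) ^ 2 / 2) P := by
      refine ((integrable_const 1).sub (iY.const_mul s)).add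
        ((iY2.const_mul (s ^ 2 / 2)).congr (ae_of_all _ fun ω => ?_))
      ring
    have h1 : ∫ ω, Real.exp (-(s * Y ω)) ∂P ≤ ∫ ω, (1 - s * Y ω + (s * Y ω) ^ 2 / 2) ∂P := by
      refine integral_mono_of_nonneg (ae_of_all _ fun _ => (Real.exp_pos _).le) iq
        (ae_of_all _ fun ω => exp_neg_le_quadratic (mul_nonneg hs0 (hY0 ω)))
    have h2 : ∫ ω, (1 - s * Y ω + (s * Y ω) ^ 2 / 2) ∂P =
        1 - s * ∫ ω, Y ω ∂P + s ^ 2 / 2 * ∫ ω, Y ω ^ 2 ∂P := by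
      have e : ∀ ω, 1 - s * Y ω + (s * Y ω) ^ 2 / 2 = 1 - s * Y ω + s ^ 2 / 2 * Y ω ^ 2 :=
        fun ω => by ring
      simp_rw [e]
      refine (integral_add ((integrable_const 1).sub (iY.const_mul s))
        (iY2.const_mul (s ^ 2 / 2))).trans ?_
      refine (congrArg (· + _) (integral_sub (integrable_const 1) (iY.const_mul s))).trans ?_
      rw [integral_const_mul, integral_const_mul]
      simp
    have h3 : s * (B * (g / 2)) = 1 / (4 * K) := by
      rw [hs]
      field_simp
      norm_num
    have h4 : s ^ 2 / 2 * (B ^ 2 * (K * g ^ 2)) = 1 / (8 * K) := by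
      rw [hs]
      field_simp
      norm_num
    have h5 := mul_le_mul_of_nonneg_left hEY hs0
    have h6 := mul_le_mul_of_nonneg_left hEY2 (by positivity : 0 ≤ s ^ 2 / 2)
    have h7 : 1 / (4 * K) = 2 * (1 / (8 * K)) := by
      field_simp
      norm_num
    have h8 := Real.add_one_le_exp (-(1 / (8 * K)))
    linarith
  have hpt : ∀ ω, ‖contraction γ (x ω) B w‖ ^ (2 * r) ≤
      ‖w‖ ^ (2 * r) * Real.exp (-(s * Y ω)) := by
    intro ω
    have h1 := norm_sq_contraction_apply_le hB hγ.le hR hγR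
      (fun k => norm_sq_trunc_le hR (X (u + k) ω)) w
    have h2 : ‖w‖ ^ 2 - γ * Y ω ≤ ‖w‖ ^ 2 * Real.exp (-(γ * Y ω / ‖w‖ ^ 2)) := by
      have := mul_le_mul_of_nonneg_left (Real.add_one_le_exp (-(γ * Y ω / ‖w‖ ^ 2)))
        (sq_nonneg ‖w‖)
      refine le_trans (le_of_eq ?_) this
      field_simp
      ring
    have h3 : (‖contraction γ (x ω) B w‖ ^ 2) ^ r ≤
        (‖w‖ ^ 2 * Real.exp (-(γ * Y ω / ‖w‖ ^ 2))) ^ r :=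
      Real.rpow_le_rpow (sq_nonneg _) (h1.trans h2) hr.le
    rw [Real.mul_rpow (sq_nonneg _) (Real.exp_pos _).le, ← Real.rpow_natCast, ← Real.rpow_mul
      (norm_nonneg _), ← Real.rpow_natCast, ← Real.rpow_mul (norm_nonneg _), ← Real.exp_mul] at h3
    simp only [Nat.cast_ofNat, Real.rpow_ofNat] at h3
    refine h3.trans (mul_le_mul_of_nonneg_left (Real.exp_le_exp.2 ?_) (by positivity))
    have h4 : s ≤ r * γ / ‖w‖ ^ 2 := by
      rw [hs, div_le_div_iff₀ (by positivity) (by positivity)]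
      calc 1 / (2 * K) * ‖w‖ ^ 2 ≤ r * (γ * B * lambdaMin (covMat π)) * ‖w‖ ^ 2 := by gcongr
        _ = r * γ * (B * (lambdaMin (covMat π) * ‖w‖ ^ 2)) := by ring
        _ ≤ r * γ * (B * g) := by gcongr
    have h5 := mul_le_mul_of_nonneg_right h4 (hY0 ω)
    have h6 : -(γ * Y ω / ‖w‖ ^ 2) * r = -(r * γ / ‖w‖ ^ 2 * Y ω) := by ring
    rw [h6]
    linarith
  have iexp : Integrable (fun ω => Real.exp (-(s * Y ω))) P := by
    refine (integrable_const (1 : ℝ)).mono' (by fun_prop) (ae_of_all _ fun ω => ?_)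
    rw [Real.norm_of_nonneg (Real.exp_pos _).le]
    exact Real.exp_le_one_iff.2 (neg_nonpos.2 (mul_nonneg hs0 (hY0 ω)))
  calc ∫⁻ ω, ENNReal.ofReal (‖contraction γ (x ω) B w‖ ^ (2 * r)) ∂P
      ≤ ∫⁻ ω, ENNReal.ofReal (‖w‖ ^ (2 * r)) * ENNReal.ofReal (Real.exp (-(s * Y ω))) ∂P := by
        refine lintegral_mono fun ω => ?_
        rw [← ENNReal.ofReal_mul (by positivity)]
        exact ENNReal.ofReal_le_ofReal (hpt ω)
    _ = ENNReal.ofReal (‖w‖ ^ (2 * r)) * ENNReal.ofReal (∫ ω, Real.exp (-(s * Y ω)) ∂P) := by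
        rw [lintegral_const_mul _ (by fun_prop), ofReal_integral_eq_lintegral_ofReal iexp
          (ae_of_all _ fun _ => (Real.exp_pos _).le)]
    _ ≤ _ := by
        rw [mul_comm]
        gcongr

end Chain

/-! ### Concentration over independent buffers -/

/-- Random matrices `(h k, V k)`, `k < N`, adapted to the filtration `𝓖`, each of which is
independent of the preceding ones. -/
structure IsIndepPairs {d : ℕ} {Ω : Type*} [mΩ : MeasurableSpace Ω] (N : ℕ) (P : Measure Ω)
    (𝓖 : ℕ → MeasurableSpace Ω) (h V : ℕ → Ω → Mat d) : Prop where
  le : ∀ k, 𝓖 k ≤ mΩ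
  mono : Monotone 𝓖
  measurable_fst : ∀ k < N, Measurable[𝓖 (k + 1)] (h k)
  measurable_snd : ∀ k < N, Measurable[𝓖 (k + 1)] (V k)
  indep : ∀ k < N, Indep (𝓖 k)
    (MeasurableSpace.comap (fun ω => (h k ω, V k ω)) inferInstance) P

theorem measurable_tailWeight {d : ℕ} {Ω : Type*} [MeasurableSpace Ω] (m : ℕ) {h : ℕ → Ω → Mat d}
    {n : ℕ} (hh : ∀ k < n, Measurable (h k)) :
    Measurable fun ω => tailWeight m (fun k => h k ω) n := by
  induction n with
  | zero => exact measurable_const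
  | succ n ih =>
    exact measurable_const.add (measurable_mul_mat (hh n (by omega)) (ih fun k hk => hh k (by omega)))

theorem measurable_backProd {d : ℕ} {Ω : Type*} [MeasurableSpace Ω] {h : ℕ → Ω → Mat d}
    {j n : ℕ} (hh : ∀ k < j + n, Measurable (h k)) :
    Measurable fun ω => backProd (fun k => h k ω) j n := by
  induction n with
  | zero => exact measurable_const
  | succ n ih =>
    exact measurable_mul_mat (hh (j + n) (by omega)) (ih fun k hk => hh k (by omega))

theorem measurable_inner_sub_sq_norm {d : ℕ} {Ω : Type*} [MeasurableSpace Ω] {f g e : Ω → E d}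
    (hf : Measurable f) (hg : Measurable g) (he : Measurable e) (l c : ℝ) (v : E d) :
    Measurable fun ω => l * ⟪v, f ω⟫ - c * (‖g ω‖ ^ 2 - ‖e ω‖ ^ 2) := by
  fun_prop

theorem measurable_prefix_sum {d : ℕ} {Ω : Type*} [MeasurableSpace Ω] (m : ℕ) {h V : ℕ → Ω → Mat d}
    {n : ℕ} (hh : ∀ k < n, Measurable (h k)) (hV : ∀ k < n, Measurable (V k)) (l c : ℝ)
    (v y : E d) :
    Measurable fun ω => ∑ k ∈ Finset.range n,
      (l * ⟪v, V k ω (tailWeight m (fun k => h k ω) k y)⟫ - c *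
        (‖tailWeight m (fun k => h k ω) k y‖ ^ 2 - ‖h k ω (tailWeight m (fun k => h k ω) k y)‖ ^ 2)) := by
  refine Finset.measurable_fun_sum _ fun k hk => ?_
  have hk' : k < n := Finset.mem_range.1 hk
  have hU := measurable_mat_apply (measurable_tailWeight m (n := k) fun j hj => hh j (by omega))
    (measurable_const (a := y))
  exact measurable_inner_sub_sq_norm (measurable_mat_apply (hV k hk') hU) hU
    (measurable_mat_apply (hh k hk') hU) l c v

section IndepPairs

variable {d : ℕ} {Ω : Type*} [mΩ : MeasurableSpace Ω] {N : ℕ} {P : Measure Ω}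
  [IsProbabilityMeasure P] {𝓖 : ℕ → MeasurableSpace Ω} {h V : ℕ → Ω → Mat d}

/-- Given `𝓖 n`, the vector `tailWeight n y` is fixed, and the one-buffer bound, being uniform in
`w`, applies to it; the exponential bounds therefore multiply. -/
theorem IsIndepPairs.lintegral_exp_sum_le_one (hI : IsIndepPairs N P 𝓖 h V) (m : ℕ) {l c : ℝ}
    {v : E d} (hexp : ∀ k < N, ∀ w : E d, ∫⁻ ω, ENNReal.ofReal (Real.exp
      (l * ⟪v, V k ω w⟫ - c * (‖w‖ ^ 2 - ‖h k ω w‖ ^ 2))) ∂P ≤ 1) (y : E d) (n : ℕ) (hn : n ≤ N) :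
    ∫⁻ ω, ENNReal.ofReal (Real.exp (∑ k ∈ Finset.range n,
      (l * ⟪v, V k ω (tailWeight m (fun k => h k ω) k y)⟫ - c *
        (‖tailWeight m (fun k => h k ω) k y‖ ^ 2 -
          ‖h k ω (tailWeight m (fun k => h k ω) k y)‖ ^ 2)))) ∂P ≤ 1 := by
  induction n with
  | zero => simp
  | succ n ih =>
    have hhm : ∀ k < n, Measurable[𝓖 n] (h k) := fun k hk =>
      (hI.measurable_fst k (by omega)).mono (hI.mono (by omega)) le_rfl
    have hVm : ∀ k < n, Measurable[𝓖 n] (V k) := fun k hk =>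
      (hI.measurable_snd k (by omega)).mono (hI.mono (by omega)) le_rfl
    have hGm := @measurable_prefix_sum d Ω (𝓖 n) m h V n hhm hVm l c v y
    have hUm : Measurable[𝓖 n] fun ω => tailWeight m (fun k => h k ω) n y :=
      @measurable_mat_apply d Ω (𝓖 n) _ _ (@measurable_tailWeight d Ω (𝓖 n) m h n hhm)
        (@measurable_const _ _ _ (𝓖 n) y)
    have hζ : Measurable fun ω => (h n ω, V n ω) :=
      ((hI.measurable_fst n (by omega)).mono (hI.le _) le_rfl).prodMk
        ((hI.measurable_snd n (by omega)).mono (hI.le _) le_rfl)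
    have hF : Measurable (Function.uncurry fun (p : ℝ × E d) (q : Mat d × Mat d) =>
        ENNReal.ofReal (Real.exp (p.1 + (l * ⟪v, q.2 p.2⟫ - c * (‖p.2‖ ^ 2 - ‖q.1 p.2‖ ^ 2))))) := by
      unfold Function.uncurry
      have h1 : Measurable fun z : (ℝ × E d) × Mat d × Mat d => z.2.1 z.1.2 :=
        measurable_mat_apply (by fun_prop) (by fun_prop)
      have h2 : Measurable fun z : (ℝ × E d) × Mat d × Mat d => z.2.2 z.1.2 :=
        measurable_mat_apply (by fun_prop) (by fun_prop)
      fun_prop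
    have key := lintegral_lintegral_comp_of_indep (P := P) (hI.le n) (hGm.prodMk hUm) hζ
      (hI.indep n (by omega)) hF
    refine Eq.trans_le (lintegral_congr fun ω => ?_) (key.trans_le ?_)
    · simp only [Finset.sum_range_succ]
    refine (lintegral_mono fun ω => ?_).trans (ih (by omega))
    set G := ∑ k ∈ Finset.range n,
      (l * ⟪v, V k ω (tailWeight m (fun k => h k ω) k y)⟫ - c *
        (‖tailWeight m (fun k => h k ω) k y‖ ^ 2 -
          ‖h k ω (tailWeight m (fun k => h k ω) k y)‖ ^ 2))
    set w := tailWeight m (fun k => h k ω) n y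
    have e : ∀ ω', ENNReal.ofReal (Real.exp (G + (l * ⟪v, V n ω' w⟫ -
        c * (‖w‖ ^ 2 - ‖h n ω' w‖ ^ 2)))) = ENNReal.ofReal (Real.exp G) *
        ENNReal.ofReal (Real.exp (l * ⟪v, V n ω' w⟫ - c * (‖w‖ ^ 2 - ‖h n ω' w‖ ^ 2))) := fun ω' => by
      rw [← ENNReal.ofReal_mul (Real.exp_pos _).le, ← Real.exp_add]
    refine (lintegral_congr e).trans_le ?_
    rw [lintegral_const_mul' _ _ ENNReal.ofReal_ne_top]
    exact mul_le_of_le_one_right' (hexp n (by omega) w)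

theorem IsIndepPairs.lintegral_norm_backProd_rpow_le (hI : IsIndepPairs N P 𝓖 h V) {r : ℝ}
    {q : ENNReal} (hrpow : ∀ k < N, ∀ w : E d, ∫⁻ ω, ENNReal.ofReal (‖h k ω w‖ ^ (2 * r)) ∂P ≤
      q * ENNReal.ofReal (‖w‖ ^ (2 * r))) (w : E d) (j n : ℕ) (hn : j + n ≤ N) :
    ∫⁻ ω, ENNReal.ofReal (‖backProd (fun k => h k ω) j n w‖ ^ (2 * r)) ∂P ≤
      q ^ n * ENNReal.ofReal (‖w‖ ^ (2 * r)) := by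
  induction n with
  | zero => simp [backProd]
  | succ n ih =>
    have hhm : ∀ k < j + n, Measurable[𝓖 (j + n)] (h k) := fun k hk =>
      (hI.measurable_fst k (by omega)).mono (hI.mono (by omega)) le_rfl
    have hUm : Measurable[𝓖 (j + n)] fun ω => backProd (fun k => h k ω) j n w :=
      @measurable_mat_apply d Ω (𝓖 (j + n)) _ _ (@measurable_backProd d Ω (𝓖 (j + n)) h j n hhm)
        (@measurable_const _ _ _ (𝓖 (j + n)) w)
    have hζ : Measurable (h (j + n)) :=
      (hI.measurable_fst (j + n) (by omega)).mono (hI.le _) le_rfl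
    have hF : Measurable (Function.uncurry fun (p : E d) (M : Mat d) =>
        ENNReal.ofReal (‖M p‖ ^ (2 * r))) := by
      unfold Function.uncurry
      have h1 : Measurable fun z : E d × Mat d => z.2 z.1 :=
        measurable_mat_apply (by fun_prop) (by fun_prop)
      fun_prop
    have hind : Indep (𝓖 (j + n)) (MeasurableSpace.comap (h (j + n)) inferInstance) P := by
      refine indep_of_indep_of_le_right (hI.indep (j + n) (by omega)) ?_
      exact (_root_.measurable_fst.comp
        (comap_measurable fun ω => (h (j + n) ω, V (j + n) ω))).comap_le
    have key := lintegral_lintegral_comp_of_indep (P := P) (hI.le (j + n)) hUm hζ hind hF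
    refine key.trans_le ?_
    refine (lintegral_mono fun ω =>
      hrpow (j + n) (by omega) (backProd (fun k => h k ω) j n w)).trans ?_
    rw [lintegral_const_mul _
      ((hUm.mono (hI.le _) le_rfl).norm.pow_const (2 * r)).ennreal_ofReal, pow_succ', mul_assoc]
    gcongr
    exact ih (by omega)

/-- Markov's inequality for the moment of order `2r` on a net. The moment is at most `exp (-cn)` and
the threshold raised to `2r` is `exp (-cn/2)`, so half of the decay goes into the rate and half into
the probability. -/
theorem IsIndepPairs.measure_lt_norm_backProd_le (hI : IsIndepPairs N P 𝓖 h V) {r c : ℝ}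
    (hr : 0 < r) (hrpow : ∀ k < N, ∀ w : E d, ∫⁻ ω, ENNReal.ofReal (‖h k ω w‖ ^ (2 * r)) ∂P ≤
      ENNReal.ofReal (Real.exp (-c)) * ENNReal.ofReal (‖w‖ ^ (2 * r))) (j n : ℕ) (hn : j + n ≤ N) :
    P {ω | 2 * Real.exp (-(c / (4 * r))) ^ n < ‖backProd (fun k => h k ω) j n‖} ≤
      ENNReal.ofReal (5 ^ d * Real.exp (-(c / 2 * n))) := by
  obtain ⟨s, hcard, hs1, hs⟩ := exists_half_net d
  set ρ := Real.exp (-(c / (4 * r))) with hρ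
  have hone : ∀ w ∈ s, P {ω | ρ ^ n < ‖backProd (fun k => h k ω) j n w‖} ≤
      ENNReal.ofReal (Real.exp (-(c / 2 * n))) := by
    intro w hw
    have hm : Measurable fun ω => backProd (fun k => h k ω) j n w :=
      measurable_mat_apply (measurable_backProd fun k hk =>
        (hI.measurable_fst k (by omega)).mono (hI.le _) le_rfl) measurable_const
    have h1 : ∫⁻ ω, ENNReal.ofReal (‖backProd (fun k => h k ω) j n w‖ ^ (2 * r)) ∂P ≤
        ENNReal.ofReal (Real.exp (-(c * n))) := by
      refine (hI.lintegral_norm_backProd_rpow_le hrpow w j n hn).trans ?_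
      rw [← ENNReal.ofReal_pow (Real.exp_pos _).le, ← Real.exp_nat_mul,
        ← ENNReal.ofReal_mul (Real.exp_pos _).le]
      refine ENNReal.ofReal_le_ofReal ?_
      have : ‖w‖ ^ (2 * r) ≤ 1 := Real.rpow_le_one (norm_nonneg _) (hs1 w hw) (by positivity)
      calc _ ≤ Real.exp (n * -c) * 1 := by gcongr
        _ = _ := by ring_nf
    have hρr : (ρ ^ n) ^ (2 * r) = Real.exp (-(c / 2 * n)) := by
      rw [hρ, ← Real.exp_nat_mul, ← Real.exp_mul]
      congr 1
      field_simp
      norm_num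
    have hsub : {ω | ρ ^ n < ‖backProd (fun k => h k ω) j n w‖} ⊆
        {ω | ENNReal.ofReal (Real.exp (-(c / 2 * n))) ≤
          ENNReal.ofReal (‖backProd (fun k => h k ω) j n w‖ ^ (2 * r))} := by
      intro ω hω
      refine ENNReal.ofReal_le_ofReal ?_
      rw [← hρr]
      exact Real.rpow_le_rpow (by positivity) (le_of_lt hω) (by positivity)
    refine (measure_mono hsub).trans ((meas_ge_le_lintegral_div
      (hm.norm.pow_const (2 * r)).ennreal_ofReal.aemeasurable (by
      simp [Real.exp_pos]) ENNReal.ofReal_ne_top).trans ?_)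
    refine (ENNReal.div_le_div_right h1 _).trans ?_
    rw [← ENNReal.ofReal_div_of_pos (Real.exp_pos _), ← Real.exp_sub]
    refine ENNReal.ofReal_le_ofReal (Real.exp_le_exp.2 (le_of_eq ?_))
    ring
  have hsub : {ω | 2 * ρ ^ n < ‖backProd (fun k => h k ω) j n‖} ⊆
      ⋃ w ∈ s, {ω | ρ ^ n < ‖backProd (fun k => h k ω) j n w‖} := by
    intro ω hω
    by_contra hcon
    simp only [Set.mem_iUnion, Set.mem_ofPred_eq, not_exists, not_lt] at hcon
    exact absurd hω (not_lt.2 (opNorm_le_two_mul_of_net hs (by positivity) hcon))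
  refine (measure_mono hsub).trans ((measure_biUnion_finset_le _ _).trans
    ((Finset.sum_le_sum hone).trans ?_))
  rw [Finset.sum_const, nsmul_eq_mul, ENNReal.ofReal_mul (by positivity)]
  gcongr
  rw [ENNReal.ofReal_pow (by norm_num), ENNReal.ofReal_ofNat]
  exact_mod_cast hcard

theorem IsIndepPairs.measure_exists_lt_norm_backProd_le (hI : IsIndepPairs N P 𝓖 h V)
    {r c n₀ : ℝ} (hr : 0 < r) (hc : 0 ≤ c)
    (hrpow : ∀ k < N, ∀ w : E d, ∫⁻ ω, ENNReal.ofReal (‖h k ω w‖ ^ (2 * r)) ∂P ≤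
      ENNReal.ofReal (Real.exp (-c)) * ENNReal.ofReal (‖w‖ ^ (2 * r))) :
    P {ω | ∃ j n : ℕ, j + n ≤ N ∧ n₀ ≤ n ∧
      2 * Real.exp (-(c / (4 * r))) ^ n < ‖backProd (fun k => h k ω) j n‖} ≤
      ENNReal.ofReal ((N + 1) ^ 2 * (5 ^ d * Real.exp (-(c / 2 * n₀)))) := by
  classical
  set I := ((Finset.range (N + 1)) ×ˢ (Finset.range (N + 1))).filter
    fun p => p.1 + p.2 ≤ N ∧ n₀ ≤ p.2 with hIdef
  have hsub : {ω | ∃ j n : ℕ, j + n ≤ N ∧ n₀ ≤ n ∧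
      2 * Real.exp (-(c / (4 * r))) ^ n < ‖backProd (fun k => h k ω) j n‖} ⊆
      ⋃ p ∈ I, {ω | 2 * Real.exp (-(c / (4 * r))) ^ p.2 <
        ‖backProd (fun k => h k ω) p.1 p.2‖} := by
    rintro ω ⟨j, n, h1, h2, h3⟩
    simp only [Set.mem_iUnion]
    refine ⟨(j, n), ?_, h3⟩
    rw [hIdef, Finset.mem_filter, Finset.mem_product, Finset.mem_range, Finset.mem_range]
    exact ⟨⟨by omega, by omega⟩, h1, h2⟩
  refine (measure_mono hsub).trans ((measure_biUnion_finset_le _ _).trans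
    ((Finset.sum_le_sum (g := fun _ => ENNReal.ofReal (5 ^ d * Real.exp (-(c / 2 * n₀))))
      fun p hp => ?_).trans ?_))
  · have hp' := (Finset.mem_filter.1 hp).2
    refine (hI.measure_lt_norm_backProd_le hr hrpow p.1 p.2 hp'.1).trans
      (ENNReal.ofReal_le_ofReal ?_)
    have := mul_le_mul_of_nonneg_left hp'.2 (by positivity : 0 ≤ c / 2)
    gcongr
  · have hcard : I.card ≤ (N + 1) ^ 2 := by
      refine (Finset.card_filter_le _ _).trans ?_
      rw [Finset.card_product, Finset.card_range, sq]
    rw [Finset.sum_const, nsmul_eq_mul, ENNReal.ofReal_mul (p := ((N : ℝ) + 1) ^ 2) (by positivity)]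
    gcongr
    rw [ENNReal.ofReal_pow (by positivity)]
    have : ENNReal.ofReal ((N : ℝ) + 1) = ((N + 1 : ℕ) : ENNReal) := by
      rw [← ENNReal.ofReal_natCast]
      push_cast
      rfl
    rw [this]
    exact_mod_cast hcard

/-- A Freedman-type bound: the compensator is random, so the estimate is confined to the event where
it is at most `W`. Nets in both arguments of the bilinear form cost `25 ^ d` in probability and a
factor `4` in size. -/
theorem IsIndepPairs.measure_lt_norm_sum_le (hI : IsIndepPairs N P 𝓖 h V) (m : ℕ) {c W b : ℝ}
    (hc : 0 < c) (hW : 0 < W) (hb : 0 ≤ b)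
    (hexp : ∀ k < N, ∀ v : E d, ‖v‖ ≤ 1 → ∀ (l : ℝ) (w : E d), ∫⁻ ω, ENNReal.ofReal (Real.exp
      (l * ⟪v, V k ω w⟫ - l ^ 2 * c * (‖w‖ ^ 2 - ‖h k ω w‖ ^ 2))) ∂P ≤ 1) :
    P {ω | 4 * b < ‖∑ k ∈ Finset.range N, V k ω * tailWeight m (fun k => h k ω) k‖ ∧
      ∀ y : E d, ‖y‖ ≤ 1 → ∑ k ∈ Finset.range N, (‖tailWeight m (fun k => h k ω) k y‖ ^ 2 -
          ‖h k ω (tailWeight m (fun k => h k ω) k y)‖ ^ 2) ≤ W} ≤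
      ENNReal.ofReal (25 ^ d * Real.exp (-(b ^ 2 / (4 * c * W)))) := by
  obtain ⟨s, hcard, hs1, hs⟩ := exists_half_net d
  set Z : Ω → Mat d := fun ω => ∑ k ∈ Finset.range N, V k ω * tailWeight m (fun k => h k ω) k
    with hZ
  set En : Ω → E d → ℝ := fun ω y => ∑ k ∈ Finset.range N,
    (‖tailWeight m (fun k => h k ω) k y‖ ^ 2 -
      ‖h k ω (tailWeight m (fun k => h k ω) k y)‖ ^ 2) with hEn
  have hone : ∀ p ∈ s ×ˢ s, P {ω | b < ⟪p.1, Z ω p.2⟫ ∧ En ω p.2 ≤ W} ≤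
      ENNReal.ofReal (Real.exp (-(b ^ 2 / (4 * c * W)))) := by
    rintro ⟨v, y⟩ hp
    rw [Finset.mem_product] at hp
    -- The maximiser of `l * b - l ^ 2 * c * W`.
    set l := b / (2 * c * W) with hl
    have hl0 : 0 ≤ l := by positivity
    have h1 := hI.lintegral_exp_sum_le_one m (l := l) (c := l ^ 2 * c) (v := v)
      (fun k hk w => hexp k hk v (hs1 v hp.1) l w) y N le_rfl
    set G : Ω → ℝ := fun ω => ∑ k ∈ Finset.range N,
      (l * ⟪v, V k ω (tailWeight m (fun k => h k ω) k y)⟫ - l ^ 2 * c *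
        (‖tailWeight m (fun k => h k ω) k y‖ ^ 2 -
          ‖h k ω (tailWeight m (fun k => h k ω) k y)‖ ^ 2)) with hG
    have hGm : Measurable G := measurable_prefix_sum m
      (fun k hk => (hI.measurable_fst k hk).mono (hI.le _) le_rfl)
      (fun k hk => (hI.measurable_snd k hk).mono (hI.le _) le_rfl) l (l ^ 2 * c) v y
    have hGe : ∀ ω, G ω = l * ⟪v, Z ω y⟫ - l ^ 2 * c * En ω y := by
      intro ω
      simp only [hG, hZ, hEn, Finset.sum_sub_distrib, ← Finset.mul_sum, sum_apply,
        inner_sum]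
      rfl
    have hsub : {ω | b < ⟪v, Z ω y⟫ ∧ En ω y ≤ W} ⊆
        {ω | ENNReal.ofReal (Real.exp (b ^ 2 / (4 * c * W))) ≤
          ENNReal.ofReal (Real.exp (G ω))} := by
      rintro ω ⟨h2, h3⟩
      refine ENNReal.ofReal_le_ofReal (Real.exp_le_exp.2 ?_)
      rw [hGe]
      have h4 : l * b - l ^ 2 * c * W = b ^ 2 / (4 * c * W) := by
        rw [hl]
        field_simp
        ring
      have h5 := mul_le_mul_of_nonneg_left h2.le hl0
      have h6 := mul_le_mul_of_nonneg_left h3 (by positivity : 0 ≤ l ^ 2 * c)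
      linarith
    refine (measure_mono hsub).trans ((meas_ge_le_lintegral_div
      hGm.exp.ennreal_ofReal.aemeasurable (by
      simp [Real.exp_pos]) ENNReal.ofReal_ne_top).trans ?_)
    refine (ENNReal.div_le_div_right h1 _).trans ?_
    rw [← ENNReal.ofReal_one, ← ENNReal.ofReal_div_of_pos (Real.exp_pos _), one_div, ← Real.exp_neg]
  have hsub : {ω | 4 * b < ‖Z ω‖ ∧ ∀ y : E d, ‖y‖ ≤ 1 → En ω y ≤ W} ⊆
      ⋃ p ∈ s ×ˢ s, {ω | b < ⟪p.1, Z ω p.2⟫ ∧ En ω p.2 ≤ W} := by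
    rintro ω ⟨h1, h2⟩
    by_contra hcon
    simp only [Set.mem_iUnion, Set.mem_ofPred_eq, not_exists, not_and] at hcon
    have h3 : ∀ y ∈ s, ‖Z ω y‖ ≤ 2 * b := fun y hy =>
      norm_le_two_mul_of_net hs hb fun v hv => by
        by_contra hlt
        exact hcon (v, y) (Finset.mem_product.2 ⟨hv, hy⟩) (not_le.1 hlt) (h2 y (hs1 y hy))
    have := opNorm_le_two_mul_of_net hs (by positivity) h3
    linarith
  refine (measure_mono hsub).trans ((measure_biUnion_finset_le _ _).trans
    ((Finset.sum_le_sum hone).trans ?_))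
  rw [Finset.sum_const, nsmul_eq_mul, ENNReal.ofReal_mul (by positivity)]
  gcongr
  rw [ENNReal.ofReal_pow (by norm_num), ENNReal.ofReal_ofNat, Finset.card_product]
  have : s.card * s.card ≤ 25 ^ d := by
    calc s.card * s.card ≤ 5 ^ d * 5 ^ d := Nat.mul_le_mul hcard hcard
      _ = 25 ^ d := by rw [← mul_pow]; norm_num
  exact_mod_cast this

/-- Geometric decay of all long products bounds every weight, hence the energy, and so places the
outcome in the event to which the Freedman-type bound applies. -/
theorem IsIndepPairs.measure_not_le (hI : IsIndepPairs N P 𝓖 h V) (hh : ∀ k ω, ‖h k ω‖ ≤ 1)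
    {a : ℕ} (haN : a < N) {r c n₀ c' ℓ : ℝ} (hr : 0 < r) (hc : 0 < c) (hn₀ : 0 ≤ n₀) (ha : n₀ ≤ a)
    (hc' : 0 < c') (hℓ : 0 ≤ ℓ)
    (hrpow : ∀ k < N, ∀ w : E d, ∫⁻ ω, ENNReal.ofReal (‖h k ω w‖ ^ (2 * r)) ∂P ≤
      ENNReal.ofReal (Real.exp (-c)) * ENNReal.ofReal (‖w‖ ^ (2 * r)))
    (hexp : ∀ k < N, ∀ v : E d, ‖v‖ ≤ 1 → ∀ (l : ℝ) (w : E d), ∫⁻ ω, ENNReal.ofReal (Real.exp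
      (l * ⟪v, V k ω w⟫ - l ^ 2 * c' * (‖w‖ ^ 2 - ‖h k ω w‖ ^ 2))) ∂P ≤ 1) :
    P {ω | ¬ (‖tailWeight (N - a) (fun k => h k ω) N‖ ≤ 2 * Real.exp (-(c / (4 * r))) ^ a /
        (1 - Real.exp (-(c / (4 * r)))) ∧
      ‖∑ k ∈ Finset.range N, V k ω * tailWeight (N - a) (fun k => h k ω) k‖ ≤
        4 * √(4 * c' * (2 * (N - a : ℕ) *
          (n₀ + 1 + 2 / (1 - Real.exp (-(c / (4 * r)))))) * ℓ))} ≤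
      ENNReal.ofReal ((N + 1) ^ 2 * (5 ^ d * Real.exp (-(c / 2 * n₀)))) +
        ENNReal.ofReal (25 ^ d * Real.exp (-ℓ)) := by
  set ρ := Real.exp (-(c / (4 * r))) with hρ
  have h0 : 0 ≤ ρ := (Real.exp_pos _).le
  have h1 : ρ < 1 := Real.exp_lt_one_iff.2 (neg_lt_zero.2 (by positivity))
  set q := n₀ + 1 + 2 / (1 - ρ) with hq
  have hq1 : 1 ≤ q := by
    have : 0 ≤ 2 / (1 - ρ) := div_nonneg zero_le_two (by linarith)
    linarith
  have hm : (1 : ℝ) ≤ (N - a : ℕ) := by exact_mod_cast (by omega : 1 ≤ N - a)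
  set W := 2 * (N - a : ℕ) * q with hW
  have hW0 : 0 < W := by positivity
  set b := √(4 * c' * W * ℓ) with hb
  have hb2 : b ^ 2 / (4 * c' * W) = ℓ := by
    rw [hb, Real.sq_sqrt (by positivity)]
    field_simp
  have e1 := hI.measure_exists_lt_norm_backProd_le (n₀ := n₀) hr hc.le hrpow
  have e2 := hI.measure_lt_norm_sum_le (N - a) (b := b) hc' hW0 (Real.sqrt_nonneg _) hexp
  rw [hb2] at e2
  refine le_trans (measure_mono ?_) ((measure_union_le _ _).trans (add_le_add e1 e2))
  intro ω hω
  by_contra hcon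
  rw [Set.mem_union, not_or] at hcon
  obtain ⟨g1, g2⟩ := hcon
  have hback : ∀ j n : ℕ, j + n ≤ N → n₀ ≤ n →
      ‖backProd (fun k => h k ω) j n‖ ≤ 2 * ρ ^ n := by
    intro j n hj hn
    by_contra hlt
    exact g1 ⟨j, n, hj, hn, not_le.1 hlt⟩
  refine hω ⟨norm_tailWeight_last_le haN ha h0 h1 hback, ?_⟩
  by_contra hlt
  refine g2 ⟨not_le.1 hlt, fun y hy => ?_⟩
  exact sum_energy_tailWeight_le (by omega) hq1 hy fun k hk =>
    norm_tailWeight_le (by omega) hn₀ h0 h1 (fun k => hh k ω) hback k hk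

end IndepPairs

/-! ### Deterministic error decomposition -/

/-- Bias, noise and coupling error on a path without truncation. Common noise cancels from the
difference between a buffer's original and restarted paths, which evolves by powers of `A` alone and
has been damped by `A ^ u` when the buffer's data are first used. -/
theorem norm_sgdRER_sub_le {d : ℕ} {γ R : ℝ} {B u a N : ℕ} (A A₀ : Mat d) (X z : ℕ → E d)
    (Y : ℕ → ℕ → E d) (hA : ‖A‖ ≤ 1) (hγ : 0 ≤ γ) (hR : 0 ≤ R) (hγR : 8 * B * (γ * R) ≤ 1)
    (haN : a < N) (hX : ∀ τ ≤ N * (B + u), ‖X τ‖ ^ 2 ≤ R)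
    (hXz : ∀ τ < N * (B + u), X (τ + 1) = A (X τ) + z τ)
    (hY : ∀ s < N, ∀ k ≤ B + u, ‖Y s k‖ ^ 2 ≤ R)
    (hYz : ∀ s < N, ∀ k < B + u, Y s (k + 1) = A (Y s k) + z (s * (B + u) + k))
    (H V : ℕ → Mat d) (hH : ∀ s, H s = contraction γ (fun j => trunc R (Y s (u + j))) B)
    (hV : ∀ s, V s = noiseSum γ (fun j => trunc R (Y s (u + j)))
      (fun j => z (s * (B + u) + (u + j))) B) :
    ‖sgdRER γ R B u a N A₀ X - A‖ ≤
      ((N : ℝ) - a)⁻¹ * (‖A₀ - A‖ * ‖tailWeight (N - a) (fun k => H (N - 1 - k)) N‖ +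
        ‖∑ k ∈ Finset.range N, V (N - 1 - k) * tailWeight (N - a) (fun k => H (N - 1 - k)) k‖) +
      N * ((‖A₀‖ + N / 4 + 1) * ‖A ^ u‖) := by
  set r := √R with hr
  have hr2 : r ^ 2 = R := Real.sq_sqrt hR
  have hle : ∀ x : E d, ‖x‖ ^ 2 ≤ R → ‖x‖ ≤ r := fun x hx => Real.le_sqrt_of_sq_le hx
  have hidx : ∀ s < N, ∀ k ≤ B + u, s * (B + u) + k ≤ N * (B + u) := fun s hs k hk => by
    have h1 : (s + 1) * (B + u) ≤ N * (B + u) := Nat.mul_le_mul_right _ hs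
    have h2 : (s + 1) * (B + u) = s * (B + u) + (B + u) := by ring
    omega
  have hdiff : ∀ s < N, ∀ k ≤ B + u,
      X (s * (B + u) + k) - Y s k = (A ^ k) (X (s * (B + u)) - Y s 0) := by
    intro s hs k
    induction k with
    | zero => simp
    | succ k ih =>
      intro hk
      have h1 := hidx s hs (k + 1) hk
      have h2 : (A ^ (k + 1)) (X (s * (B + u)) - Y s 0) =
          A ((A ^ k) (X (s * (B + u)) - Y s 0)) := by rw [pow_succ']; rfl
      rw [← add_assoc, hXz _ (by omega), hYz s hs k (by omega), h2, ← ih (by omega), map_sub]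
      abel
  have hXY : ∀ s < N, ∀ k ≤ B, ‖X (s * (B + u) + (u + k)) - Y s (u + k)‖ ≤ 2 * r * ‖A ^ u‖ := by
    intro s hs k hk
    rw [hdiff s hs (u + k) (by omega)]
    have h1 : ‖A ^ (u + k)‖ ≤ ‖A ^ u‖ := by
      rw [pow_add]
      refine (norm_mul_le _ _).trans (mul_le_of_le_one_right (norm_nonneg _) ?_)
      clear hk
      induction k with
      | zero => exact ContinuousLinearMap.norm_id_le
      | succ k ih =>
        rw [pow_succ]
        exact (norm_mul_le _ _).trans (mul_le_one₀ ih (norm_nonneg _) hA)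
    have h2 : ‖X (s * (B + u)) - Y s 0‖ ≤ 2 * r := by
      refine (norm_sub_le _ _).trans ?_
      have := hle _ (hX (s * (B + u)) (by simpa using hidx s hs 0 (Nat.zero_le _)))
      have := hle _ (hY s hs 0 (Nat.zero_le _))
      linarith
    calc _ ≤ ‖A ^ (u + k)‖ * ‖X (s * (B + u)) - Y s 0‖ := ContinuousLinearMap.le_opNorm _ _
      _ ≤ ‖A ^ u‖ * (2 * r) := by gcongr
      _ = _ := by ring
  have hpert := norm_rerIterate_sub_splitIterate_le (N := N) (u := u) hγ (hr2.symm ▸ hγR) A₀ X Y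
    (fun s hs k hk => hle _ (hX _ (hidx s hs (u + k) (by omega))))
    (fun s hs k hk => hle _ (hY s hs (u + k) (by omega))) (norm_nonneg (A ^ u)) hXY
  set D : ℕ → Mat d := fun t => splitIterate γ B u A₀ Y t - A with hD
  have hDrec : ∀ s < N, D (s + 1) = D s * H s + V s := by
    intro s hs
    have hY' : ∀ k < B, trunc R (Y s (u + k)) = Y s (0 * (B + u) + (u + k)) := fun k hk => by
      rw [zero_mul, zero_add]
      exact trunc_of_le (hY s hs _ (by omega))
    have := bufferIterate_sub_mul_contraction γ B u (Y s) 0 (splitIterate γ B u A₀ Y s) A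
      (fun j => trunc R (Y s (u + j))) (fun j => z (s * (B + u) + (u + j))) hY' (fun k hk => by
        rw [hY' k hk, zero_mul, zero_add, zero_add, hYz s hs _ (by omega)]) B le_rfl
    rw [Nat.sub_self, contraction, noiseSum, mul_one, add_zero] at this
    rw [hH, hV]
    exact this
  have hsum := sum_Ioc_eq_tailWeight haN D H V hDrec
  set U := tailWeight (N - a) (fun k => H (N - 1 - k)) with hU
  have hm : (0 : ℝ) < N - a := sub_pos.2 (by exact_mod_cast haN)
  have hcard : ((Finset.Ioc a N).card : ℝ) = N - a := by
    rw [Nat.card_Ioc, Nat.cast_sub haN.le]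
  have hif : sgdRER γ R B u a N A₀ X =
      ((N : ℝ) - a)⁻¹ • ∑ s ∈ Finset.Ioc a N, rerIterate γ B u A₀ X s := by
    rw [sgdRER, if_neg]
    rintro ⟨τ, hτ, h⟩
    exact absurd h (not_lt.2 (hX τ hτ.le))
  have hsplit : sgdRER γ R B u a N A₀ X - A = ((N : ℝ) - a)⁻¹ • ∑ s ∈ Finset.Ioc a N, D s +
      ((N : ℝ) - a)⁻¹ • ∑ s ∈ Finset.Ioc a N,
        (rerIterate γ B u A₀ X s - splitIterate γ B u A₀ Y s) := by
    have hA' : A = ((N : ℝ) - a)⁻¹ • ∑ s ∈ Finset.Ioc a N, A := by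
      rw [Finset.sum_const, ← Nat.cast_smul_eq_nsmul ℝ, smul_smul, hcard,
        inv_mul_cancel₀ hm.ne', one_smul]
    have hr : ∑ s ∈ Finset.Ioc a N, rerIterate γ B u A₀ X s = ∑ s ∈ Finset.Ioc a N, D s +
        ∑ s ∈ Finset.Ioc a N, (rerIterate γ B u A₀ X s - splitIterate γ B u A₀ Y s) +
        ∑ s ∈ Finset.Ioc a N, A := by
      rw [← Finset.sum_add_distrib, ← Finset.sum_add_distrib]
      refine Finset.sum_congr rfl fun s _ => ?_
      simp only [hD]
      abel
    rw [hif, hr, smul_add, smul_add, ← hA']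
    abel
  rw [hsplit]
  refine (norm_add_le _ _).trans (add_le_add ?_ ?_)
  · rw [norm_smul, Real.norm_of_nonneg (inv_nonneg.2 hm.le), hsum]
    refine mul_le_mul_of_nonneg_left ((norm_add_le _ _).trans (add_le_add ?_ le_rfl))
      (inv_nonneg.2 hm.le)
    exact norm_mul_le _ _
  · rw [norm_smul, Real.norm_of_nonneg (inv_nonneg.2 hm.le), inv_mul_le_iff₀ hm, ← hcard]
    refine (norm_sum_le _ _).trans ((Finset.sum_le_card_nsmul _ _
      (N * ((‖A₀‖ + N / 4 + 1) * ‖A ^ u‖)) fun s hs => ?_).trans_eq (nsmul_eq_mul _ _))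
    have hsN : s ≤ N := (Finset.mem_Ioc.1 hs).2
    refine (hpert s hsN).trans ?_
    gcongr

/-! ### Independent drivers and the coupled buffers -/

theorem iIndepFun_sumElim {Ω β ι κ : Type*} [Fintype ι] [Fintype κ] [MeasurableSpace Ω]
    [MeasurableSpace β] {P : Measure Ω} [IsProbabilityMeasure P] {f : ι → Ω → β} {g : κ → Ω → β}
    (hf : ∀ i, Measurable (f i)) (hg : ∀ i, Measurable (g i)) (hfi : iIndepFun f P)
    (hgi : iIndepFun g P) (h : IndepFun (fun ω i => f i ω) (fun ω i => g i ω) P) :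
    iIndepFun (Sum.elim f g) P := by
  have hm : ∀ i, Measurable (Sum.elim f g i) := by
    rintro (i | i)
    exacts [hf i, hg i]
  rw [iIndepFun_iff_map_fun_eq_pi_map fun i => (hm i).aemeasurable]
  have : ∀ i, IsProbabilityMeasure (P.map (Sum.elim f g i)) := fun i =>
    Measure.isProbabilityMeasure_map (hm i).aemeasurable
  have hmp := measurePreserving_sumPiEquivProdPi_symm (X := fun _ : ι ⊕ κ => β)
    fun i => P.map (Sum.elim f g i)
  rw [← hmp.map_eq]
  have e1 : Measure.pi (fun i => P.map (Sum.elim f g (Sum.inl i))) =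
      P.map fun ω i => f i ω :=
    ((iIndepFun_iff_map_fun_eq_pi_map fun i => (hf i).aemeasurable).1 hfi).symm
  have e2 : Measure.pi (fun i => P.map (Sum.elim f g (Sum.inr i))) =
      P.map fun ω i => g i ω :=
    ((iIndepFun_iff_map_fun_eq_pi_map fun i => (hg i).aemeasurable).1 hgi).symm
  have hfm : Measurable fun ω i => f i ω := measurable_pi_lambda _ hf
  have hgm : Measurable fun ω i => g i ω := measurable_pi_lambda _ hg
  rw [e1, e2, ← h.map_prod_eq_prod_map_map hfm.aemeasurable hgm.aemeasurable,
    Measure.map_map (MeasurableEquiv.measurable _) (hfm.prodMk hgm)]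
  congr 1
  ext ω i
  cases i <;> rfl

theorem iIndepFun_comp_of_map_eq {Ω Ω' β ι : Type*} [Fintype ι] [MeasurableSpace Ω]
    [MeasurableSpace Ω'] [MeasurableSpace β] {P : Measure Ω} {P' : Measure Ω'}
    [IsProbabilityMeasure P] [IsProbabilityMeasure P'] {φ : Ω' → Ω} (hφ : Measurable φ)
    (hφP : P'.map φ = P) {f : ι → Ω → β} (hf : ∀ i, Measurable (f i)) (h : iIndepFun f P) :
    iIndepFun (fun i ω => f i (φ ω)) P' := by
  refine (iIndepFun_iff_map_fun_eq_pi_map (f := fun i ω => f i (φ ω))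
    fun i => ((hf i).comp hφ).aemeasurable).2 ?_
  have e1 : ∀ i, P'.map (fun ω => f i (φ ω)) = P.map (f i) := fun i => by
    rw [← hφP, Measure.map_map (hf i) hφ]
    rfl
  simp_rw [e1]
  rw [← (iIndepFun_iff_map_fun_eq_pi_map fun i => (hf i).aemeasurable).1 h, ← hφP,
    Measure.map_map (measurable_pi_lambda _ hf) hφ]
  rfl

/-- The σ-algebra generated by the variables `f i`, `i ∈ I`. -/
abbrev sigmaOf {Ω β ι : Type*} [MeasurableSpace β] (f : ι → Ω → β) (I : Set ι) :
    MeasurableSpace Ω :=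
  ⨆ i ∈ I, MeasurableSpace.comap (f i) inferInstance

theorem sigmaOf_mono {Ω β ι : Type*} [MeasurableSpace β] (f : ι → Ω → β) {I J : Set ι}
    (h : I ⊆ J) : sigmaOf f I ≤ sigmaOf f J := biSup_mono h

theorem sigmaOf_le {Ω β ι : Type*} [mΩ : MeasurableSpace Ω] [MeasurableSpace β] {f : ι → Ω → β}
    (hf : ∀ i, Measurable (f i)) (I : Set ι) : sigmaOf f I ≤ mΩ :=
  iSup₂_le fun i _ => (hf i).comap_le

theorem measurable_sigmaOf {Ω β ι : Type*} [MeasurableSpace β] (f : ι → Ω → β) {I : Set ι} {i : ι}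
    (hi : i ∈ I) : Measurable[sigmaOf f I] (f i) :=
  (comap_measurable (f i)).mono
    (le_iSup₂_of_le (f := fun i (_ : i ∈ I) => MeasurableSpace.comap (f i) inferInstance)
      i hi le_rfl) le_rfl

theorem indep_sigmaOf {Ω β ι : Type*} [mΩ : MeasurableSpace Ω] [MeasurableSpace β]
    {P : Measure Ω} {f : ι → Ω → β} (hf : ∀ i, Measurable (f i)) (h : iIndepFun f P)
    {I J : Set ι} (hIJ : Disjoint I J) : Indep (sigmaOf f I) (sigmaOf f J) P :=
  indep_iSup_of_disjoint (fun i => (hf i).comap_le) h.iIndep hIJ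

theorem isChain_of_iIndepFun {d : ℕ} {ι Ω : Type*} [MeasurableSpace Ω] {A : Mat d}
    {μ π : Measure (E d)} {P : Measure Ω} {S : ℕ} {f : ι → Ω → E d} (hf : ∀ i, Measurable (f i))
    (h : iIndepFun f P) {I : ℕ → Set ι} (hI : Monotone I) {X η : ℕ → Ω → E d}
    (h0 : ∃ i ∈ I 0, X 0 = f i) (h0law : P.map (X 0) = π)
    (hη : ∀ k < S, ∃ i ∈ I (k + 1), i ∉ I k ∧ η k = f i) (hηlaw : ∀ k < S, P.map (η k) = μ)
    (hrec : ∀ k < S, ∀ ω, X (k + 1) ω = A (X k ω) + η k ω) :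
    IsChain A μ π S P (fun k => sigmaOf f (I k)) X η where
  le k := sigmaOf_le hf _
  mono _ _ hkl := sigmaOf_mono f (hI hkl)
  measurable_init := by
    obtain ⟨i, hi, e⟩ := h0
    exact e ▸ measurable_sigmaOf f hi
  init_law := h0law
  measurable_noise k hk := by
    obtain ⟨i, hi, -, e⟩ := hη k hk
    exact e ▸ measurable_sigmaOf f hi
  noise_law := hηlaw
  indep k hk := by
    obtain ⟨i, -, hi, e⟩ := hη k hk
    rw [e]
    refine indep_of_indep_of_le_right
      (indep_sigmaOf hf h (Set.disjoint_singleton_right.2 hi)) ?_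
    exact (measurable_sigmaOf f (Set.mem_singleton i)).comap_le
  recursion := hrec

section Coupling

variable {d : ℕ} {Ω : Type*} {A : Mat d} {μ π : Measure (E d)} {T N S : ℕ} {X η : ℕ → Ω → E d}

/-- The path in the `s`-th buffer, of length `S`, that is started from the independent state `p.2 s`
and driven by the original noise. -/
noncomputable def coupledPath (A : Mat d) (N S : ℕ) (η : ℕ → Ω → E d) (s : ℕ) :
    ℕ → Ω × (Fin N → E d) → E d
  | 0, p => if h : s < N then p.2 ⟨s, h⟩ else 0
  | k + 1, p => A (coupledPath A N S η s k p) + η (s * S + k) p.1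

/-- The independent variables that drive the original and the coupled chains: the initial state, the
noise, and the initial states of the buffers. -/
def drivers (X η : ℕ → Ω → E d) (T N : ℕ) :
    (Unit ⊕ Fin T) ⊕ Fin N → Ω × (Fin N → E d) → E d :=
  Sum.elim (fun i p => Sum.elim (fun _ : Unit => X 0) (fun τ : Fin T => η τ) i p.1)
    (fun s p => p.2 s)

/-- The drivers of the original chain up to time `k`. -/
def originalIndex (T N k : ℕ) : Set ((Unit ⊕ Fin T) ⊕ Fin N) :=
  {i | i = Sum.inl (Sum.inl ()) ∨ ∃ τ : Fin T, (τ : ℕ) < k ∧ i = Sum.inl (Sum.inr τ)}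

/-- The drivers of the coupled chain of buffer `s` up to time `k`. -/
def bufferIndex (T N S s k : ℕ) : Set ((Unit ⊕ Fin T) ⊕ Fin N) :=
  {i | (∃ s' : Fin N, (s' : ℕ) = s ∧ i = Sum.inr s') ∨
    ∃ τ : Fin T, s * S ≤ τ ∧ (τ : ℕ) < s * S + k ∧ i = Sum.inl (Sum.inr τ)}

theorem bufferIndex_mono (T N S s : ℕ) : Monotone (bufferIndex T N S s) := by
  rintro k l hkl i (h | ⟨τ, h1, h2, h3⟩)
  exacts [Or.inl h, Or.inr ⟨τ, h1, by omega, h3⟩]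

theorem disjoint_bufferIndex {s s' : ℕ} (h : s < s') :
    Disjoint (bufferIndex T N S s S) (bufferIndex T N S s' S) := by
  rw [Set.disjoint_left]
  have h1 : (s + 1) * S ≤ s' * S := Nat.mul_le_mul_right _ h
  have h2 : (s + 1) * S = s * S + S := by ring
  rintro i (⟨t, ht, rfl⟩ | ⟨τ, hτ1, hτ2, rfl⟩) (⟨t', ht', e⟩ | ⟨τ', hτ1', hτ2', e⟩)
  · have := Sum.inr_injective e
    subst this
    omega
  · simp at e
  · simp at e
  · have := Sum.inr_injective (Sum.inl_injective e)
    subst this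
    omega

variable [MeasurableSpace Ω] {P : Measure Ω}

theorem IsVAR.measurable_drivers (h : IsVAR A μ π T P X η) (i : (Unit ⊕ Fin T) ⊕ Fin N) :
    Measurable (drivers X η T N i) := by
  rcases i with (i | τ) | s
  · exact h.measurable_init.comp measurable_fst
  · exact (h.measurable_noise τ τ.2).comp measurable_fst
  · exact (measurable_pi_apply s).comp measurable_snd

variable [IsProbabilityMeasure P]

theorem map_fst_prod {α β : Type*} [MeasurableSpace α] [MeasurableSpace β] (ν : Measure α)
    (ν' : Measure β) [SFinite ν] [IsProbabilityMeasure ν'] : (ν.prod ν').map Prod.fst = ν :=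
  measurePreserving_fst.map_eq

theorem map_snd_prod {α β : Type*} [MeasurableSpace α] [MeasurableSpace β] (ν : Measure α)
    (ν' : Measure β) [IsProbabilityMeasure ν] [SFinite ν'] : (ν.prod ν').map Prod.snd = ν' :=
  measurePreserving_snd.map_eq

theorem IsVAR.iIndepFun_drivers [IsProbabilityMeasure π] (h : IsVAR A μ π T P X η) (N : ℕ) :
    iIndepFun (drivers X η T N) (P.prod (Measure.pi fun _ : Fin N => π)) := by
  have hm1 : ∀ i, Measurable (Sum.elim (fun _ : Unit => X 0) (fun τ : Fin T => η τ) i) := by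
    rintro (i | τ)
    exacts [h.measurable_init, h.measurable_noise τ τ.2]
  have h1 : iIndepFun (Sum.elim (fun _ : Unit => X 0) (fun τ : Fin T => η τ)) P := by
    refine iIndepFun_sumElim (fun _ => h.measurable_init) (fun τ => h.measurable_noise τ τ.2)
      iIndepFun.of_subsingleton h.noise_indep ?_
    exact h.init_indep.comp (φ := fun x (_ : Unit) => x) (ψ := id) (by fun_prop) measurable_id
  refine iIndepFun_sumElim (fun i => (hm1 i).comp measurable_fst)
    (fun s => (measurable_pi_apply s).comp measurable_snd) ?_ ?_ ?_
  · exact iIndepFun_comp_of_map_eq measurable_fst (map_fst_prod _ _) hm1 h1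
  · refine iIndepFun_comp_of_map_eq (f := fun (s : Fin N) (y : Fin N → E d) => y s)
      measurable_snd (map_snd_prod P _) (fun s => measurable_pi_apply s) ?_
    exact iIndepFun_pi (X := fun _ x => x) fun _ => aemeasurable_id
  · exact indepFun_prod (X := fun ω i => Sum.elim (fun _ : Unit => X 0) (fun τ : Fin T => η τ) i ω)
      (Y := fun y : Fin N → E d => fun s => y s) (measurable_pi_lambda _ hm1) measurable_id

theorem IsVAR.isChain [IsProbabilityMeasure π] (h : IsVAR A μ π T P X η) (N : ℕ) :
    IsChain A μ π T (P.prod (Measure.pi fun _ : Fin N => π))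
      (fun k => sigmaOf (drivers X η T N) (originalIndex T N k))
      (fun k p => X k p.1) (fun k p => η k p.1) := by
  refine isChain_of_iIndepFun h.measurable_drivers (h.iIndepFun_drivers N) ?_
    ⟨Sum.inl (Sum.inl ()), Or.inl rfl, rfl⟩ ?_ (fun k hk => ⟨Sum.inl (Sum.inr ⟨k, hk⟩),
      Or.inr ⟨_, Nat.lt_succ_self k, rfl⟩, ?_, rfl⟩) (fun k hk => ?_)
    fun k hk p => h.recursion k hk p.1
  · rintro k l hkl i (h | ⟨τ, h1, h2⟩)
    exacts [Or.inl h, Or.inr ⟨τ, by omega, h2⟩]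
  · have := Measure.map_map (μ := P.prod (Measure.pi fun _ : Fin N => π)) h.measurable_init
      measurable_fst
    rw [map_fst_prod, h.init_law] at this
    exact this.symm
  · rintro (h | ⟨τ, h1, h2⟩)
    · simp at h
    · have := Sum.inr_injective (Sum.inl_injective h2)
      subst this
      exact lt_irrefl _ h1
  · have := Measure.map_map (μ := P.prod (Measure.pi fun _ : Fin N => π))
      (h.measurable_noise k hk) measurable_fst
    rw [map_fst_prod, h.noise_law k hk] at this
    exact this.symm

theorem IsVAR.isChain_coupledPath [IsProbabilityMeasure π] (h : IsVAR A μ π T P X η)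
    (hNS : N * S ≤ T) {s : ℕ} (hs : s < N) :
    IsChain A μ π S (P.prod (Measure.pi fun _ : Fin N => π))
      (fun k => sigmaOf (drivers X η T N) (bufferIndex T N S s k))
      (coupledPath A N S η s) (fun k p => η (s * S + k) p.1) := by
  have hlt : ∀ k < S, s * S + k < T := fun k hk => by
    have h1 : (s + 1) * S ≤ N * S := Nat.mul_le_mul_right _ hs
    have h2 : (s + 1) * S = s * S + S := by ring
    omega
  have e0 : coupledPath A N S η s 0 = fun p : Ω × (Fin N → E d) => p.2 ⟨s, hs⟩ := by
    ext p
    simp [coupledPath, hs]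
  refine isChain_of_iIndepFun h.measurable_drivers (h.iIndepFun_drivers N)
    (bufferIndex_mono T N S s) ⟨Sum.inr ⟨s, hs⟩, Or.inl ⟨_, rfl, rfl⟩, e0⟩ ?_
    (fun k hk => ⟨Sum.inl (Sum.inr ⟨s * S + k, hlt k hk⟩),
      Or.inr ⟨_, Nat.le_add_right _ _, Nat.lt_succ_self _, rfl⟩, ?_, rfl⟩) (fun k hk => ?_)
    fun k hk p => rfl
  · have h1 := Measure.map_map (μ := P.prod (Measure.pi fun _ : Fin N => π))
      (measurable_pi_apply (⟨s, hs⟩ : Fin N)) measurable_snd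
    rw [map_snd_prod] at h1
    rw [e0]
    refine h1.symm.trans ?_
    exact (measurePreserving_eval (fun _ : Fin N => π) ⟨s, hs⟩).map_eq
  · rintro (⟨s', h1, h2⟩ | ⟨τ, h1, h2, h3⟩)
    · simp at h2
    · have := Sum.inr_injective (Sum.inl_injective h3)
      subst this
      exact lt_irrefl _ h2
  · have := Measure.map_map (μ := P.prod (Measure.pi fun _ : Fin N => π))
      (h.measurable_noise _ (hlt k hk)) measurable_fst
    rw [map_fst_prod, h.noise_law _ (hlt k hk)] at this
    exact this.symm

/-- The contraction of the coupled buffer `s`. -/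
noncomputable def coupledContraction (A : Mat d) (N B u : ℕ) (η : ℕ → Ω → E d) (γ R : ℝ) (s : ℕ)
    (p : Ω × (Fin N → E d)) : Mat d :=
  contraction γ (fun j => trunc R (coupledPath A N (B + u) η s (u + j) p)) B

/-- The noise of the coupled buffer `s`. -/
noncomputable def coupledNoise (A : Mat d) (N B u : ℕ) (η : ℕ → Ω → E d) (γ R : ℝ) (s : ℕ)
    (p : Ω × (Fin N → E d)) : Mat d :=
  noiseSum γ (fun j => trunc R (coupledPath A N (B + u) η s (u + j) p))
    (fun j => η (s * (B + u) + (u + j)) p.1) B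

/-- The filtration runs backwards in time: its `k`-th member is generated by the drivers of the last
`k` buffers. Independence holds because restarted buffers use disjoint blocks of noise and separate
initial states. -/
theorem IsVAR.isIndepPairs [IsProbabilityMeasure π] (h : IsVAR A μ π T P X η) {B u : ℕ}
    (hNS : N * (B + u) ≤ T) (γ R : ℝ) :
    IsIndepPairs N (P.prod (Measure.pi fun _ : Fin N => π))
      (fun k => sigmaOf (drivers X η T N)
        {i | ∃ s, N - k ≤ s ∧ s < N ∧ i ∈ bufferIndex T N (B + u) s (B + u)})
      (fun k => coupledContraction A N B u η γ R (N - 1 - k))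
      (fun k => coupledNoise A N B u η γ R (N - 1 - k)) := by
  have hx : ∀ s < N, ∀ j < B,
      Measurable[sigmaOf (drivers X η T N) (bufferIndex T N (B + u) s (B + u))]
        fun p => trunc R (coupledPath A N (B + u) η s (u + j) p) := fun s hs j hj =>
    (measurable_trunc R).comp (((h.isChain_coupledPath hNS hs).measurable_state (by omega)).mono
      (sigmaOf_mono _ (bufferIndex_mono T N (B + u) s (by omega))) le_rfl)
  have hz : ∀ s < N, ∀ j < B,
      Measurable[sigmaOf (drivers X η T N) (bufferIndex T N (B + u) s (B + u))]
        fun p : Ω × (Fin N → E d) => η (s * (B + u) + (u + j)) p.1 := fun s hs j hj =>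
    ((h.isChain_coupledPath hNS hs).measurable_noise (u + j) (by omega)).mono
      (sigmaOf_mono _ (bufferIndex_mono T N (B + u) s (by omega))) le_rfl
  have hH : ∀ s < N, Measurable[sigmaOf (drivers X η T N) (bufferIndex T N (B + u) s (B + u))]
      (coupledContraction A N B u η γ R s) := fun s hs =>
    @measurable_contraction d _ (sigmaOf (drivers X η T N) (bufferIndex T N (B + u) s (B + u))) γ
      _ B (hx s hs)
  have hV : ∀ s < N, Measurable[sigmaOf (drivers X η T N) (bufferIndex T N (B + u) s (B + u))]
      (coupledNoise A N B u η γ R s) := fun s hs =>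
    @measurable_noiseSum d _ (sigmaOf (drivers X η T N) (bufferIndex T N (B + u) s (B + u))) γ
      _ _ B (hx s hs) (hz s hs)
  have hsub : ∀ k < N, bufferIndex T N (B + u) (N - 1 - k) (B + u) ⊆
      {i | ∃ s, N - (k + 1) ≤ s ∧ s < N ∧ i ∈ bufferIndex T N (B + u) s (B + u)} :=
    fun k hk i hi => ⟨N - 1 - k, by omega, by omega, hi⟩
  refine ⟨fun k => sigmaOf_le h.measurable_drivers _, fun k l hkl => sigmaOf_mono _ ?_,
    fun k hk => (hH _ (by omega)).mono (sigmaOf_mono _ (hsub k hk)) le_rfl,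
    fun k hk => (hV _ (by omega)).mono (sigmaOf_mono _ (hsub k hk)) le_rfl, fun k hk => ?_⟩
  · rintro i ⟨s, h1, h2, h3⟩
    exact ⟨s, by omega, h2, h3⟩
  · refine indep_of_indep_of_le_right (indep_sigmaOf h.measurable_drivers (h.iIndepFun_drivers N)
      (J := bufferIndex T N (B + u) (N - 1 - k) (B + u)) ?_) ?_
    · rw [Set.disjoint_left]
      rintro i ⟨s, h1, h2, h3⟩ hi
      exact Set.disjoint_left.1 (disjoint_bufferIndex (by omega : N - 1 - k < s)) hi h3
    · exact Measurable.comap_le ((hH _ (by omega)).prodMk (hV _ (by omega)))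

end Coupling

/-! ### The error bound with unspecified parameters -/

section Probability

variable {d : ℕ} {Cμ : ℝ} {Ω : Type*} [MeasurableSpace Ω] {A : Mat d} {μ π : Measure (E d)} {T : ℕ}
  {P : Measure Ω} {X η : ℕ → Ω → E d}

theorem sigmaMax_pos (hd : 1 ≤ d) {M : Mat d} (hM : ∀ x : E d, x ≠ 0 → 0 < ⟪x, M x⟫) :
    0 < sigmaMax M := by
  set e := EuclideanSpace.basisFun (Fin d) ℝ ⟨0, hd⟩ with he
  have h1 : ‖e‖ = 1 := by simp [he]
  have h2 := inner_apply_le_sigmaMax hd M e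
  have h3 := hM e (norm_ne_zero_iff.1 (h1 ▸ one_ne_zero))
  rw [h1] at h2
  linarith

theorem IsChain.measureReal_norm_sq_gt [IsProbabilityMeasure P] {S : ℕ}
    {ℱ : ℕ → MeasurableSpace Ω} (hπ : IsStationaryLaw A μ π) (h : IsChain A μ π S P ℱ X η) {k : ℕ}
    (hk : k ≤ S) (R : ℝ) :
    P.real {ω | R < ‖X k ω‖ ^ 2} = π.real {z | R < ‖z‖ ^ 2} := by
  have hm : Measurable (X k) := (h.measurable_state hk).mono (h.le _) le_rfl
  rw [← h.law_state hπ hk, map_measureReal_apply hm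
    (measurableSet_lt measurable_const (by fun_prop))]
  rfl

/-- The space is enlarged by the independent restart states. The event concerns the original sample
only, so its probability is unchanged; its complement is covered by truncation on the original path,
truncation on a restarted path, and failure of concentration. -/
theorem IsVAR.one_sub_le_measureReal [IsProbabilityMeasure P] (hC : 0 < Cμ) (hA : ‖A‖ < 1)
    (hμ : IsSubGaussianNoise Cμ μ) (hπ : IsStationaryLaw A μ π) (h : IsVAR A μ π T P X η)
    (hd : 1 ≤ d) {γ R r n₀ ℓ : ℝ} {B u a N : ℕ} (hB : 1 ≤ B) (haN : a < N) (hNS : N * (B + u) ≤ T)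
    (hγ : 0 < γ) (hR : 0 ≤ R) (hγR : 8 * B * (γ * R) ≤ 1)
    (hp : π.real {z | R < ‖z‖ ^ 2} ≤ 1 / (4 * momentConst Cμ)) (hr : 0 < r)
    (hrγ : 1 / (2 * momentConst Cμ) ≤ r * (γ * B * lambdaMin (covMat π)))
    (hn₀ : 0 ≤ n₀) (ha : n₀ ≤ a) (hℓ : 0 ≤ ℓ) (A₀ : Mat d) {c ρ : ℝ}
    (hc : c = 1 / (8 * momentConst Cμ)) (hρ : ρ = Real.exp (-(c / (4 * r)))) :
    1 - (((N * (B + u) + 1) + N * (B + u + 1)) * π.real {z | R < ‖z‖ ^ 2} +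
        (N + 1) ^ 2 * (5 ^ d * Real.exp (-(c / 2 * n₀))) + 25 ^ d * Real.exp (-ℓ)) ≤
      P.real {ω | ‖sgdRER γ R B u a N A₀ (fun τ => X τ ω) - A‖ ≤
        ((N : ℝ) - a)⁻¹ * (‖A₀ - A‖ * (2 * ρ ^ a / (1 - ρ)) +
          4 * √(4 * (γ * (Cμ * sigmaMax (covMat μ))) *
            (2 * (N - a : ℕ) * (n₀ + 1 + 2 / (1 - ρ))) * ℓ)) +
        N * ((‖A₀‖ + N / 4 + 1) * ‖A ^ u‖)} := by
  have := hπ.isProbabilityMeasure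
  have hK := one_le_momentConst hC
  have hc0 : 0 < c := by rw [hc]; positivity
  have hB' : (1 : ℝ) ≤ B := by exact_mod_cast hB
  have hγR0 : 0 ≤ γ * R := mul_nonneg hγ.le hR
  have hγR' : γ * R ≤ 1 / 2 := by nlinarith
  have htr : ∀ x : E d, γ * ‖trunc R x‖ ^ 2 ≤ 1 / 2 := fun x =>
    (mul_le_mul_of_nonneg_left (norm_sq_trunc_le hR x) hγ.le).trans hγR'
  have hσ : 0 < sigmaMax (covMat μ) := sigmaMax_pos hd fun x hx => hμ.inner_covMat_pos hx
  set G := {ω | ‖sgdRER γ R B u a N A₀ (fun τ => X τ ω) - A‖ ≤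
        ((N : ℝ) - a)⁻¹ * (‖A₀ - A‖ * (2 * ρ ^ a / (1 - ρ)) +
          4 * √(4 * (γ * (Cμ * sigmaMax (covMat μ))) *
            (2 * (N - a : ℕ) * (n₀ + 1 + 2 / (1 - ρ))) * ℓ)) +
        N * ((‖A₀‖ + N / 4 + 1) * ‖A ^ u‖)} with hG
  set Q := P.prod (Measure.pi fun _ : Fin N => π) with hQ
  set p := π.real {z | R < ‖z‖ ^ 2} with hpd
  set h' : ℕ → Ω × (Fin N → E d) → Mat d :=
    fun k => coupledContraction A N B u η γ R (N - 1 - k) with hh'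
  set V' : ℕ → Ω × (Fin N → E d) → Mat d :=
    fun k => coupledNoise A N B u η γ R (N - 1 - k) with hV'
  have hcontr : ∀ s q w, ‖coupledContraction A N B u η γ R s q w‖ ≤ ‖w‖ := fun s q w =>
    norm_contraction_apply_le hγ.le (fun _ => htr _) B w
  have hmain := (h.isIndepPairs hNS γ R).measure_not_le (ℓ := ℓ)
    (fun k q => ContinuousLinearMap.opNorm_le_bound _ zero_le_one fun w => by
      rw [one_mul]; exact hcontr _ q w) haN hr hc0 hn₀ ha
    (c' := γ * (Cμ * sigmaMax (covMat μ))) (by positivity) hℓ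
    (fun k hk w => hc ▸ (h.isChain_coupledPath hNS (by omega : N - 1 - k < N)
      ).lintegral_norm_contraction_rpow_le hC hA hμ hπ hB (by omega) hγ hR hγR hp hr hrγ w)
    (fun k hk v hv l w => by
      refine le_trans (lintegral_mono fun q => ?_)
        ((h.isChain_coupledPath hNS (by omega : N - 1 - k < N)
          ).lintegral_exp_noiseSum_le_one hC hμ hγ.le hR hγR' (u := u) l v w B (by omega))
      -- The compensator may be enlarged from `⟪v, Σ v⟫` to `sigmaMax Σ`, since the energy loss is
      -- nonnegative and `‖v‖ ≤ 1`.
      refine ENNReal.ofReal_le_ofReal (Real.exp_le_exp.2 (sub_le_sub_left ?_ _))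
      rw [mul_assoc (l ^ 2)]
      refine mul_le_mul_of_nonneg_right (mul_le_mul_of_nonneg_left
        (mul_le_mul_of_nonneg_left (mul_le_mul_of_nonneg_left ?_ hC.le) hγ.le) (sq_nonneg l)) ?_
      · refine (inner_apply_le_sigmaMax hd _ v).trans (mul_le_of_le_one_right hσ.le ?_)
        exact pow_le_one₀ (norm_nonneg v) hv
      · exact sub_nonneg.2 (pow_le_pow_left₀ (norm_nonneg _) (hcontr _ q w) 2))
  rw [← hρ] at hmain
  set bad := {q : Ω × (Fin N → E d) | ¬ (‖tailWeight (N - a) (fun k => h' k q) N‖ ≤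
      2 * ρ ^ a / (1 - ρ) ∧
    ‖∑ k ∈ Finset.range N, V' k q * tailWeight (N - a) (fun k => h' k q) k‖ ≤
      4 * √(4 * (γ * (Cμ * sigmaMax (covMat μ))) *
        (2 * (N - a : ℕ) * (n₀ + 1 + 2 / (1 - ρ))) * ℓ))} with hbad
  set b₁ := ⋃ τ ∈ Finset.range (N * (B + u) + 1),
    {q : Ω × (Fin N → E d) | R < ‖X τ q.1‖ ^ 2} with hb₁
  set b₂ := ⋃ s ∈ Finset.range N, ⋃ k ∈ Finset.range (B + u + 1),
    {q : Ω × (Fin N → E d) | R < ‖coupledPath A N (B + u) η s k q‖ ^ 2} with hb₂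
  have e₁ : Q.real b₁ ≤ (N * (B + u) + 1) * p := by
    refine (measureReal_biUnion_finset_le _ _).trans
      ((Finset.sum_le_card_nsmul _ _ p fun τ hτ => ?_).trans_eq ?_)
    · have := Finset.mem_range.1 hτ
      exact ((h.isChain N).measureReal_norm_sq_gt hπ (by omega) R).le
    · simp
  have e₂ : Q.real b₂ ≤ N * (B + u + 1) * p := by
    refine (measureReal_biUnion_finset_le _ _).trans
      ((Finset.sum_le_card_nsmul _ _ ((B + u + 1) * p) fun s hs => ?_).trans_eq ?_)
    · refine (measureReal_biUnion_finset_le _ _).trans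
        ((Finset.sum_le_card_nsmul _ _ p fun k hk => ?_).trans_eq ?_)
      · have := Finset.mem_range.1 hk
        exact ((h.isChain_coupledPath hNS (Finset.mem_range.1 hs)
          ).measureReal_norm_sq_gt hπ (by omega) R).le
      · simp
    · simp [mul_assoc]
  have e₃ : Q.real bad ≤ (N + 1) ^ 2 * (5 ^ d * Real.exp (-(c / 2 * n₀))) +
      25 ^ d * Real.exp (-ℓ) := by
    rw [← ENNReal.ofReal_add (by positivity) (by positivity)] at hmain
    exact ENNReal.toReal_le_of_le_ofReal (by positivity) hmain
  have hcover : Set.univ ⊆ ((G ×ˢ Set.univ ∪ b₁) ∪ b₂) ∪ bad := by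
    intro q _
    by_contra hq
    simp only [Set.mem_union, not_or] at hq
    obtain ⟨⟨⟨g, g₁⟩, g₂⟩, g₃⟩ := hq
    refine g ⟨?_, Set.mem_univ _⟩
    simp only [hb₁, hb₂, Set.mem_iUnion, not_exists, Finset.mem_range, Set.mem_ofPred_eq,
      not_lt] at g₁ g₂
    obtain ⟨f₁, f₂⟩ := not_not.1 g₃
    have hm : (0 : ℝ) < N - a := sub_pos.2 (by exact_mod_cast haN)
    refine (norm_sgdRER_sub_le A A₀ (fun τ => X τ q.1) (fun τ => η τ q.1)
      (fun s k => coupledPath A N (B + u) η s k q) hA.le hγ.le hR hγR haN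
      (fun τ hτ => g₁ τ (by omega)) (fun τ hτ => h.recursion τ (by omega) _)
      (fun s hs k hk => g₂ s hs k (by omega)) (fun s hs k hk => rfl)
      (fun s => coupledContraction A N B u η γ R s q) (fun s => coupledNoise A N B u η γ R s q)
      (fun _ => rfl) fun _ => rfl).trans ?_
    gcongr
  have h1 : (1 : ℝ) ≤ Q.real (((G ×ˢ Set.univ ∪ b₁) ∪ b₂) ∪ bad) := by
    have := measureReal_mono (μ := Q) hcover
    rwa [probReal_univ] at this
  have h2 : Q.real (G ×ˢ Set.univ) = P.real G := by
    rw [hQ, measureReal_prod_prod, probReal_univ, mul_one]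
  have h3 := measureReal_union_le (μ := Q) ((G ×ˢ Set.univ ∪ b₁) ∪ b₂) bad
  have h4 := measureReal_union_le (μ := Q) (G ×ˢ Set.univ ∪ b₁) b₂
  have h5 := measureReal_union_le (μ := Q) (G ×ˢ Set.univ) b₁
  rw [h2] at h5
  linarith

end Probability

/-! ### Choice of parameters -/

section Parameters

theorem half_le_one_sub_exp_neg {x : ℝ} (h0 : 0 ≤ x) (h1 : x ≤ 1) :
    x / 2 ≤ 1 - Real.exp (-x) := by
  have h2 : Real.exp (-x) ≤ 1 - x / 2 := by
    rw [Real.exp_neg, inv_le_iff_one_le_mul₀ (Real.exp_pos x)]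
    have := mul_le_mul_of_nonneg_left (Real.add_one_le_exp x) (by linarith : 0 ≤ 1 - x / 2)
    nlinarith
  linarith

theorem five_pow_mul_exp_le_one (d : ℕ) : (5 : ℝ) ^ d * Real.exp (-(2 * d)) ≤ 1 := by
  have h : (5 : ℝ) ≤ Real.exp 2 := by
    have := Real.quadratic_le_exp_of_nonneg (zero_le_two : (0 : ℝ) ≤ 2)
    linarith
  rw [Real.exp_neg, ← div_eq_mul_inv, div_le_one (Real.exp_pos _), mul_comm, Real.exp_nat_mul]
  gcongr

/-- Truncation, long products and noise contribute `8`, `4` and `1` times `T ^ (-α)`. The extra `T ^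
(-2)` in the first two pays for `d ≤ T` and the union bounds; the terms `2d` and `4d` in the
exponents absorb `5 ^ d` and `25 ^ d`, as `5 ≤ exp 2`. -/
theorem failure_probability_le {α α₀ c₀ κ p L : ℝ} {d T N S : ℕ} (hα₀ : 0 < α₀) (hα : α₀ ≤ α)
    (hL : L = Real.log T) (hT : 1 ≤ T) (hdT : d ≤ T) (hN : 1 ≤ N) (hS : 1 ≤ S) (hNS : N * S ≤ T)
    (hp : p ≤ 2 * d * Real.exp (-((α + 2) * L))) (hp0 : 0 ≤ p) (hκ : 3 + 2 / α₀ ≤ κ * c₀) :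
    ((N * S + 1) + N * (S + 1)) * p +
        (N + 1) ^ 2 * (5 ^ d * Real.exp (-(κ * (c₀ * (d + α * L))))) +
        25 ^ d * Real.exp (-(4 * d + α * L)) ≤ 13 / (T : ℝ) ^ α := by
  have hT' : (1 : ℝ) ≤ T := by exact_mod_cast hT
  have hT0 : (0 : ℝ) < T := by linarith
  have hdT' : (d : ℝ) ≤ T := by exact_mod_cast hdT
  have hL0 : 0 ≤ L := hL ▸ Real.log_nonneg hT'
  have hNS' : (N : ℝ) * S ≤ T := by exact_mod_cast hNS
  have hS' : (1 : ℝ) ≤ S := by exact_mod_cast hS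
  have hN' : (1 : ℝ) ≤ N := by exact_mod_cast hN
  have hNT : (N : ℝ) ≤ T := by nlinarith
  have hexp : Real.exp (-(α * L)) = 1 / (T : ℝ) ^ α := by
    rw [Real.exp_neg, Real.rpow_def_of_pos hT0, hL, mul_comm, one_div]
  have hexp2 : Real.exp (-((α + 2) * L)) = 1 / (T : ℝ) ^ α * ((T : ℝ) ^ 2)⁻¹ := by
    rw [← hexp, add_mul, neg_add, Real.exp_add, Real.exp_neg (2 * L), two_mul, Real.exp_add, hL,
      Real.exp_log hT0, sq]
  set τ := 1 / (T : ℝ) ^ α with hτ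
  have hτ0 : 0 < τ := by positivity
  have h1 : ((N * S + 1) + N * (S + 1)) * p ≤ 8 * τ := by
    calc _ ≤ (4 * T) * (2 * T * (τ * ((T : ℝ) ^ 2)⁻¹)) := by
          rw [hexp2] at hp
          refine mul_le_mul (by linarith) (hp.trans ?_) hp0 (by positivity)
          gcongr
      _ = 8 * τ := by field_simp; ring
  have h2 : (N + 1) ^ 2 * (5 ^ d * Real.exp (-(κ * (c₀ * (d + α * L))))) ≤ 4 * τ := by
    have h3 : 2 * d + (α + 2) * L ≤ κ * (c₀ * (d + α * L)) := by
      have hα' : 0 < α := by linarith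
      have e1 := mul_le_mul_of_nonneg_right hκ (by positivity : 0 ≤ d + α * L)
      have e2 : 2 * L ≤ 2 / α₀ * (α * L) := by
        rw [div_mul_eq_mul_div, le_div_iff₀ hα₀]
        nlinarith
      have e3 : 0 ≤ 2 / α₀ * d := by positivity
      have e4 : 0 ≤ α * L := by positivity
      have e5 : (0 : ℝ) ≤ d := by positivity
      nlinarith
    calc _ ≤ (2 * T) ^ 2 * (5 ^ d * Real.exp (-(2 * d) + -((α + 2) * L))) := by
          gcongr
          · linarith
          · linarith
      _ = (2 * T) ^ 2 * (τ * ((T : ℝ) ^ 2)⁻¹) * (5 ^ d * Real.exp (-(2 * d))) := by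
          rw [Real.exp_add, hexp2]; ring
      _ ≤ (2 * T) ^ 2 * (τ * ((T : ℝ) ^ 2)⁻¹) * 1 := by
          gcongr
          exact five_pow_mul_exp_le_one d
      _ = 4 * τ := by field_simp; ring
  have h3 : 25 ^ d * Real.exp (-(4 * d + α * L)) ≤ τ := by
    have e : (25 : ℝ) ^ d * Real.exp (-(4 * d + α * L)) =
        (5 ^ d * Real.exp (-(2 * d))) ^ 2 * τ := by
      rw [← hexp, mul_pow, ← pow_mul, mul_comm d, pow_mul, ← Real.exp_nat_mul, mul_assoc,
        ← Real.exp_add]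
      norm_num
      ring
    rw [e]
    exact mul_le_of_le_one_left hτ0.le (pow_le_one₀ (by positivity) (five_pow_mul_exp_le_one d))
  calc _ ≤ 8 * τ + 4 * τ + τ := by gcongr
    _ = 13 / (T : ℝ) ^ α := by rw [hτ]; ring

/-- With `θ ≥ c/(dκ log T)` the rate `θ/16` gives the exponent constant `c/16`, and `1 - exp
(-(θ/16)) ≥ θ/32` gives the prefactor `64/c`. -/
theorem bias_le_biasFactor {c θ κ x : ℝ} {d a t T : ℕ} (hc : 0 < c) (hθ : 0 < θ) (hθ1 : θ ≤ 1)
    (hx : 0 ≤ x) (hat : a < t) (hD : 0 < d * κ * Real.log T)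
    (hcθ : c ≤ θ * (d * κ * Real.log T)) :
    ((t : ℝ) - a)⁻¹ * (x * (2 * Real.exp (-(θ / 16)) ^ a / (1 - Real.exp (-(θ / 16))))) ≤
      biasFactor (c / 16) (64 / c) d a t T κ * x := by
  have hm : (0 : ℝ) < t - a := sub_pos.2 (by exact_mod_cast hat)
  unfold biasFactor
  set D := d * κ * Real.log T with hDd
  have h1 : θ / 32 ≤ 1 - Real.exp (-(θ / 16)) := by
    have := half_le_one_sub_exp_neg (by positivity : 0 ≤ θ / 16) (by linarith)
    linarith
  have h2 : c / D ≤ θ := (div_le_iff₀ hD).2 hcθ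
  have h3 : Real.exp (-(θ / 16)) ^ a ≤ Real.exp (-(c / 16 * (a / D))) := by
    rw [← Real.exp_nat_mul]
    refine Real.exp_le_exp.2 ?_
    have : c / D * a ≤ θ * a := by gcongr
    have e : c / 16 * (a / D) = c / D * a / 16 := by ring
    rw [e]
    linarith
  have h4 : 2 * Real.exp (-(θ / 16)) ^ a / (1 - Real.exp (-(θ / 16))) ≤
      64 / c * D * Real.exp (-(c / 16 * (a / D))) := by
    rw [div_le_iff₀ (by linarith [hθ])]
    have h5 : c / D / 32 ≤ 1 - Real.exp (-(θ / 16)) := le_trans (by gcongr) h1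
    calc 2 * Real.exp (-(θ / 16)) ^ a ≤ 2 * Real.exp (-(c / 16 * (a / D))) := by gcongr
      _ = 64 / c * D * Real.exp (-(c / 16 * (a / D))) * (c / D / 32) := by field_simp; ring
      _ ≤ _ := by gcongr
  calc _ ≤ ((t : ℝ) - a)⁻¹ * (x * (64 / c * D * Real.exp (-(c / 16 * (a / D))))) := by
        gcongr
    _ = _ := by ring

/-- The variance is proportional to `γq`, and `q` is of order `1/(γBΛ)`, so the step size
disappears. -/
theorem fluctuation_le {Cμ σ γ θ q Cq ℓ L B Λ : ℝ} {a t : ℕ} (hat : a < t) (hC : 0 < Cμ)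
    (hσ : 0 < σ) (hB : 0 < B) (hΛ : 0 < Λ) (hγ : 0 < γ) (hθ : θ = γ * B * Λ) (hq : q ≤ Cq / θ)
    (hq0 : 0 ≤ q) (hℓ0 : 0 ≤ ℓ)
    (hℓ : ℓ ≤ 4 * L) :
    ((t : ℝ) - a)⁻¹ * (4 * √(4 * (γ * (Cμ * σ)) * (2 * (t - a : ℕ) * q) * ℓ)) ≤
      4 * √(32 * Cμ * Cq) * √(L * σ / (((t : ℝ) - a) * B * Λ)) := by
  have hm : (0 : ℝ) < t - a := sub_pos.2 (by exact_mod_cast hat)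
  have hθ0 : 0 < θ := hθ ▸ by positivity
  have hCq : 0 ≤ Cq := by
    have := hq0.trans hq
    rwa [le_div_iff₀ hθ0, zero_mul] at this
  rw [Nat.cast_sub hat.le]
  set m := (t : ℝ) - a with hmd
  have e1 : m⁻¹ = √((m ^ 2)⁻¹) := by rw [Real.sqrt_inv, Real.sqrt_sq hm.le]
  rw [e1, mul_left_comm, ← Real.sqrt_mul (by positivity), mul_assoc 4 √(_),
    ← Real.sqrt_mul (by positivity)]
  refine mul_le_mul_of_nonneg_left (Real.sqrt_le_sqrt ?_) (by norm_num)
  calc _ ≤ (m ^ 2)⁻¹ * (4 * (γ * (Cμ * σ)) * (2 * m * (Cq / θ)) * (4 * L)) := by gcongr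
    _ = _ := by rw [hθ]; field_simp; ring

theorem tr_le_mul_kappa_mul_lambdaMin {d : ℕ} (hd : 1 ≤ d) {M : Mat d}
    (hM : (M : E d →ₗ[ℝ] E d).IsSymmetric) (hpos : ∀ x : E d, x ≠ 0 → 0 < ⟪x, M x⟫) :
    tr M ≤ d * kappa M * lambdaMin M := by
  have h1 := sigmaMin_pos hd hpos
  have h2 := sigmaMin_le_lambdaMin hd hM (lambdaMin_pos hd hM hpos).le
  have h3 := sigmaMax_pos hd hpos
  calc tr M ≤ d * sigmaMax M := tr_le_mul_sigmaMax hd M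
    _ = d * kappa M * sigmaMin M := by rw [kappa]; field_simp
    _ ≤ d * kappa M * lambdaMin M := by
      have : 0 ≤ kappa M := div_nonneg h3.le h1.le
      gcongr

/-- Writing `θ = γBΛ`, the lower bound treats the two branches of the minimum separately, the second
through `tr G ≤ dκΛ`. The upper bound uses `8BγR ≤ 1` and `R ≥ KαdΛL`. -/
theorem stepSize_bounds {Cγ cR K α d L κ Λ τ R γ B : ℝ} (hCγ : 0 < Cγ) (hcR : 0 < cR)
    (hKα : K * α ≤ cR) (hd : 0 < d) (hL : Real.log 2 ≤ L) (hB : 0 < B) (hΛ : 0 < Λ)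
    (hτ : d * Λ ≤ τ) (hτκ : τ ≤ d * κ * Λ) (hdκ : 1 ≤ d * κ) (hR : R = cR * τ * L)
    (hγ : γ = min (Cγ / (B * Λ)) (1 / (8 * B * R))) :
    0 < γ ∧ 8 * B * (γ * R) ≤ 1 ∧
      min (Cγ * Real.log 2) (1 / (8 * cR)) ≤ γ * B * Λ * (d * κ * L) ∧
      γ * B * Λ * (8 * K * (d * (α * L))) ≤ 1 := by
  have hL0 : 0 < L := (Real.log_pos one_lt_two).trans_le hL
  have hτ0 : 0 < τ := lt_of_lt_of_le (by positivity) hτ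
  have hR0 : 0 < R := hR ▸ by positivity
  have hγ0 : 0 < γ := hγ ▸ lt_min (by positivity) (by positivity)
  have hγR : 8 * B * (γ * R) ≤ 1 := by
    have h1 : γ ≤ 1 / (8 * B * R) := hγ ▸ min_le_right _ _
    rw [le_div_iff₀ (by positivity)] at h1
    linarith
  refine ⟨hγ0, hγR, ?_, ?_⟩
  · rcases min_choice (Cγ / (B * Λ)) (1 / (8 * B * R)) with h | h
    · have e : γ * B * Λ = Cγ := by rw [hγ, h]; field_simp
      rw [e]
      have h1 : Real.log 2 ≤ d * κ * L := hL.trans (le_mul_of_one_le_left hL0.le hdκ)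
      exact (min_le_left _ _).trans (by gcongr)
    · have e : γ * B * Λ = Λ / (8 * R) := by rw [hγ, h]; field_simp
      refine (min_le_right _ _).trans ?_
      rw [e, div_mul_eq_mul_div, div_le_div_iff₀ (by positivity) (by positivity), hR]
      have := mul_le_mul_of_nonneg_left hτκ (by positivity : 0 ≤ 8 * cR * L)
      linarith
  · have h1 : Λ * (K * α * d * L) ≤ R := by
      rw [hR]
      calc Λ * (K * α * d * L) = (K * α) * (d * Λ) * L := by ring
        _ ≤ _ := by gcongr
    have h2 := mul_le_mul_of_nonneg_left h1 (by positivity : 0 ≤ 8 * (γ * B))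
    linarith

theorem two_mul_add_two_le {Cμ α₀ α x cR : ℝ} (hC : 0 < Cμ) (hα₀ : 0 < α₀) (hα : α₀ ≤ α)
    (hx : 0 ≤ x) (h : (2 * Cμ * (1 + 2 / α₀) + x) * α ≤ cR) : 2 * Cμ * (α + 2) ≤ cR := by
  have h2 : 2 ≤ 2 / α₀ * α := by
    rw [div_mul_eq_mul_div, le_div_iff₀ hα₀]; linarith
  have h3 : 0 ≤ x * α := mul_nonneg hx (by linarith)
  have h4 := mul_le_mul_of_nonneg_left h2 (by positivity : 0 ≤ 2 * Cμ)
  linarith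

/-- The burn-in length `c₀(d + y)` is dominated by a multiple of the contraction time `1/θ`: a sum
is at most a constant times the product `dy`, and the step size makes `θdy` bounded. -/
theorem window_le {c₀ x K d y θ : ℝ} (hc₀ : 0 < c₀) (hx : 0 ≤ x) (hd : 1 ≤ d) (hy : 0 ≤ y)
    (hxy : 1 ≤ x * y) (hK : 0 < K) (hθ : 0 < θ) (hθ1 : θ ≤ 1) (hθK : θ * (8 * K * (d * y)) ≤ 1) :
    c₀ * (d + y) + 1 + 2 / (1 - Real.exp (-(θ / 16))) ≤ (c₀ * (x + 1) / (8 * K) + 65) / θ := by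
  have h1 := half_le_one_sub_exp_neg (by positivity : 0 ≤ θ / 16) (by linarith)
  have h2 : 2 / (1 - Real.exp (-(θ / 16))) ≤ 64 / θ := by
    rw [div_le_div_iff₀ (by linarith) hθ]
    linarith
  have h3 : 1 ≤ 1 / θ := (one_le_div hθ).2 hθ1
  have h4 : c₀ * (d + y) ≤ c₀ * (x + 1) / (8 * K) / θ := by
    rw [le_div_iff₀ hθ, le_div_iff₀ (by positivity)]
    have h5 : d + y ≤ (x + 1) * (d * y) := by
      have h6 := mul_le_mul_of_nonneg_left hxy (by linarith : 0 ≤ d)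
      have h7 := mul_le_mul_of_nonneg_right hd hy
      linarith
    have h6 := mul_le_mul_of_nonneg_left h5 (by positivity : 0 ≤ c₀ * θ * (8 * K))
    have h7 := mul_le_mul_of_nonneg_left hθK (by positivity : 0 ≤ c₀ * (x + 1))
    linarith
  have e : (c₀ * (x + 1) / (8 * K) + 65) / θ = c₀ * (x + 1) / (8 * K) / θ + 1 / θ + 64 / θ := by
    ring
  linarith

theorem drift_le {M x : ℝ} {t B T S : ℕ} (ht : 1 ≤ t) (hB : 1 ≤ B) (hBS : B ≤ S) (htT : t * S ≤ T)
    (hx : x ≤ M) (hM : 0 ≤ M) :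
    (t : ℝ) * (x + t / 4 + 1) ≤ (M + 2) * ((T : ℝ) ^ 2 / (B : ℝ) ^ 2) := by
  have ht1 : (1 : ℝ) ≤ t := by exact_mod_cast ht
  have hB1 : (1 : ℝ) ≤ B := by exact_mod_cast hB
  have htB : (t : ℝ) * B ≤ T := by exact_mod_cast (Nat.mul_le_mul_left t hBS).trans htT
  have h1 : (t : ℝ) ^ 2 ≤ (T : ℝ) ^ 2 / (B : ℝ) ^ 2 := by
    rw [le_div_iff₀ (by positivity), ← mul_pow]
    gcongr
  have h2 : x + t / 4 + 1 ≤ (M + 2) * t := by nlinarith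
  calc (t : ℝ) * (x + t / 4 + 1) ≤ t * ((M + 2) * t) := by gcongr
    _ = (M + 2) * (t : ℝ) ^ 2 := by ring
    _ ≤ _ := by gcongr

end Parameters

end SGDRER

/-! ### The main theorem -/

open SGDRER in
theorem mainTheorem1 (Cμ α₀ : ℝ) (hCμ : 0 < Cμ) (hα₀ : 0 < α₀) :
    ∃ c K C c₀ c₁ : ℝ, 0 < c ∧ 0 < K ∧ 0 < C ∧ 0 < c₀ ∧ 0 < c₁ ∧
    ∀ M : ℝ, 0 ≤ M → ∃ c₄ : ℝ, 0 < c₄ ∧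
    ∀ Cγ cR : ℝ, 0 < Cγ → 0 < cR → ∃ c₂ c₃ : ℝ, 0 < c₂ ∧ 0 < c₃ ∧
    ∀ (α : ℝ) (d T B u a t : ℕ) (Astar A₀ : Mat d) (μ π : Measure (E d))
      (Ω : Type*) [MeasurableSpace Ω] (P : Measure Ω) [IsProbabilityMeasure P]
      (X η : ℕ → Ω → E d) (γ R : ℝ),
      α₀ ≤ α → K * α ≤ cR →
      1 ≤ d → 1 ≤ B → a < t → t * (B + u) ≤ T →
      ‖Astar‖ < 1 → ‖A₀‖ ≤ M →
      IsSubGaussianNoise Cμ μ → IsStationaryLaw Astar μ π → IsVAR Astar μ π T P X η →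
      R = cR * tr (covMat π) * Real.log T →
      γ = min (Cγ / (B * lambdaMin (covMat π))) (1 / (8 * B * R)) →
      c * d * kappa (covMat π) < (T : ℝ) ^ (α / 2) →
      c₀ * (d + α * Real.log T) < a →
      1 - C / (T : ℝ) ^ α ≤
        P.real {ω | ‖sgdRER γ R B u a t A₀ (fun τ => X τ ω) - Astar‖ ≤
          c₁ * √((d + α * Real.log T) * sigmaMax (covMat μ) /
              (((t : ℝ) - a) * B * lambdaMin (covMat π)))
            + biasFactor c₂ c₃ d a t T (kappa (covMat π)) * ‖A₀ - Astar‖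
            + c₄ * ((T : ℝ) ^ 2 / (B : ℝ) ^ 2) * ‖Astar ^ u‖} := by
  have hK := one_le_momentConst hCμ
  set Km := momentConst Cμ with hKm
  have hl2 : 0 < Real.log 2 := Real.log_pos one_lt_two
  -- The first summand makes the tail probability at level `R` at most `2d T ^ (-(α + 2))`. The
  -- second gives `1 ≤ KαL`, from which `θ ≤ 1`.
  set K := 2 * Cμ * (1 + 2 / α₀) + 1 / (α₀ * Real.log 2) with hKd
  -- Long products decay at exponent `1/(16 Km)` per buffer, so this makes the total exponent `(3 +
  -- 2/α₀)(d + αL)`, which exceeds `2d + (α + 2)L`.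
  set c₀ := 16 * Km * (3 + 2 / α₀) with hc₀
  have hK0 : 0 < K := by positivity
  have hc₀0 : 0 < c₀ := by positivity
  set Cq := c₀ * (1 / (α₀ * Real.log 2) + 1) / (8 * K) + 65 with hCq
  have hCq0 : 0 < Cq := by positivity
  have hc₀8 : 8 * Km ≤ c₀ := by
    have : 0 ≤ 2 / α₀ := by positivity
    rw [hc₀]; nlinarith
  refine ⟨1, K, 13, c₀, 4 * √(32 * Cμ * Cq), one_pos, hK0, by norm_num, hc₀0, by positivity,
    fun M hM => ⟨M + 2, by positivity, fun Cγ cR hCγ hcR => ?_⟩⟩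
  set c' := min (Cγ * Real.log 2) (1 / (8 * cR)) with hc'
  have hc'0 : 0 < c' := lt_min (by positivity) (by positivity)
  refine ⟨c' / 16, 64 / c', by positivity, by positivity, ?_⟩
  intro α d T B u a t A A₀ μ π Ω _ P _ X η γ R hα hKα hd hB hat htT hA hA₀ hμ hπ hVAR hR hγ _ ha
  have hα0 : 0 < α := hα₀.trans_le hα
  have hd' : (1 : ℝ) ≤ d := by exact_mod_cast hd
  have hB' : (1 : ℝ) ≤ B := by exact_mod_cast hB
  -- With `a < t ≤ T` this yields `T ≥ 2`, so that `log T` is bounded below.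
  have ha0 : 1 ≤ a := by
    by_contra h
    obtain rfl : a = 0 := by omega
    have : 0 ≤ c₀ * (d + α * Real.log T) := by positivity
    simp only [Nat.cast_zero] at ha
    linarith
  have htT' : t ≤ T := (Nat.le_mul_of_pos_right t (by omega)).trans htT
  have hT2 : (2 : ℝ) ≤ T := by exact_mod_cast (by omega : 2 ≤ T)
  have haT : (a : ℝ) ≤ T := by exact_mod_cast (by omega : a ≤ T)
  set L := Real.log T with hL
  have hL2 : Real.log 2 ≤ L := Real.log_le_log two_pos hT2
  have hL0 : 0 < L := hl2.trans_le hL2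
  have hdc : c₀ * d ≤ T := by
    have : 0 ≤ c₀ * (α * L) := by positivity
    linarith [mul_add c₀ d (α * L)]
  have hdT : (d : ℝ) ≤ T := (le_mul_of_one_le_left (by positivity) (by linarith)).trans hdc
  have hGs := isSymmetric_covMat π
  have hGp : ∀ x : E d, x ≠ 0 → 0 < ⟪x, covMat π x⟫ := fun x hx => hπ.inner_covMat_pos hCμ hA hμ hx
  have hτκ := tr_le_mul_kappa_mul_lambdaMin hd hGs hGp
  have hτ : d * lambdaMin (covMat π) ≤ tr (covMat π) := mul_lambdaMin_le_tr hGs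
  have hΛ0 : 0 < lambdaMin (covMat π) := lambdaMin_pos hd hGs hGp
  set Λ := lambdaMin (covMat π) with hΛ
  set κ := kappa (covMat π) with hκ
  have hdκ : 1 ≤ d * κ := by
    have : 1 * Λ ≤ d * κ * Λ := (mul_le_mul_of_nonneg_right hd' hΛ0.le).trans (hτ.trans hτκ)
    exact le_of_mul_le_mul_right this hΛ0
  have hR0 : 0 ≤ R := by
    rw [hR]
    exact mul_nonneg (mul_nonneg hcR.le (le_trans (by positivity) hτ)) hL0.le
  obtain ⟨hγ0, hγR, hcθ, hθK⟩ := stepSize_bounds hCγ hcR hKα (by linarith) hL2 (by linarith) hΛ0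
    hτ hτκ hdκ hR hγ
  set θ := γ * B * Λ with hθ
  have hθ0 : 0 < θ := by positivity
  have hαL : 1 ≤ 1 / (α₀ * Real.log 2) * (α * L) := by
    rw [div_mul_eq_mul_div, one_mul, le_div_iff₀ (by positivity), one_mul]
    gcongr
  have hθ1 : θ ≤ 1 := by
    have h1 : 1 ≤ K * (α * L) := by
      have : 0 ≤ 2 * Cμ * (1 + 2 / α₀) * (α * L) := by positivity
      rw [hKd, add_mul]
      linarith
    have h2 : 1 ≤ d * (K * (α * L)) := one_le_mul_of_one_le_of_one_le hd' h1
    refine le_trans (le_mul_of_one_le_right hθ0.le ?_) hθK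
    linarith
  have htail : π.real {z | R < ‖z‖ ^ 2} ≤ 2 * d * Real.exp (-((α + 2) * L)) := by
    have h1 := hπ.measure_norm_sq_gt_le hCμ hA hμ (by positivity : 0 ≤ cR * L)
    have e : cR * L * tr (covMat π) = R := by rw [hR]; ring
    rw [e] at h1
    have h2 : (α + 2) * L ≤ cR * L / (2 * Cμ) := by
      rw [le_div_iff₀ (by positivity)]
      have := mul_le_mul_of_nonneg_right
        (two_mul_add_two_le hCμ hα₀ hα (by positivity) hKα) hL0.le
      linarith
    exact h1.trans (by gcongr)
  -- The tail is at most `2d/T`, while `T ≥ c₀ d ≥ 8 Km d` by the burn-in condition.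
  have hp : π.real {z | R < ‖z‖ ^ 2} ≤ 1 / (4 * Km) := by
    have h1 : Real.exp (-((α + 2) * L)) ≤ (T : ℝ)⁻¹ := by
      rw [← Real.exp_log (by linarith : (0 : ℝ) < T), ← Real.exp_neg, ← hL]
      refine Real.exp_le_exp.2 (neg_le_neg (le_mul_of_one_le_left hL0.le (by linarith)))
    refine (htail.trans (mul_le_mul_of_nonneg_left h1 (by positivity))).trans ?_
    rw [← div_eq_mul_inv, div_le_div_iff₀ (by linarith) (by positivity)]
    have := mul_le_mul_of_nonneg_right hc₀8 (by linarith : (0 : ℝ) ≤ d)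
    linarith
  -- The smallest moment order allowed by the one-buffer contraction; it gives the rate `θ/16` per
  -- buffer.
  set r := 1 / (2 * Km * θ) with hr
  have hr0 : 0 < r := by positivity
  have hrθ : 1 / (8 * Km) / (4 * r) = θ / 16 := by rw [hr]; field_simp; norm_num
  have hrθ' : 1 / (2 * Km) ≤ r * θ :=
    (by rw [hr]; field_simp : 1 / (2 * Km) = r * θ).le
  have hmain := hVAR.one_sub_le_measureReal hCμ hA hμ hπ hd (n₀ := c₀ * (d + α * L))
    (ℓ := 4 * d + α * L) hB hat htT hγ0 hR0 hγR hp hr0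
    hrθ' (by positivity) ha.le (by positivity) A₀ rfl rfl
  rw [← hKm, hrθ] at hmain
  refine le_trans (sub_le_sub_left ?_ _) (hmain.trans (measureReal_mono fun ω hω => ?_))
  · have h1 := failure_probability_le (κ := 1 / (8 * Km) / 2) (c₀ := c₀) (N := t) (S := B + u)
      hα₀ hα hL (by omega) (by exact_mod_cast hdT) (by omega) (by omega) htT htail
      measureReal_nonneg (by rw [hc₀]; field_simp; norm_num)
    push_cast at h1
    exact h1
  · refine (Set.mem_ofPred_eq ▸ hω : _ ≤ _).trans ?_
    rw [mul_add, add_comm (_ * (‖A₀ - A‖ * _))]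
    refine add_le_add (add_le_add ?_ ?_) ?_
    · have h1 : 0 < 1 - Real.exp (-(θ / 16)) :=
        sub_pos.2 (Real.exp_lt_one_iff.2 (by linarith))
      have h2 : 0 ≤ α * L := by positivity
      exact fluctuation_le hat hCμ (sigmaMax_pos hd fun x hx => hμ.inner_covMat_pos hx)
        (by linarith) hΛ0 hγ0 hθ
        (window_le hc₀0 (by positivity) hd' h2 hαL hK0 hθ0 hθ1 hθK) (by positivity)
        (by positivity) (by linarith)
    · exact bias_le_biasFactor hc'0 hθ0 hθ1 (norm_nonneg _) hat
        (by have := hl2.trans_le (hL2.trans (le_mul_of_one_le_left hL0.le hdκ)); exact this) hcθ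
    · rw [← mul_assoc]
      exact mul_le_mul_of_nonneg_right
        (drift_le (by omega) hB (Nat.le_add_right B u) htT hA₀ hM) (norm_nonneg _)
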